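/- Graphs are directed graphs $\Gamma=(V,E,o,t)$ (loops and multiple edges allowed) together with two sets $V^i(\Gamma),V^f(\Gamma)\subset V(\Gamma)$ of marked (initial and final) vertices, possibly empty; graph maps preserve both. A *path* is a graph map from a directed segment $I$, a *cycle* a graph map from a directed circle $S^1$. A path is *admissible* if it runs from an initial to a final vertex or is a loop. The *core* $\mathrm{core}(\Gamma)$ is the union of the images of all cycles, the *relative core* $\mathrm{rcore}(\Gamma)$ the union of the images of all admissible paths; $\Gamma$ is *relatively core* if $\Gamma=\mathrm{rcore}(\Gamma)$. $\Gamma$ is *connected* if any two vertices are equivalent under the equivalence relation generated by being joined by a path. A graph map is a *forwards immersion* if it is injective on the set of edges leaving each vertex. Let $\bar V(\Gamma)$ be the set of vertices whose indegree or outdegree is not $1$, and let $\bar E(\Gamma)$ be the set of (images of) nontrivial paths that repeat no edge, have both end points in $\bar V(\Gamma)$ and no inner vertex in $\bar V(\Gamma)$, together with the (images of) cycles that repeat no edge and do not meet $\bar V(\Gamma)$. Put $C_\Gamma=|\bar E(\Gamma)|+|V^i(\Gamma)|$, and let $\beta_1(\Gamma)$ be the first Betti number. The fibre product $\Gamma\times_\Delta\Lambda$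 of $\gamma:\Gamma\to\Delta$ and $\lambda:\Lambda\to\Delta$ has vertices (edges, initial vertices, final vertices) the pairs of vertices (edges, initial vertices, final vertices) with the same image in $\Delta$. The *degree* of a cycle is the largest degree of a covering map $S^1\to S^1$ through which it factors; a cycle is *primitive* if it does not factor properly through another cycle. For $\gamma:\Gamma\to\Delta$ let $s_\Gamma:\mathbb S_\Gamma\to\Gamma$ be the disjoint union, over all primitive cycles $f:S^1\to\Gamma$ (up to rotation) with $\deg(\gamma\circ f)\ge 12\,\beta_1(\Gamma)$, of the maps $f$; similarly $s_\Lambda:\mathbb S_\Lambda\to\Lambda$ for $\lambda$. Let $\mathbb S=\mathrm{core}(\mathbb S_\Gamma\times_\Delta\mathbb S_\Lambda)$ and let $s:\mathbb S\to\Gamma\times_\Delta\Lambda$ be the natural map. **Theorem.** (1) Let $\Gamma,\Lambda$ be finite, connected, relatively core graphs, $\Delta$ a graph, and $\gamma:\Gamma\to\Delta$, $\lambda:\Lambda\to\Delta$ forwards immersions. Put $\Theta=\mathrm{rcore}(\Gamma\times_\Delta\Lambda)$. Then $$|E(\Theta)\setminus E(s(\mathbb S))|\le 508\cdot C_\Gamma\cdot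 C_\Lambda\cdot\bigl(|\bar E(\Lambda)|\cdot|E(\Gamma)|+|\bar E(\Gamma)|\cdot|E(\Lambda)|\bigr).$$ (2) There is a universal constant $C>0$ such that for all finite graphs $\Gamma,\Lambda$, every graph $\Delta$ and all forwards immersions $\gamma:\Gamma\to\Delta$, $\lambda:\Lambda\to\Delta$, $$|E(\mathrm{core}(\Gamma\times_\Delta\Lambda))\setminus E(s(\mathbb S))|\le C\cdot(\beta_1(\Gamma)\cdot\beta_1(\Lambda))^2\cdot(|E(\Gamma)|+|E(\Lambda)|).$$ -/

import Mathlib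

universe u₁ v₁ u₂ v₂ u₃ v₃

/-- A directed graph (loops and multiple edges allowed) with two sets of marked vertices, the
initial ones `Vi` and the final ones `Vf`. A graph without marked vertices has `Vi = Vf = ∅`. -/
structure MGraph where
  V : Type u₁
  E : Type v₁
  /-- origin -/
  o : E → V
  /-- target -/
  t : E → V
  /-- initial vertices -/
  Vi : Set V
  /-- final vertices -/
  Vf : Set V

namespace MGraph

/-- Graph maps; they preserve the marked vertices. -/
@[ext]
structure Hom (Γ : MGraph.{u₁, v₁}) (Δ : MGraph.{u₂, v₂}) where
  onV : Γ.V → Δ.V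
  onE : Γ.E → Δ.E
  o_comm : ∀ e, onV (Γ.o e) = Δ.o (onE e)
  t_comm : ∀ e, onV (Γ.t e) = Δ.t (onE e)
  map_Vi : ∀ v ∈ Γ.Vi, onV v ∈ Δ.Vi
  map_Vf : ∀ v ∈ Γ.Vf, onV v ∈ Δ.Vf

/-- Composition of graph maps (`g` after `f`). -/
def Hom.comp {Γ : MGraph.{u₁, v₁}} {Δ : MGraph.{u₂, v₂}} {Ξ : MGraph.{u₃, v₃}}
    (g : Hom Δ Ξ) (f : Hom Γ Δ) : Hom Γ Ξ where
  onV := g.onV ∘ f.onV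
  onE := g.onE ∘ f.onE
  o_comm e := by simp [f.o_comm, g.o_comm]
  t_comm e := by simp [f.t_comm, g.t_comm]
  map_Vi v hv := g.map_Vi _ (f.map_Vi v hv)
  map_Vf v hv := g.map_Vf _ (f.map_Vf v hv)

/-- Forwards star: the edges with origin `v`. -/
def fstar (Γ : MGraph.{u₁, v₁}) (v : Γ.V) : Set Γ.E := {e | Γ.o e = v}

/-- Backwards star: the edges with target `v`. -/
def bstar (Γ : MGraph.{u₁, v₁}) (v : Γ.V) : Set Γ.E := {e | Γ.t e = v}

/-- A graph map is a forwards immersion if it is injective on every forwards star. -/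
def Hom.IsForwardsImmersion {Γ : MGraph.{u₁, v₁}} {Δ : MGraph.{u₂, v₂}} (γ : Hom Γ Δ) : Prop :=
  ∀ v : Γ.V, Set.InjOn γ.onE (Γ.fstar v)

/-- The segment with `k` edges. -/
def segment (k : ℕ) : MGraph.{0, 0} where
  V := Fin (k + 1)
  E := Fin k
  o := Fin.castSucc
  t := Fin.succ
  Vi := ∅
  Vf := ∅

/-- The circle with `n` edges; only used for `0 < n`. -/
def circle (n : ℕ) : MGraph.{0, 0} where
  V := ZMod n
  E := ZMod n
  o := fun i => i
  t := fun i => i + 1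
  Vi := ∅
  Vf := ∅

/-- A path of length `k` is a graph map from the segment with `k` edges. -/
abbrev Path (Γ : MGraph.{u₁, v₁}) (k : ℕ) := Hom (segment k) Γ

/-- A cycle of length `n` (with `0 < n`) is a graph map from the circle with `n` edges. -/
abbrev Cyc (Γ : MGraph.{u₁, v₁}) (n : ℕ) := Hom (circle n) Γ

/-- Origin of a path. -/
def Path.source {Γ : MGraph.{u₁, v₁}} {k : ℕ} (p : Path Γ k) : Γ.V := p.onV (0 : Fin (k + 1))

/-- Target of a path. -/
def Path.target {Γ : MGraph.{u₁, v₁}} {k : ℕ} (p : Path Γ k) : Γ.V := p.onV (Fin.last k)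

/-- A path is admissible if it runs from an initial to a final vertex or is a loop. -/
def Path.IsAdmissible {Γ : MGraph.{u₁, v₁}} {k : ℕ} (p : Path Γ k) : Prop :=
  (p.source ∈ Γ.Vi ∧ p.target ∈ Γ.Vf) ∨ p.source = p.target

/-- A graph is connected if it has exactly one class under the equivalence relation generated by
"there is a path from `u` to `v`". -/
def Connected (Γ : MGraph.{u₁, v₁}) : Prop :=
  Nonempty Γ.V ∧ ∀ u v : Γ.V,
    Relation.EqvGen (fun a b => ∃ (k : ℕ) (p : Path Γ k), p.source = a ∧ p.target = b) u v

/-- Subgraphs, given by a set of vertices and a set of edges. -/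
structure Sub (Γ : MGraph.{u₁, v₁}) where
  verts : Set Γ.V
  edges : Set Γ.E
  o_mem : ∀ e ∈ edges, Γ.o e ∈ verts
  t_mem : ∀ e ∈ edges, Γ.t e ∈ verts

/-- The core: the union of the images of all cycles. -/
def core (Γ : MGraph.{u₁, v₁}) : Sub Γ where
  verts := {v | ∃ (n : ℕ) (_ : 0 < n) (f : Cyc Γ n), v ∈ Set.range f.onV}
  edges := {e | ∃ (n : ℕ) (_ : 0 < n) (f : Cyc Γ n), e ∈ Set.range f.onE}
  o_mem := by
    rintro _ ⟨n, hn, f, i, rfl⟩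
    exact ⟨n, hn, f, _, f.o_comm i⟩
  t_mem := by
    rintro _ ⟨n, hn, f, i, rfl⟩
    exact ⟨n, hn, f, _, f.t_comm i⟩

/-- The relative core: the union of the images of all admissible paths. -/
def rcore (Γ : MGraph.{u₁, v₁}) : Sub Γ where
  verts := {v | ∃ (k : ℕ) (p : Path Γ k), p.IsAdmissible ∧ v ∈ Set.range p.onV}
  edges := {e | ∃ (k : ℕ) (p : Path Γ k), p.IsAdmissible ∧ e ∈ Set.range p.onE}
  o_mem := by
    rintro _ ⟨k, p, hp, i, rfl⟩
    exact ⟨k, p, hp, _, p.o_comm i⟩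
  t_mem := by
    rintro _ ⟨k, p, hp, i, rfl⟩
    exact ⟨k, p, hp, _, p.t_comm i⟩

/-- The standard map from a segment onto a circle. -/
def wrap (n : ℕ) : Hom (segment n) (circle n) where
  onV := fun i : Fin (n + 1) => ((i : ℕ) : ZMod n)
  onE := fun i : Fin n => ((i : ℕ) : ZMod n)
  o_comm _ := rfl
  t_comm i := Nat.cast_succ (R := ZMod n) (Fin.val (n := n) i)
  map_Vi _ h := h.elim
  map_Vf _ h := h.elim

/-- The core is contained in the relative core. -/
theorem core_edges_subset_rcore (Γ : MGraph.{u₁, v₁}) : Γ.core.edges ⊆ Γ.rcore.edges := by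
  rintro _ ⟨n, hn, f, i, rfl⟩
  have : NeZero n := ⟨hn.ne'⟩
  refine ⟨n, f.comp (wrap n), Or.inr ?_, (⟨ZMod.val (n := n) i, ZMod.val_lt _⟩ : Fin n), ?_⟩
  · refine congrArg f.onV ?_
    change (((0 : Fin (n + 1)) : ℕ) : ZMod n) = ((Fin.last n : ℕ) : ZMod n)
    simp
  · exact congrArg f.onE (ZMod.natCast_zmod_val (n := n) i)

/-- A graph is relatively core if it is equal to its relative core. -/
def IsRelCore (Γ : MGraph.{u₁, v₁}) : Prop :=
  (rcore Γ).verts = Set.univ ∧ (rcore Γ).edges = Set.univ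

/-- The vertices whose indegree or outdegree is not `1`. -/
def Vbar (Γ : MGraph.{u₁, v₁}) : Set Γ.V :=
  {v | (Γ.bstar v).ncard ≠ 1 ∨ (Γ.fstar v).ncard ≠ 1}

/-- The set of long edges, each of them regarded as a subgraph and recorded through its set of
edges (which determines it): the nontrivial paths that repeat no edge, whose two end points are in
`Vbar` and whose inner vertices are not, and the cycles that repeat no edge and miss `Vbar`. -/
def Ebar (Γ : MGraph.{u₁, v₁}) : Set (Set Γ.E) :=
  {S | (∃ (k : ℕ) (_ : 0 < k) (p : Path Γ k), Function.Injective p.onE ∧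
          (∀ i : Fin (k + 1), p.onV i ∈ Γ.Vbar ↔ i = 0 ∨ i = Fin.last k) ∧
          S = Set.range p.onE) ∨
       (∃ (n : ℕ) (_ : 0 < n) (f : Cyc Γ n), Function.Injective f.onE ∧
          (∀ i, f.onV i ∉ Γ.Vbar) ∧ S = Set.range f.onE)}

/-- The constant `|Ē(Γ)| + |Vⁱ(Γ)|`. -/
noncomputable def graphConst (Γ : MGraph.{u₁, v₁}) : ℕ := Γ.Ebar.ncard + Γ.Vi.ncard

/-- The cellular boundary map on rational `1`-chains, `e ↦ t e - o e`. -/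
noncomputable def boundary (Γ : MGraph.{u₁, v₁}) : (Γ.E →₀ ℚ) →ₗ[ℚ] (Γ.V →₀ ℚ) :=
  Finsupp.lift (Γ.V →₀ ℚ) ℚ Γ.E
    (fun e => Finsupp.single (Γ.t e) 1 - Finsupp.single (Γ.o e) 1)

/-- The first Betti number: the dimension of the first (cellular) homology group. -/
noncomputable def betti₁ (Γ : MGraph.{u₁, v₁}) : ℕ :=
  Module.finrank ℚ (LinearMap.ker Γ.boundary)

/-- The fibre product graph. -/
def fibreProd {Γ : MGraph.{u₁, v₁}} {Λ : MGraph.{u₂, v₂}} {Δ : MGraph.{u₃, v₃}}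
    (γ : Hom Γ Δ) (lam : Hom Λ Δ) : MGraph.{max u₁ u₂, max v₁ v₂} where
  V := {x : Γ.V × Λ.V // γ.onV x.1 = lam.onV x.2}
  E := {e : Γ.E × Λ.E // γ.onE e.1 = lam.onE e.2}
  o := fun e => ⟨(Γ.o e.1.1, Λ.o e.1.2), by rw [γ.o_comm, lam.o_comm, e.2]⟩
  t := fun e => ⟨(Γ.t e.1.1, Λ.t e.1.2), by rw [γ.t_comm, lam.t_comm, e.2]⟩
  Vi := {x | x.1.1 ∈ Γ.Vi ∧ x.1.2 ∈ Λ.Vi}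
  Vf := {x | x.1.1 ∈ Γ.Vf ∧ x.1.2 ∈ Λ.Vf}

/-- The degree of a cycle: the largest degree of a covering map of circles through which it
factors. Every graph map from the circle of length `d * m` to the circle of length `m` is a covering
map of degree `d`. -/
noncomputable def Cyc.deg {Γ : MGraph.{u₁, v₁}} {n : ℕ} (f : Cyc Γ n) : ℕ :=
  sSup {d | ∃ (m : ℕ) (_ : 0 < m) (π : Hom (circle n) (circle m)) (g : Cyc Γ m),
    f = g.comp π ∧ n = d * m}

/-- A cycle is primitive if it does not factor properly through another cycle. -/
def Cyc.IsPrimitive {Γ : MGraph.{u₁, v₁}} {n : ℕ} (f : Cyc Γ n) : Prop :=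
  ∀ (m : ℕ) (_ : 0 < m) (π : Hom (circle n) (circle m)) (g : Cyc Γ m), f = g.comp π → m = n

/-- The rotation of a circle by `c` steps. -/
def rot (n : ℕ) (c : ZMod n) : Hom (circle n) (circle n) where
  onV := fun i : ZMod n => (i + c : ZMod n)
  onE := fun i : ZMod n => (i + c : ZMod n)
  o_comm _ := rfl
  t_comm i := add_right_comm (G := ZMod n) i 1 c
  map_Vi _ h := h.elim
  map_Vf _ h := h.elim

theorem comp_rot_rot {Γ : MGraph.{u₁, v₁}} {n : ℕ} (f : Cyc Γ n) (c d : ZMod n)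
    (h : c + d = 0) : Hom.comp (Hom.comp f (rot n c)) (rot n d) = f := by
  have key : ∀ i : ZMod n, i + d + c = i := fun i => by rw [add_assoc, add_comm d, h, add_zero]
  ext i
  · exact congrArg f.onV (key i)
  · exact congrArg f.onE (key i)

theorem factors_rot {Γ : MGraph.{u₁, v₁}} {n m : ℕ} (f : Cyc Γ n) (c : ZMod n)
    (g : Cyc Γ m) :
    (∃ π : Hom (circle n) (circle m), Hom.comp f (rot n c) = g.comp π) ↔
      ∃ π : Hom (circle n) (circle m), f = g.comp π := by
  constructor
  · rintro ⟨π, h⟩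
    refine ⟨π.comp (rot n (-c)), ?_⟩
    rw [← comp_rot_rot f c (-c) (by simp), h]
    rfl
  · rintro ⟨π, rfl⟩
    exact ⟨π.comp (rot n c), rfl⟩

theorem Cyc.IsPrimitive.rot {Γ : MGraph.{u₁, v₁}} {n : ℕ} {f : Cyc Γ n}
    (hf : Cyc.IsPrimitive f) (c : ZMod n) : Cyc.IsPrimitive (Hom.comp f (MGraph.rot n c)) := by
  intro m hm π g h
  obtain ⟨π', h'⟩ := (factors_rot f c g).1 ⟨π, h⟩
  exact hf m hm π' g h'

theorem Cyc.deg_rot {Γ : MGraph.{u₁, v₁}} {n : ℕ} (f : Cyc Γ n) (c : ZMod n) :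
    Cyc.deg (Hom.comp f (MGraph.rot n c)) = Cyc.deg f := by
  unfold Cyc.deg
  congr 1
  ext d
  constructor
  · rintro ⟨m, hm, π, g, h, hd⟩
    obtain ⟨π', h'⟩ := (factors_rot f c g).1 ⟨π, h⟩
    exact ⟨m, hm, π', g, h', hd⟩
  · rintro ⟨m, hm, π, g, h, hd⟩
    obtain ⟨π', h'⟩ := (factors_rot f c g).2 ⟨π, h⟩
    exact ⟨m, hm, π', g, h', hd⟩

/-- The primitive cycles `f` in `Γ`, each with the base point that its parametrisation gives it,
such that the degree of `γ ∘ f` is at least `12 * β₁(Γ)`. -/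
structure LongCycle {Γ : MGraph.{u₁, v₁}} {Δ : MGraph.{u₂, v₂}} (γ : Hom Γ Δ) where
  len : ℕ
  len_pos : 0 < len
  cyc : Cyc Γ len
  primitive : Cyc.IsPrimitive cyc
  long : 12 * Γ.betti₁ ≤ Cyc.deg (γ.comp cyc)

/-- Move the base point of a long cycle one step forwards. -/
def LongCycle.next {Γ : MGraph.{u₁, v₁}} {Δ : MGraph.{u₂, v₂}} {γ : Hom Γ Δ}
    (c : LongCycle γ) : LongCycle γ where
  len := c.len
  len_pos := c.len_pos
  cyc := Hom.comp c.cyc (rot c.len 1)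
  primitive := c.primitive.rot 1
  long := (Cyc.deg_rot (γ.comp c.cyc) 1).symm ▸ c.long

/-- The graph `𝕊_Γ` of long cycles: the disjoint union of one circle for each primitive cycle `f`
of `Γ` (up to rotation) with `deg (γ ∘ f) ≥ 12 * β₁(Γ)`. A vertex is such a cycle with a base
point, an edge is such a cycle with a distinguished edge, recorded through the origin of that edge;
the rotation class of a primitive cycle of length `n` contributes a circle with `n` vertices and `n`
edges. -/
def longCycles {Γ : MGraph.{u₁, v₁}} {Δ : MGraph.{u₂, v₂}} (γ : Hom Γ Δ) :
    MGraph.{max u₁ v₁, max u₁ v₁} where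
  V := LongCycle γ
  E := LongCycle γ
  o := fun c => c
  t := fun c => c.next
  Vi := ∅
  Vf := ∅

/-- The natural map `s_Γ : 𝕊_Γ → Γ`: base points and distinguished edges. -/
def longCyclesMap {Γ : MGraph.{u₁, v₁}} {Δ : MGraph.{u₂, v₂}} (γ : Hom Γ Δ) :
    Hom (longCycles γ) Γ where
  onV := fun c : LongCycle γ => c.cyc.onV (0 : ZMod c.len)
  onE := fun c : LongCycle γ => c.cyc.onE (0 : ZMod c.len)
  o_comm c := LongCycle.cyc c |>.o_comm (0 : ZMod (LongCycle.len c))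
  t_comm c := LongCycle.cyc c |>.t_comm (0 : ZMod (LongCycle.len c))
  map_Vi _ h := h.elim
  map_Vf _ h := h.elim

section Product

variable {Γ : MGraph.{u₁, v₁}} {Λ : MGraph.{u₂, v₂}} {Δ : MGraph.{u₃, v₃}}
  (γ : Hom Γ Δ) (lam : Hom Λ Δ)

/-- The fibre product `𝕊_Γ ×_Δ 𝕊_Λ` of the graphs of long cycles. -/
def longProd : MGraph :=
  fibreProd (γ.comp (longCyclesMap γ)) (lam.comp (longCyclesMap lam))

/-- The natural map `𝕊_Γ ×_Δ 𝕊_Λ → Γ ×_Δ Λ` induced by `s_Γ` and `s_Λ`. -/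
def longProdMap : Hom (longProd γ lam) (fibreProd γ lam) where
  onV := fun x => ⟨((longCyclesMap γ).onV x.1.1, (longCyclesMap lam).onV x.1.2), x.2⟩
  onE := fun e => ⟨((longCyclesMap γ).onE e.1.1, (longCyclesMap lam).onE e.1.2), e.2⟩
  o_comm e := Subtype.ext (Prod.ext ((longCyclesMap γ).o_comm e.1.1)
    ((longCyclesMap lam).o_comm e.1.2))
  t_comm e := Subtype.ext (Prod.ext ((longCyclesMap γ).t_comm e.1.1)
    ((longCyclesMap lam).t_comm e.1.2))
  map_Vi _ h := h.1.elim
  map_Vf _ h := h.1.elim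

/-- The edges of `s(𝕊)`, the image in `Γ ×_Δ Λ` of the core `𝕊` of `𝕊_Γ ×_Δ 𝕊_Λ`. -/
def longImageEdges : Set (fibreProd γ lam).E :=
  (longProdMap γ lam).onE '' (core (longProd γ lam)).edges

/-- `s(𝕊)` lies in the core of `Γ ×_Δ Λ`. -/
theorem longImageEdges_subset_core :
    longImageEdges γ lam ⊆ (core (fibreProd γ lam)).edges := by
  rintro _ ⟨_, ⟨n, hn, f, i, rfl⟩, rfl⟩
  exact ⟨n, hn, (longProdMap γ lam).comp f, i, rfl⟩

end Product

end MGraph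

/-! Label each edge of `Γ` and `Λ` by its image in `Δ`. For a forwards immersion, origin and label
determine an edge, so a walk is determined by its first edge and its labels, and the edges of the
fibre product are the pairs of edges with equal labels. Cut `Γ` and `Λ` into chains, whose inner
vertices have exactly one incoming and one outgoing edge. The pairs from a chain of length `m` and
one of length `n` form a rectangle, and walks in the fibre product run along its diagonals. It
suffices to bound the bad pairs in each rectangle by a constant times `m + n` and to sum. The only
property of the (relative) core that matters is `BackClosed`: every edge has a predecessor in it or
begins at a pair of initial vertices.

Few pairs lie behind a pair of initial vertices (`card_le_of_behind`). For any other pair the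
beginning of its diagonal is in the set as well. If the labels on this diagonal do not all agree,
its history leads back to a source, a pair of first edges of chains or a pair of initial vertices,
and the source determines the diagonal (`card_le_of_not_full`).

The diagonals on which all labels agree are grouped by a greedy covering (`exists_separated`) around
long ones: a cluster lies within `L / 4` of a diagonal of length `L`, and the lengths `L` add up to
at most `4 * (m + n)`. Two full diagonals at distance `δ` force the period `δ` on the labels, so a
cluster reads one primitive periodic word `w` whose least period `p` divides all the distances
(`dvd_of_least_period`). Choose an edge on each of the two chains that every diagonal of the cluster
meets. If both lie on closed walks that read `w`, with `D` and `D'` periods, then either both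
numbers reach the thresholds and all pairs lie in `s(𝕊)`, or one is small and the closed walk
repeats so soon that few pairs are left (`sum_diagCount_le_of_periodic`). Otherwise follow each
diagonal back to where `w` begins to be read. Each of the two walks passes a gate, and the pair of
gates determines the diagonal (`card_le_of_not_periodic`).

The heart is that there are few gates (`ncard_gates_le`). Order the phases of `w` lexicographically
by the words read from them. Consider walks reading `w` that end at one fixed edge in one fixed
phase; let each pass the least phase `φ₁` and after that the greatest phase `φ₂`. Its position at
`φ₂` is the gate. Among the phases in which an edge is met after `φ₁`, the greatest one moves along
with the walks, because a common first letter does not affect the order. So walks that enter their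
greatest phase in the same segment of a chain merge, and each segment accounts for at most two
gates.

Finally, the number of chains is bounded by `|Ē|` in (1) and, on the cores, by `4 * β₁` in (2); `β₁`
is at most the number of chains of the whole graph. -/

/-- A graph whose edges are labelled in such a way that an edge is determined by its origin and its
label, together with a set of initial vertices. -/
structure LGraph.{a, v, e} (A : Type a) where
  V : Type v
  E : Type e
  o : E → V
  t : E → V
  lab : E → A
  Vi : Set V
  det : ∀ x y, o x = o y → lab x = lab y → x = y

/-! ### Walks labelled by a periodic word, and chains of edges -/

namespace LGraph

variable {A : Type*}

/-- A decomposition of the edges into chains: inner vertices of a chain have exactly one incoming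
and one outgoing edge. -/
structure Chains (S : LGraph A) (ι : Type*) where
  idx : S.E → ι
  pos : S.E → ℕ
  prev : S.E → S.E
  ext : ∀ x y, idx x = idx y → pos x = pos y → x = y
  idx_prev : ∀ x, pos x ≠ 0 → idx (prev x) = idx x
  pos_prev : ∀ x, pos x ≠ 0 → pos (prev x) + 1 = pos x
  t_prev : ∀ x, pos x ≠ 0 → S.t (prev x) = S.o x
  eq_prev : ∀ x y, pos x ≠ 0 → S.t y = S.o x → y = prev x
  eq_of_o : ∀ x y, pos x ≠ 0 → S.o y = S.o x → y = x

/-- `c 0, …, c T` are the edges of a walk labelled by the periodic word `w`, read from phase `φ`. -/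
def IsWalk (S : LGraph A) {p : ℕ} (w : ZMod p → A) (φ : ZMod p) (c : ℕ → S.E) (T : ℕ) : Prop :=
  (∀ k < T, S.t (c k) = S.o (c (k + 1))) ∧ ∀ k ≤ T, S.lab (c k) = w (φ + k)

theorem phase_add {p : ℕ} {φ φ' : ZMod p} {x y : ℕ} (h : φ + x = φ' + y) (j : ℕ) :
    φ + (x + j : ℕ) = φ' + (y + j : ℕ) := by
  push_cast
  linear_combination h

/-- Determinism: from a common edge in a common phase the next label is prescribed, and origin and
label determine the next edge. -/
theorem IsWalk.agree {S : LGraph A} {p : ℕ} {w : ZMod p → A} {φ φ' : ZMod p} {c c' : ℕ → S.E}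
    {T T' : ℕ} (h : S.IsWalk w φ c T) (h' : S.IsWalk w φ' c' T') {x y : ℕ} (hc : c x = c' y)
    (hφ : φ + x = φ' + y) (j : ℕ) (hx : x + j ≤ T) (hy : y + j ≤ T') :
    c (x + j) = c' (y + j) := by
  induction j with
  | zero => exact hc
  | succ j ih =>
    have e := ih (by omega) (by omega)
    have h1 := h.1 (x + j) (by omega)
    have h2 := h'.1 (y + j) (by omega)
    have h3 := h.2 (x + (j + 1)) hx
    have h4 := h'.2 (y + (j + 1)) hy
    refine S.det _ _ ?_ ?_
    · rw [← add_assoc, ← add_assoc, ← h1, ← h2, e]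
    · rw [h3, h4, phase_add hφ]

/-- An edge read in phase `φ` at which a walk labelled by `w` may begin. -/
def IsStart (S : LGraph A) {p : ℕ} (w : ZMod p → A) (φ : ZMod p) (e : S.E) : Prop :=
  S.o e ∈ S.Vi ∨ ∃ e₀, S.t e₀ = S.o e ∧ S.lab e₀ ≠ w (φ - 1)

/-- A walk labelled by `w` from a start edge to the edge `ρ` in phase `ψ`, together with the first
time `n` at which its phase is `φ₁` and the first time `m` after that at which it is `φ₂`. -/
structure Entry (S : LGraph A) {p : ℕ} (w : ZMod p → A) (φ₁ φ₂ : ZMod p) (ρ : S.E)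
    (ψ : ZMod p) where
  c : ℕ → S.E
  φ : ZMod p
  T : ℕ
  n : ℕ
  m : ℕ
  walk : S.IsWalk w φ c T
  start : S.IsStart w φ (c 0)
  c_T : c T = ρ
  φ_T : φ + T = ψ
  φ_n : φ + n = φ₁
  n_min : ∀ k < n, φ + k ≠ φ₁
  n_le : n ≤ m
  φ_m : φ + m = φ₂
  m_min : ∀ k, n ≤ k → k < m → φ + k ≠ φ₂
  m_le : m ≤ T

namespace Chains

variable {S : LGraph A} {ι : Type*} (C : S.Chains ι)

theorem idx_pos_prev_iterate (x : S.E) (r : ℕ) (hr : r ≤ C.pos x) :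
    C.idx (C.prev^[r] x) = C.idx x ∧ C.pos (C.prev^[r] x) = C.pos x - r := by
  induction r with
  | zero => simp
  | succ r ih =>
    obtain ⟨h1, h2⟩ := ih (by omega)
    rw [Function.iterate_succ_apply']
    have h0 : C.pos (C.prev^[r] x) ≠ 0 := by omega
    have := C.pos_prev _ h0
    exact ⟨(C.idx_prev _ h0).trans h1, by omega⟩

theorem prev_iterate_eq {x y : S.E} (h : C.idx x = C.idx y) (hxy : C.pos x ≤ C.pos y) :
    C.prev^[C.pos y - C.pos x] y = x := by
  obtain ⟨h1, h2⟩ := C.idx_pos_prev_iterate y (C.pos y - C.pos x) (by omega)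
  exact C.ext _ _ (h1.trans h.symm) (by omega)

/-- A walk can be followed backwards along a chain. -/
theorem walk_backwards {p : ℕ} {w : ZMod p → A} {φ : ZMod p} {c : ℕ → S.E} {T : ℕ}
    (h : S.IsWalk w φ c T) {k : ℕ} (hk : k ≤ T) (r : ℕ) (hr : r ≤ k) (hr' : r ≤ C.pos (c k)) :
    c (k - r) = C.prev^[r] (c k) := by
  induction r with
  | zero => simp
  | succ r ih =>
    have e := ih (by omega) (by omega)
    rw [Function.iterate_succ_apply', ← e]
    have h0 : C.pos (c (k - r)) ≠ 0 := by
      have := (C.idx_pos_prev_iterate (c k) r (by omega)).2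
      rw [e]; omega
    refine C.eq_prev _ _ h0 ?_
    have := h.1 (k - (r + 1)) (by omega)
    rwa [show k - (r + 1) + 1 = k - r by omega] at this

/-- Segments: the chains are cut in front of the edges in a set `B`. -/
theorem exists_head (B : Set S.E) (hB : ∀ x, C.pos x = 0 → x ∈ B) :
    ∃ hd : S.E → S.E, (∀ x, hd x ∈ B) ∧ ∀ x y, hd x = hd y →
      C.idx x = C.idx y ∧
        ∀ z ∈ B, C.idx z = C.idx x → C.pos x < C.pos z → C.pos z ≤ C.pos y → False := by
  have key : ∀ (n : ℕ) (x : S.E), C.pos x = n → ∃ z ∈ B, C.idx z = C.idx x ∧ C.pos z ≤ C.pos x ∧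
      ∀ z' ∈ B, C.idx z' = C.idx x → C.pos z < C.pos z' → C.pos z' ≤ C.pos x → False := by
    intro n
    induction n with
    | zero =>
      intro x hx
      exact ⟨x, hB x hx, rfl, le_rfl, fun z' _ _ h1 h2 => by omega⟩
    | succ n ih =>
      intro x hx
      by_cases hxB : x ∈ B
      · exact ⟨x, hxB, rfl, le_rfl, fun z' _ _ h1 h2 => by omega⟩
      · have h0 : C.pos x ≠ 0 := by omega
        have h1 := C.pos_prev x h0
        have h2 := C.idx_prev x h0
        obtain ⟨z, hz, hi, hp, hz'⟩ := ih (C.prev x) (by omega)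
        refine ⟨z, hz, hi.trans h2, by omega, fun z' hz'B hi' hlt hle => ?_⟩
        by_cases hE : C.pos z' = C.pos x
        · exact hxB (C.ext _ _ hi' hE ▸ hz'B)
        · exact hz' z' hz'B (hi'.trans h2.symm) hlt (by omega)
  choose hd h1 h2 h3 h4 using fun x => key (C.pos x) x rfl
  refine ⟨hd, h1, fun x y hxy => ?_⟩
  have hi : C.idx x = C.idx y := by rw [← h2 x, ← h2 y, hxy]
  refine ⟨hi, fun z hz hiz hlt hle => ?_⟩
  have := h3 x
  exact h4 y z hz (hiz.trans hi) (by rw [← hxy]; omega) hle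

end Chains

/-! ### Counting the gates of the walks that end at a fixed edge in a fixed phase -/

section EntryCount

variable {S : LGraph A} {ι : Type*} (C : S.Chains ι) {p : ℕ} {w : ZMod p → A}
  {O : Type*} [LinearOrder O] {rank : ZMod p → O} {φ₁ φ₂ : ZMod p} {ρ : S.E} {ψ : ZMod p}

/-- The nodes (edges with a phase) on the walks of all entries after the time `n`. -/
def Active (S : LGraph A) {p : ℕ} (w : ZMod p → A) (φ₁ φ₂ : ZMod p) (ρ : S.E) (ψ : ZMod p)
    (e : S.E) (φ : ZMod p) : Prop :=
  ∃ K : Entry S w φ₁ φ₂ ρ ψ, ∃ x, K.n ≤ x ∧ x ≤ K.T ∧ K.c x = e ∧ K.φ + x = φ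

/-- The phase `φ` has maximal rank among the phases in which `e` is active. -/
def IsTop (S : LGraph A) {p : ℕ} (w : ZMod p → A) (rank : ZMod p → O) (φ₁ φ₂ : ZMod p) (ρ : S.E)
    (ψ : ZMod p) (e : S.E) (φ : ZMod p) : Prop :=
  Active S w φ₁ φ₂ ρ ψ e φ ∧ ∀ φ', Active S w φ₁ φ₂ ρ ψ e φ' → rank φ' ≤ rank φ

theorem IsTop.unique (inj : Function.Injective rank) {e : S.E} {φ φ' : ZMod p}
    (h : IsTop S w rank φ₁ φ₂ ρ ψ e φ) (h' : IsTop S w rank φ₁ φ₂ ρ ψ e φ') : φ = φ' :=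
  inj (le_antisymm (h'.2 _ h.1) (h.2 _ h'.1))

/-- Inside a segment the top phase moves along with the walk. -/
theorem IsTop.along
    (mono : ∀ φ φ', w φ = w φ' → rank φ ≤ rank φ' → rank (φ + 1) ≤ rank (φ' + 1))
    (bot : ∀ φ, rank φ₁ ≤ rank φ)
    (K : Entry S w φ₁ φ₂ ρ ψ) {x : ℕ} (hx : K.n ≤ x) (hxT : x ≤ K.T)
    (htop : IsTop S w rank φ₁ φ₂ ρ ψ (K.c x) (K.φ + x)) {y : S.E} (hi : C.idx (K.c x) = C.idx y)
    (hpos : C.pos (K.c x) ≤ C.pos y)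
    (hρ : ∀ z, C.idx z = C.idx y → C.pos (K.c x) < C.pos z → C.pos z ≤ C.pos y →
      ¬ (C.idx z = C.idx ρ ∧ C.pos z = C.pos ρ + 1))
    (j : ℕ) (hj : C.pos (K.c x) + j ≤ C.pos y) :
    x + j ≤ K.T ∧ K.c (x + j) = C.prev^[C.pos y - C.pos (K.c x) - j] y ∧
      IsTop S w rank φ₁ φ₂ ρ ψ (K.c (x + j)) (K.φ + (x + j : ℕ)) := by
  induction j with
  | zero => exact ⟨hxT, (C.prev_iterate_eq hi hpos).symm, htop⟩
  | succ j ih =>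
    obtain ⟨h1, h2, h3⟩ := ih (by omega)
    set r := C.pos y - C.pos (K.c x) - (j + 1) with hr
    have hr' : C.pos y - C.pos (K.c x) - j = r + 1 := by omega
    rw [hr'] at h2
    set g := C.prev^[r] y with hg
    obtain ⟨g1, g2⟩ := C.idx_pos_prev_iterate y r (by omega)
    rw [← hg] at g1 g2
    have g0 : C.pos g ≠ 0 := by omega
    rw [Function.iterate_succ_apply', ← hg] at h2
    -- The walk of an entry stops at `ρ`, and `hρ` keeps the edge behind `ρ` out of this stretch.
    have hT : x + j ≠ K.T := by
      intro hE
      rw [hE, K.c_T] at h2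
      refine hρ g g1 (by omega) (by omega) ⟨?_, ?_⟩
      · rw [h2, C.idx_prev g g0]
      · rw [h2, C.pos_prev g g0]
    have hT' : x + j + 1 ≤ K.T := by omega
    have hg' : K.c (x + j + 1) = g := by
      refine C.eq_of_o g _ g0 ?_
      rw [← K.walk.1 (x + j) (by omega), h2, C.t_prev g g0]
    refine ⟨hT', hg', ⟨K, x + j + 1, by omega, hT', rfl, rfl⟩, ?_⟩
    rintro φ' ⟨K', x', hx', hxT', hc', rfl⟩
    -- A competing active node either is met at the time `n`, where its phase `φ₁` has least rank,
    -- or comes from an active node on the preceding edge, where `mono` applies.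
    rcases hx'.eq_or_lt with hE | hlt
    · rw [← hE, K'.φ_n]
      exact bot _
    · obtain ⟨x'', rfl⟩ : ∃ x'', x' = x'' + 1 := ⟨x' - 1, by omega⟩
      have hprev : K'.c x'' = K.c (x + j) := by
        rw [h2]
        refine C.eq_prev g _ g0 ?_
        rw [K'.walk.1 x'' (by omega), hc', ← hg']
        rfl
      have := mono (K'.φ + x'') (K.φ + (x + j : ℕ))
        (by rw [← K'.walk.2 x'' (by omega), ← K.walk.2 (x + j) h1, hprev])
        (h3.2 _ ⟨K', x'', by omega, by omega, hprev, rfl⟩)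
      have e1 : K'.φ + ((x'' + 1 : ℕ) : ZMod p) = K'.φ + x'' + 1 := by push_cast; ring
      have e2 : K.φ + ((x + (j + 1) : ℕ) : ZMod p) = K.φ + (x + j : ℕ) + 1 := by push_cast; ring
      rw [e1, e2]
      exact this

/-- Times of first visits agree for walks that have the same phase. -/
theorem Entry.c_m_eq_of_agree (K K' : Entry S w φ₁ φ₂ ρ ψ) {x y : ℕ} (hc : K.c x = K'.c y)
    (hφ : K.φ + x = K'.φ + y) (hx : x ≤ K.m) (hy : y ≤ K'.m)
    (hmin : ∀ j, x + j < K.m → K'.m ≠ y + j) (hmin' : ∀ j, y + j < K'.m → K.m ≠ x + j) :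
    K.c K.m = K'.c K'.m := by
  have hE : K.m - x = K'.m - y := by
    rcases lt_trichotomy (K.m - x) (K'.m - y) with h | h | h
    · exact absurd (show K.m = x + (K.m - x) by omega) (hmin' _ (by omega))
    · exact h
    · exact absurd (show K'.m = y + (K'.m - y) by omega) (hmin _ (by omega))
  have := K.walk.agree K'.walk hc hφ (K.m - x) (by have := K.m_le; omega)
    (by have := K'.m_le; omega)
  rwa [show x + (K.m - x) = K.m by omega, show y + (K.m - x) = K'.m by omega] at this

/-- Between `n` and `m` the remaining time until the phase `φ₂` depends on the current phase only,
so from a common node both walks reach the same gate. -/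
theorem Entry.c_m_eq_of_n_le (K K' : Entry S w φ₁ φ₂ ρ ψ) {x y : ℕ} (hc : K.c x = K'.c y)
    (hφ : K.φ + x = K'.φ + y) (hx : x ≤ K.m) (hy : y ≤ K'.m) (hn : K.n ≤ x) (hn' : K'.n ≤ y) :
    K.c K.m = K'.c K'.m := by
  refine K.c_m_eq_of_agree K' hc hφ hx hy (fun j hj hE => ?_) (fun j hj hE => ?_)
  · refine K.m_min (x + j) (by omega) hj ?_
    exact (phase_add hφ j).trans (hE ▸ K'.φ_m)
  · refine K'.m_min (y + j) (by omega) hj ?_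
    exact (phase_add hφ j).symm.trans (hE ▸ K.φ_m)

/-- Up to the time `n` the remaining time until `φ₁` depends on the phase only, so walks with a
common node agree at their times `n`, and hence at their gates. -/
theorem Entry.c_m_eq_of_le_n (K K' : Entry S w φ₁ φ₂ ρ ψ) {x y : ℕ} (hc : K.c x = K'.c y)
    (hφ : K.φ + x = K'.φ + y) (hx : x ≤ K.n) (hy : y ≤ K'.n) : K.c K.m = K'.c K'.m := by
  have hE : K.n - x = K'.n - y := by
    rcases lt_trichotomy (K.n - x) (K'.n - y) with h | h | h
    · refine absurd ((phase_add hφ (K.n - x)).symm.trans ?_) (K'.n_min (y + (K.n - x)) (by omega))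
      rw [show x + (K.n - x) = K.n by omega]
      exact K.φ_n
    · exact h
    · refine absurd ((phase_add hφ (K'.n - y)).trans ?_) (K.n_min (x + (K'.n - y)) (by omega))
      rw [show y + (K'.n - y) = K'.n by omega]
      exact K'.φ_n
  have h1 := K.n_le
  have h2 := K'.n_le
  have h3 := K.m_le
  have h4 := K'.m_le
  have := K.walk.agree K'.walk hc hφ (K.n - x) (by omega) (by omega)
  rw [show x + (K.n - x) = K.n by omega, show y + (K.n - x) = K'.n by omega] at this
  exact K.c_m_eq_of_n_le K' this (by rw [K.φ_n, K'.φ_n]) h1 h2 le_rfl le_rfl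

variable (S w rank φ₁ φ₂ ρ ψ) in
/-- `x` is the first time, from the time `n` on, at which the entry `K` is in a top phase. -/
def FirstTop (K : Entry S w φ₁ φ₂ ρ ψ) (x : ℕ) : Prop :=
  K.n ≤ x ∧ x ≤ K.m ∧ IsTop S w rank φ₁ φ₂ ρ ψ (K.c x) (K.φ + x) ∧
    ∀ y, K.n ≤ y → y < x → ¬ IsTop S w rank φ₁ φ₂ ρ ψ (K.c y) (K.φ + y)

/-- The time `m` always qualifies: the phase there is `φ₂`, which has maximal rank. -/
theorem exists_firstTop (top : ∀ φ, rank φ ≤ rank φ₂) (K : Entry S w φ₁ φ₂ ρ ψ) :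
    ∃ x, FirstTop S w rank φ₁ φ₂ ρ ψ K x := by
  classical
  have h : ∃ x, K.n ≤ x ∧ IsTop S w rank φ₁ φ₂ ρ ψ (K.c x) (K.φ + x) :=
    ⟨K.m, K.n_le, ⟨K, K.m, K.n_le, K.m_le, rfl, rfl⟩, fun φ' _ => by rw [K.φ_m]; exact top _⟩
  refine ⟨Nat.find h, (Nat.find_spec h).1, Nat.find_min' h ?_, (Nat.find_spec h).2,
    fun y hy hlt htop => Nat.find_min h hlt ⟨hy, htop⟩⟩
  exact ⟨K.n_le, ⟨K, K.m, K.n_le, K.m_le, rfl, rfl⟩, fun φ' _ => by rw [K.φ_m]; exact top _⟩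

/-- If a second entry gets into its first top phase further along a segment, then its walk passes
the first top node of the first entry, before the time `n`. -/
theorem FirstTop.passes (inj : Function.Injective rank)
    (mono : ∀ φ φ', w φ = w φ' → rank φ ≤ rank φ' → rank (φ + 1) ≤ rank (φ' + 1))
    (bot : ∀ φ, rank φ₁ ≤ rank φ)
    {K K' : Entry S w φ₁ φ₂ ρ ψ} {x x' : ℕ} (h : FirstTop S w rank φ₁ φ₂ ρ ψ K x)
    (h' : FirstTop S w rank φ₁ φ₂ ρ ψ K' x') (hi : C.idx (K.c x) = C.idx (K'.c x'))
    (hpos : C.pos (K.c x) < C.pos (K'.c x'))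
    (hB : ∀ z, C.idx z = C.idx (K'.c x') → C.pos (K.c x) < C.pos z → C.pos z ≤ C.pos (K'.c x') →
      S.o z ∉ S.Vi ∧ ¬ (C.idx z = C.idx ρ ∧ C.pos z = C.pos ρ + 1)) :
    ∃ y, y ≤ K'.n ∧ K'.c y = K.c x ∧ K'.φ + y = K.φ + x := by
  obtain ⟨hn, hm, htop, -⟩ := h
  obtain ⟨hn', hm', htop', hmin'⟩ := h'
  have hmT := K.m_le
  have hmT' := K'.m_le
  have al := IsTop.along C mono bot K hn (by omega) htop hi hpos.le
    (fun z h1 h2 h3 => (hB z h1 h2 h3).2)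
  set d := C.pos (K'.c x') - C.pos (K.c x) with hd
  have hend := al d (by omega)
  rw [Nat.sub_self] at hend
  obtain ⟨hT, hc, ht⟩ := hend
  have hc : K.c (x + d) = K'.c x' := hc
  rw [hc] at ht
  have hφ := IsTop.unique inj ht htop'
  by_cases hdx : d ≤ x'
  · have hb := C.walk_backwards K'.walk (k := x') (by omega) d hdx (by omega)
    rw [hd, C.prev_iterate_eq hi hpos.le, ← hd] at hb
    have hφ' : K'.φ + (x' - d : ℕ) = K.φ + x := by
      rw [Nat.cast_sub hdx]
      push_cast at hφ
      linear_combination -hφ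
    refine ⟨x' - d, ?_, hb, hφ'⟩
    -- A passage later than `n` would be a top time of `K'` before its first one.
    by_contra hlt
    refine hmin' (x' - d) (by omega) (by omega) ?_
    rw [hb, hφ']
    exact htop
  -- Neither kind of start is possible here: no initial vertex lies inside the segment, and the only
  -- edge before `K'.c 0` is on the walk of `K` in the matching phase, so its label is the expected
  -- one.
  · exfalso
    have hb := C.walk_backwards K'.walk (k := x') (by omega) x' le_rfl (by omega)
    rw [Nat.sub_self] at hb
    obtain ⟨g1, g2⟩ := C.idx_pos_prev_iterate (K'.c x') x' (by omega)
    rw [← hb] at g1 g2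
    obtain ⟨hVi, -⟩ := hB (K'.c 0) g1 (by omega) (by omega)
    rcases K'.start with hs | ⟨e₀, he, hl⟩
    · exact hVi hs
    · have h0 : C.pos (K'.c 0) ≠ 0 := by omega
      have e1 := C.eq_prev _ _ h0 he
      obtain ⟨a1, a2, -⟩ := al (d - x' - 1) (by omega)
      rw [show d - (d - x' - 1) = x' + 1 by omega, Function.iterate_succ_apply', ← hb, ← e1] at a2
      refine hl ?_
      rw [← a2, K.walk.2 _ a1]
      congr 1
      rw [show d - x' - 1 = d - (x' + 1) by omega, Nat.cast_add, Nat.cast_sub (by omega)]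
      push_cast at hφ ⊢
      linear_combination hφ

variable (S w φ₁ φ₂ ρ ψ) in
/-- The edges at which an entry is at the time `m`. -/
def gates : Set S.E := {M | ∃ K : Entry S w φ₁ φ₂ ρ ψ, K.c K.m = M}

/-- Cut the chains in front of the edges that begin at initial vertices and directly behind `ρ`;
this gives at most `N + ν + 1` segments for `N` chains and `ν` initial vertices. Assign a gate to
the segment where a chosen entry first is in a top phase. In one segment, take the entry whose first
top edge comes earliest. Any other entry of the segment with a different gate passes this node no
later than its time `n`, so all these others share one gate. -/
theorem ncard_gates_le (C : S.Chains ι) [Finite S.E] [Finite ι] (hVi : S.Vi.Finite)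
    (inj : Function.Injective rank)
    (mono : ∀ φ φ', w φ = w φ' → rank φ ≤ rank φ' → rank (φ + 1) ≤ rank (φ' + 1))
    (bot : ∀ φ, rank φ₁ ≤ rank φ) (top : ∀ φ, rank φ ≤ rank φ₂) :
    (gates S w φ₁ φ₂ ρ ψ).ncard ≤ 2 * (Nat.card ι + S.Vi.ncard + 1) := by
  classical
  set B₀ : Set S.E := {x | C.pos x = 0}
  set B₁ : Set S.E := {x | C.pos x ≠ 0 ∧ S.o x ∈ S.Vi}
  set B₂ : Set S.E := {x | C.idx x = C.idx ρ ∧ C.pos x = C.pos ρ + 1}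
  have c0 : B₀.ncard ≤ Nat.card ι := by
    rw [← Set.ncard_univ]
    refine Set.ncard_le_ncard_of_injOn C.idx (fun _ _ => Set.mem_univ _) ?_ Set.finite_univ
    intro x hx y hy h
    exact C.ext _ _ h (by rw [hx, hy])
  have c1 : B₁.ncard ≤ S.Vi.ncard := by
    refine Set.ncard_le_ncard_of_injOn S.o (fun x hx => hx.2) ?_ hVi
    intro x hx y hy h
    exact C.eq_of_o _ _ hy.1 h
  have c2 : B₂.ncard ≤ 1 := by
    rw [Set.ncard_le_one_iff]
    intro x y hx hy
    exact C.ext _ _ (hx.1.trans hy.1.symm) (hx.2.trans hy.2.symm)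
  set B := B₀ ∪ B₁ ∪ B₂
  have cB : B.ncard ≤ Nat.card ι + S.Vi.ncard + 1 := by
    have h2 := Set.ncard_union_le B₀ B₁
    exact (Set.ncard_union_le (B₀ ∪ B₁) B₂).trans (by omega)
  obtain ⟨hd, hd1, hd2⟩ := C.exists_head B (fun x hx => Or.inl (Or.inl hx))
  choose x hx using exists_firstTop (S := S) (w := w) (φ₁ := φ₁) (ρ := ρ) (ψ := ψ) top
  rcases isEmpty_or_nonempty (Entry S w φ₁ φ₂ ρ ψ) with hE | hE
  · have : gates S w φ₁ φ₂ ρ ψ = ∅ := Set.eq_empty_of_forall_notMem fun M ⟨K, _⟩ => hE.elim K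
    simp [this]
  choose! K hK using fun (M : S.E) (hM : M ∈ gates S w φ₁ φ₂ ρ ψ) => hM
  have : Fintype S.E := Fintype.ofFinite _
  rw [Set.ncard_eq_toFinset_card']
  have hB' : B.toFinset.card ≤ Nat.card ι + S.Vi.ncard + 1 := by
    rwa [← Set.ncard_eq_toFinset_card']
  refine (Finset.card_le_mul_card_image_of_maps_to (t := B.toFinset)
    (f := fun M => hd ((K M).c (x (K M)))) (fun M _ => by simpa using hd1 _) 2 ?_).trans
    (Nat.mul_le_mul_left 2 hB')
  intro b _
  set F := {M ∈ (gates S w φ₁ φ₂ ρ ψ).toFinset | hd ((K M).c (x (K M))) = b} with hF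
  rcases F.eq_empty_or_nonempty with h0 | hne
  · rw [h0]; simp
  obtain ⟨M₀, hM₀, hmin⟩ := F.exists_min_image (fun M => C.pos ((K M).c (x (K M)))) hne
  have mem : ∀ M ∈ F, (K M).c (K M).m = M ∧ hd ((K M).c (x (K M))) = b := by
    intro M hM
    rw [hF, Finset.mem_filter, Set.mem_toFinset] at hM
    exact ⟨hK M hM.1, hM.2⟩
  have pass : ∀ M ∈ F, M ≠ M₀ → ∃ y, y ≤ (K M).n ∧ (K M).c y = (K M₀).c (x (K M₀)) ∧
      (K M).φ + y = (K M₀).φ + x (K M₀) := by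
    intro M hM hne
    obtain ⟨hi, hz⟩ := hd2 ((K M₀).c (x (K M₀))) ((K M).c (x (K M)))
      ((mem M₀ hM₀).2.trans (mem M hM).2.symm)
    rcases (hmin M hM).eq_or_lt with hE | hlt
    · refine absurd ?_ hne
      have hc := C.ext _ _ hi hE
      obtain ⟨a1, a2, a3, -⟩ := hx (K M₀)
      obtain ⟨b1, b2, b3, -⟩ := hx (K M)
      rw [← (mem M hM).1, ← (mem M₀ hM₀).1]
      refine ((K M₀).c_m_eq_of_n_le (K M) hc (IsTop.unique inj a3 ?_) a2 b2 a1 b1).symm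
      rw [hc]
      exact b3
    · refine (hx (K M₀)).passes C inj mono bot (hx (K M)) hi hlt (fun z h1 h2 h3 => ?_)
      have h1' := h1.trans hi.symm
      refine ⟨fun h => hz z (Or.inl (Or.inr ⟨by omega, h⟩)) h1' h2 h3,
        fun h => hz z (Or.inr h) h1' h2 h3⟩
  rw [← Finset.card_erase_add_one hM₀]
  have : (F.erase M₀).card ≤ 1 := by
    rw [Finset.card_le_one]
    intro M hM M' hM'
    rw [Finset.mem_erase] at hM hM'
    obtain ⟨y, h1, h2, h3⟩ := pass M hM.2 hM.1
    obtain ⟨y', h1', h2', h3'⟩ := pass M' hM'.2 hM'.1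
    rw [← (mem M hM.2).1, ← (mem M' hM'.2).1]
    exact (K M).c_m_eq_of_le_n (K M') (h2.trans h2'.symm) (h3.trans h3'.symm) h1 h1'
  omega

end EntryCount

end LGraph

/-! ### Tools: rotations of words, deterministic relations, coverings on the line -/

/-- The rotations of a primitive periodic word, ordered lexicographically. -/
theorem exists_rank {A : Type*} {p : ℕ} [NeZero p] (w : ZMod p → A)
    (prim : ∀ c, (∀ φ, w (φ + c) = w φ) → c = 0) :
    ∃ (_ : LinearOrder A) (rank : ZMod p → Lex (ℕ → A)) (φ₁ φ₂ : ZMod p),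
      Function.Injective rank ∧
      (∀ φ φ', w φ = w φ' → rank φ ≤ rank φ' → rank (φ + 1) ≤ rank (φ' + 1)) ∧
      (∀ φ, rank φ₁ ≤ rank φ) ∧ ∀ φ, rank φ ≤ rank φ₂ := by
  classical
  let : LinearOrder A := linearOrderOfSTO WellOrderingRel
  -- A phase is ranked by the infinite word read from it. Distinct phases read distinct words
  -- because `w` is primitive, and removing a common first letter preserves the lexicographic order.
  let rank : ZMod p → Lex (ℕ → A) := fun φ => toLex fun n : ℕ => w (φ + n)
  obtain ⟨φ₁, h₁⟩ := Finite.exists_min rank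
  obtain ⟨φ₂, h₂⟩ := Finite.exists_max rank
  refine ⟨inferInstance, rank, φ₁, φ₂, fun φ φ' h => ?_, fun φ φ' hw hle => ?_, h₁, h₂⟩
  · have h' : ∀ n : ℕ, w (φ + n) = w (φ' + n) := fun n => congrFun (toLex.injective h) n
    have := prim (φ' - φ) fun χ => by
      have := h' (χ - φ).val
      rw [ZMod.natCast_zmod_val] at this
      rw [show χ + (φ' - φ) = φ' + (χ - φ) by ring, ← this]
      congr 1; ring
    exact (sub_eq_zero.1 this).symm
  · by_contra hlt
    rw [not_le] at hlt
    refine absurd hle (not_le.2 ?_)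
    obtain ⟨i, hi, hi'⟩ := hlt
    refine ⟨i + 1, fun j hj => ?_, ?_⟩
    · rcases j with _ | j
      · change w (φ' + (0 : ℕ)) = w (φ + (0 : ℕ))
        simpa using hw.symm
      · have := hi j (by simpa using hj)
        change w (φ' + 1 + j) = w (φ + 1 + j) at this
        change w (φ' + (j + 1 : ℕ)) = w (φ + (j + 1 : ℕ))
        push_cast
        rwa [add_comm (j : ZMod p), ← add_assoc, ← add_assoc]
    · change w (φ' + 1 + i) < w (φ + 1 + i) at hi'
      change w (φ' + (i + 1 : ℕ)) < w (φ + (i + 1 : ℕ))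
      push_cast
      rwa [add_comm (i : ZMod p), ← add_assoc, ← add_assoc]

/-- In a finite set with a deterministic relation `r`, let every element of `R` outside of `S` have
an `r`-predecessor in `R`. Then every element of `R` is reached from `S` or is periodic. -/
theorem exists_source_or_periodic {α : Type*} [Finite α] (r : α → α → Prop)
    (hr : ∀ x y z, r x y → r x z → y = z) (R S : Set α)
    (h : ∀ x ∈ R, x ∉ S → ∃ y ∈ R, r y x) (x : α) (hx : x ∈ R) :
    (∃ (c : ℕ → α) (T : ℕ), c 0 ∈ R ∧ c 0 ∈ S ∧ c T = x ∧ ∀ k < T, r (c k) (c (k + 1))) ∨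
    ∃ (c : ℕ → α) (T : ℕ), 0 < T ∧ c 0 = x ∧ (∀ k, c (k + T) = c k) ∧
      ∀ k, r (c k) (c (k + 1)) := by
  classical
  set reach : α → Prop := fun x =>
    ∃ (c : ℕ → α) (T : ℕ), c 0 ∈ R ∧ c 0 ∈ S ∧ c T = x ∧ ∀ k < T, r (c k) (c (k + 1)) with hreach
  have step : ∀ y z, reach y → r y z → reach z := by
    rintro y z ⟨c, T, h1, h2, h3, h4⟩ hyz
    refine ⟨fun k => if k ≤ T then c k else z, T + 1, by simpa, by simpa, by simp, fun k hk => ?_⟩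
    rcases (Nat.lt_succ_iff.1 hk).eq_or_lt with rfl | hk'
    · simpa [h3] using hyz
    · simpa [hk'.le, Nat.succ_le_iff.2 hk'] using h4 k hk'
  by_cases hrx : reach x
  · exact Or.inl hrx
  right
  -- Every element that is not reached has a predecessor of the same kind. A choice of predecessors
  -- is injective because `r` is deterministic, so by finiteness it is a permutation, whose inverse
  -- moves forwards along `r`.
  let Q := {y : α // y ∈ R ∧ ¬ reach y}
  have hQ : ∀ y : Q, ∃ z : Q, r z.1 y.1 := by
    rintro ⟨y, hy, hy'⟩
    obtain ⟨z, hz, hzy⟩ := h y hy fun hyS => hy' ⟨fun _ => y, 0, hy, hyS, rfl, by simp⟩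
    exact ⟨⟨z, hz, fun hz' => hy' (step z y hz' hzy)⟩, hzy⟩
  choose g hg using hQ
  have ginj : Function.Injective g := fun y z hyz =>
    Subtype.ext (hr _ _ _ (hg y) (hyz ▸ hg z))
  let σ : Equiv.Perm Q := Equiv.ofBijective g (Finite.injective_iff_bijective.1 ginj)
  refine ⟨fun k => ((σ⁻¹ ^ k) ⟨x, hx, hrx⟩).1, orderOf σ, orderOf_pos σ, by simp, fun k => ?_,
    fun k => ?_⟩
  · have : σ⁻¹ ^ orderOf σ = 1 := by rw [inv_pow, pow_orderOf_eq_one, inv_one]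
    simp only [pow_add, this, mul_one]
  · have := hg ((σ⁻¹ ^ (k + 1)) ⟨x, hx, hrx⟩)
    have e : g ((σ⁻¹ ^ (k + 1)) ⟨x, hx, hrx⟩) = (σ⁻¹ ^ k) ⟨x, hx, hrx⟩ := by
      change σ _ = _
      rw [pow_succ', Equiv.Perm.mul_apply]
      exact σ.apply_symm_apply _
    rw [e] at this
    exact this

/-- A greedy covering. -/
theorem exists_separated (D : Finset ℤ) (len : ℤ → ℕ) :
    ∃ D' ⊆ D, (∀ d ∈ D, ∃ d' ∈ D', 4 * |d - d'| ≤ len d' ∧ len d ≤ len d') ∧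
      ∀ d₁ ∈ D', ∀ d₂ ∈ D', d₁ ≠ d₂ → (len d₁ : ℤ) < 4 * |d₁ - d₂| := by
  induction D using Finset.strongInduction with
  | H D ih =>
    rcases D.eq_empty_or_nonempty with rfl | hne
    · exact ⟨∅, by simp, by simp, by simp⟩
    -- An element `a` of maximal length covers everything within a quarter of its length; the
    -- induction treats the rest.
    obtain ⟨a, ha, hmax⟩ := D.exists_max_image len hne
    obtain ⟨D', hD', h1, h2⟩ := ih {d ∈ D | (len a : ℤ) < 4 * |d - a|}
      ((Finset.filter_ssubset).2 ⟨a, ha, by simp⟩)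
    have hlt : ∀ d ∈ D', (len a : ℤ) < 4 * |d - a| ∧ d ∈ D := fun d hd => by
      have := Finset.mem_filter.1 (hD' hd)
      exact ⟨this.2, this.1⟩
    refine ⟨insert a D', ?_, fun d hd => ?_, ?_⟩
    · intro d hd
      rcases Finset.mem_insert.1 hd with rfl | hd
      · exact ha
      · exact (hlt d hd).2
    · by_cases hda : (len a : ℤ) < 4 * |d - a|
      · obtain ⟨d', hd', h⟩ := h1 d (Finset.mem_filter.2 ⟨hd, hda⟩)
        exact ⟨d', Finset.mem_insert_of_mem hd', h⟩
      · exact ⟨a, Finset.mem_insert_self _ _, not_lt.1 hda, hmax d hd⟩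
    · intro d₁ hd₁ d₂ hd₂ hne
      rcases Finset.mem_insert.1 hd₁ with e₁ | e₁ <;>
        rcases Finset.mem_insert.1 hd₂ with e₂ | e₂
      · exact absurd (e₁.trans e₂.symm) hne
      · rw [e₁, abs_sub_comm]
        exact (hlt d₂ e₂).1
      · have h3 := (hlt d₁ e₁).1
        have h4 := hmax d₁ (hlt d₁ e₁).2
        rw [e₂]
        omega
      · exact h2 d₁ e₁ d₂ e₂ hne

/-- By separation the intervals `[4d, 4d + len d)` are disjoint, and they all lie in `[-4m, 4n)`. -/
theorem sum_len_le_of_separated (D : Finset ℤ) (len : ℤ → ℕ) (m n : ℕ)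
    (hsep : ∀ d₁ ∈ D, ∀ d₂ ∈ D, d₁ ≠ d₂ → (len d₁ : ℤ) < 4 * |d₁ - d₂|)
    (hm : ∀ d ∈ D, -(m : ℤ) ≤ d) (hn : ∀ d ∈ D, d + len d ≤ n) :
    ∑ d ∈ D, len d ≤ 4 * (m + n) := by
  classical
  have hdisj : (D : Set ℤ).PairwiseDisjoint fun d => Finset.Ico (4 * d) (4 * d + len d) := by
    intro d₁ h₁ d₂ h₂ hne
    rw [Function.onFun, Finset.disjoint_left]
    intro x hx hx'
    rw [Finset.mem_Ico] at hx hx'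
    have e1 := hsep d₁ h₁ d₂ h₂ hne
    have e2 := hsep d₂ h₂ d₁ h₁ hne.symm
    rcases abs_cases (d₁ - d₂) with h | h <;> rcases abs_cases (d₂ - d₁) with h' | h' <;> omega
  calc ∑ d ∈ D, len d = ∑ d ∈ D, (Finset.Ico (4 * d) (4 * d + len d)).card := by simp
    _ = (D.biUnion fun d => Finset.Ico (4 * d) (4 * d + len d)).card :=
        (Finset.card_biUnion hdisj).symm
    _ ≤ (Finset.Ico (-(4 * m : ℤ)) (4 * n)).card := by
        refine Finset.card_le_card fun x hx => ?_
        obtain ⟨d, hd, hx⟩ := Finset.mem_biUnion.1 hx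
        rw [Finset.mem_Ico] at hx ⊢
        have := hm d hd
        have := hn d hd
        omega
    _ = 4 * (m + n) := by rw [Int.card_Ico]; omega

/-! ### Enumerated chains and closed walks -/

namespace LGraph

variable {A : Type*}

/-- `u` enumerates the first `m` edges of the chain `a`. -/
def Chains.Enum {S : LGraph A} {ι : Type*} (C : S.Chains ι) (a : ι) (m : ℕ) (u : ℤ → S.E) : Prop :=
  ∀ i : ℤ, 0 ≤ i → i < m → C.idx (u i) = a ∧ (C.pos (u i) : ℤ) = i

namespace Chains.Enum

variable {S : LGraph A} {ι : Type*} {C : S.Chains ι} {a : ι} {m : ℕ} {u : ℤ → S.E}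
  (h : C.Enum a m u)

include h

theorem inj {i j : ℤ} (hi : 0 ≤ i) (hi' : i < m) (hj : 0 ≤ j) (hj' : j < m) (hu : u i = u j) :
    i = j := by
  rw [← (h i hi hi').2, ← (h j hj hj').2, hu]

theorem pos_succ {i : ℤ} (hi : 0 ≤ i) (hi' : i + 1 < m) : C.pos (u (i + 1)) ≠ 0 := by
  have := (h (i + 1) (by omega) hi').2
  omega

theorem prev_succ {i : ℤ} (hi : 0 ≤ i) (hi' : i + 1 < m) : C.prev (u (i + 1)) = u i := by
  have h0 := h.pos_succ hi hi'
  have h1 := h (i + 1) (by omega) hi'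
  have h2 := h i hi (by omega)
  have h3 := C.pos_prev _ h0
  refine C.ext _ _ ?_ ?_
  · rw [C.idx_prev _ h0, h1.1, h2.1]
  · omega

theorem t_eq {i : ℤ} (hi : 0 ≤ i) (hi' : i + 1 < m) : S.t (u i) = S.o (u (i + 1)) := by
  rw [← h.prev_succ hi hi', C.t_prev _ (h.pos_succ hi hi')]

theorem eq_of_o {i : ℤ} (hi : 0 ≤ i) (hi' : i + 1 < m) {e : S.E} (he : S.t (u i) = S.o e) :
    e = u (i + 1) :=
  C.eq_of_o _ _ (h.pos_succ hi hi') (by rw [← he, h.t_eq hi hi'])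

theorem eq_of_t {i : ℤ} (hi : 0 ≤ i) (hi' : i + 1 < m) {e : S.E} (he : S.t e = S.o (u (i + 1))) :
    e = u i :=
  (C.eq_prev _ _ (h.pos_succ hi hi') he).trans (h.prev_succ hi hi')

theorem walk_eq {c : ℕ → S.E} {i : ℤ} (hi : 0 ≤ i) (h0 : c 0 = u i) (k : ℕ) (hk : i + k < m)
    (hc : ∀ j < k, S.t (c j) = S.o (c (j + 1))) : c k = u (i + k) := by
  induction k with
  | zero => simpa using h0
  | succ k ih =>
    have e := ih (by push_cast at hk; omega) fun j hj => hc j (by omega)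
    have := h.eq_of_o (i := i + k) (by omega) (by push_cast at hk; omega)
      (e ▸ hc k (by omega))
    rw [this]; push_cast; congr 1; ring

/-- A bi-infinite walk through one edge of a chain contains the chain. -/
theorem biwalk_eq {c : ℤ → S.E} (hc : ∀ k, S.t (c k) = S.o (c (k + 1))) {r : ℤ} (hr : 0 ≤ r)
    (hr' : r < m) (h0 : c r = u r) {i : ℤ} (hi : 0 ≤ i) (hi' : i < m) : c i = u i := by
  have up : ∀ k : ℕ, r + k < m → c (r + k) = u (r + k) := by
    intro k
    induction k with
    | zero => intro; simpa using h0
    | succ k ih =>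
      intro hk
      push_cast at hk ⊢
      have e := ih (by omega)
      have := h.eq_of_o (i := r + k) (by omega) (by omega) (e ▸ hc (r + k))
      rw [show r + ((k : ℤ) + 1) = r + k + 1 by ring, this]
  have down : ∀ k : ℕ, 0 ≤ r - k → c (r - k) = u (r - k) := by
    intro k
    induction k with
    | zero => intro; simpa using h0
    | succ k ih =>
      intro hk
      push_cast at hk ⊢
      have e := ih (by omega)
      refine h.eq_of_t (by omega) (by omega) ?_
      rw [hc, show r - ((k : ℤ) + 1) + 1 = r - k by ring, e]
  rcases le_total r i with hle | hle
  · have := up (i - r).toNat (by omega)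
    rwa [show r + ((i - r).toNat : ℤ) = i by omega] at this
  · have := down (r - i).toNat (by omega)
    rwa [show r - ((r - i).toNat : ℤ) = i by omega] at this

end Chains.Enum

/-- The edge `ρ`, read in phase `ψ`, lies on a closed walk labelled by `w`. -/
def IsPeriodic (S : LGraph A) {p : ℕ} (w : ZMod p → A) (ρ : S.E) (ψ : ZMod p) (T : ℕ) : Prop :=
  0 < T ∧ (T : ZMod p) = 0 ∧ ∃ c, S.IsWalk w ψ c T ∧ c 0 = ρ ∧ c T = ρ

/-- Repeat a shortest closed walk; `D` is the number of periods of `w` that it reads. If an edge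
recurred in the same phase too early, determinism would carry the recurrence on to `ρ` and give a
shorter closed walk; this is the last clause. -/
theorem IsPeriodic.exists_biwalk {S : LGraph A} {p : ℕ} {w : ZMod p → A} {ρ : S.E}
    {r s : ℤ} (h : ∃ T, IsPeriodic S w ρ (r - s : ℤ) T) :
    ∃ (D : ℕ) (c : ℤ → S.E), 0 < D ∧ c r = ρ ∧ (∀ k, S.t (c k) = S.o (c (k + 1))) ∧
      (∀ k, S.lab (c k) = w ((k - s : ℤ) : ZMod p)) ∧ (∀ k, c (k + (D * p : ℕ)) = c k) ∧
      ∀ k k', (p : ℤ) ∣ k - k' → c k = c k' → ((D * p : ℕ) : ℤ) ∣ k - k' := by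
  classical
  obtain ⟨h1, h2, c, hc, c0, cT⟩ := Nat.find_spec h
  set n := Nat.find h with hn
  obtain ⟨D, hD⟩ : p ∣ n := (ZMod.natCast_eq_zero_iff _ _).1 h2
  have hn0 : (0 : ℤ) < n := by exact_mod_cast h1
  have hpn : (p : ℤ) ∣ n := ⟨D, by rw [hD]; push_cast; ring⟩
  let f : ℤ → ℕ := fun k => ((k - r) % n).toNat
  have hf : ∀ k, (f k : ℤ) = (k - r) % n := fun k => by
    have := Int.emod_nonneg (k - r) hn0.ne'
    simp only [f]; omega
  have hfn : ∀ k, f k < n := fun k => by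
    have := Int.emod_lt_of_pos (k - r) hn0
    have := hf k
    omega
  have hper : ∀ k, c (f (k + n)) = c (f k) := fun k => by
    have : f (k + n) = f k := by
      have h1 := hf k
      have h2 := hf (k + n)
      rw [show k + n - r = k - r + n by ring, Int.add_emod_right] at h2
      omega
    rw [this]
  have hstep : ∀ k, c (f (k + 1)) = c (f k + 1) := fun k => by
    have h3 := hf (k + 1)
    have h4 := hf k
    have h5 := hfn k
    have h6 : (k + 1 - r) % n = ((f k : ℤ) + 1) % n := by
      rw [h4, show k + 1 - r = k - r + 1 by ring, Int.emod_add_emod]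
    rcases (Nat.succ_le_of_lt h5).eq_or_lt with hE | hlt
    · rw [h6, show ((f k : ℤ) + 1) = n by omega, Int.emod_self] at h3
      rw [show f (k + 1) = 0 by omega, show f k + 1 = n by omega, c0, cT]
    · rw [h6, Int.emod_eq_of_lt (by omega) (by omega)] at h3
      rw [show f (k + 1) = f k + 1 by omega]
  have hwalk : ∀ k, S.t (c (f k)) = S.o (c (f (k + 1))) := fun k => by
    rw [hstep, hc.1 _ (hfn k)]
  have hlab : ∀ k, S.lab (c (f k)) = w ((k - s : ℤ) : ZMod p) := fun k => by
    rw [hc.2 _ (hfn k).le]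
    congr 1
    have e : ((f k : ℤ) : ZMod p) = ((k - r : ℤ) : ZMod p) := by
      rw [ZMod.intCast_eq_intCast_iff_dvd_sub, hf]
      exact hpn.trans (Int.dvd_self_sub_emod)
    rw [Int.cast_natCast] at e
    rw [e]; push_cast; ring
  have hn' : (D * p : ℕ) = n := by rw [hD, mul_comm]
  refine ⟨D, fun k => c (f k), Nat.pos_of_ne_zero fun h0 => by simp [h0] at hD; omega, ?_, hwalk,
    hlab, ?_, ?_⟩
  · have := hf r
    simp only [sub_self, Int.zero_emod] at this
    change c (f r) = ρ
    rw [show f r = 0 by omega, c0]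
  · rw [hn']; exact hper
  · rw [hn']
    intro k k' hk hck
    have hck : c (f k) = c (f k') := hck
    have fwd : ∀ j : ℕ, c (f (k + j)) = c (f (k' + j)) := by
      intro j
      induction j with
      | zero => simpa using hck
      | succ j ih =>
        have a1 := hwalk (k + j)
        have a2 := hwalk (k' + j)
        push_cast
        rw [← add_assoc, ← add_assoc]
        refine S.det _ _ (by rw [← a1, ← a2, ih]) ?_
        rw [hlab, hlab]
        congr 1
        rw [ZMod.intCast_eq_intCast_iff_dvd_sub]
        rw [show k' + ↑j + 1 - s - (k + ↑j + 1 - s) = -(k - k') by ring]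
        exact (dvd_neg.2 hk)
    have hj : ∃ j : ℕ, (n : ℤ) ∣ k + j - r := by
      refine ⟨f (2 * r - k), ?_⟩
      rw [hf, show 2 * r - k - r = r - k by ring]
      have : (n : ℤ) ∣ (r - k) - (r - k) % n := Int.dvd_self_sub_emod
      have := dvd_neg.2 this
      rwa [show -((r - k) - (r - k) % (n : ℤ)) = k + (r - k) % n - r by ring] at this
    obtain ⟨j, hj⟩ := hj
    have e1 : f (k + j) = 0 := by
      have := hf (k + j)
      rw [Int.emod_eq_zero_of_dvd hj] at this
      omega
    have e2 := fwd j
    rw [e1, c0] at e2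
    by_cases h0 : f (k' + j) = 0
    · have := hf (k' + j)
      rw [h0] at this
      have := Int.dvd_of_emod_eq_zero this.symm
      have := dvd_sub hj this
      rwa [show k + ↑j - r - (k' + ↑j - r) = k - k' by ring] at this
    · exfalso
      refine Nat.find_min h (hfn (k' + j)) ⟨by omega, ?_, c, ⟨fun i hi => hc.1 i ?_, fun i hi =>
        hc.2 i ?_⟩, c0, e2.symm⟩
      · rw [← Int.cast_natCast, ZMod.intCast_zmod_eq_zero_iff_dvd, hf]
        have h3 : (p : ℤ) ∣ (k' + j - r) - (k' + j - r) % n := hpn.trans Int.dvd_self_sub_emod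
        have h4 : (p : ℤ) ∣ k' + j - r := by
          have := dvd_sub (hpn.trans hj) hk
          rwa [show k + ↑j - r - (k - k') = k' + j - r by ring] at this
        exact (dvd_sub_right h4).1 h3
      · have := hfn (k' + j); omega
      · have := hfn (k' + j); omega

/-- A residue class modulo `p` splits into `D` classes modulo `D * p`. -/
theorem card_le_of_class (F : Finset ℤ) {p D : ℕ} (hp : 0 < p) (hD : 0 < D) (x : ℤ)
    (h1 : ∀ i ∈ F, (p : ℤ) ∣ i - x)
    (h2 : ∀ i ∈ F, ∀ j ∈ F, ((D * p : ℕ) : ℤ) ∣ i - j → i = j) : F.card ≤ D := by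
  have hD' : (0 : ℤ) < D := by exact_mod_cast hD
  rw [show D = (Finset.range D).card by simp]
  refine Finset.card_le_card_of_injOn (fun i => ((i - x) / p % D).toNat) (fun i _ => ?_) ?_
  · have := Int.emod_lt_of_pos ((i - x) / p) hD'
    have := Int.emod_nonneg ((i - x) / p) hD'.ne'
    simp only [Finset.coe_range, Set.mem_Iio]
    omega
  · intro i hi j hj hij
    refine h2 i hi j hj ?_
    have a1 := Int.emod_nonneg ((i - x) / p) hD'.ne'
    have a2 := Int.emod_nonneg ((j - x) / p) hD'.ne'
    have h3 : (i - x) / p % D = (j - x) / p % D := by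
      simp only at hij
      omega
    obtain ⟨q, hq⟩ := h1 i hi
    obtain ⟨q', hq'⟩ := h1 j hj
    have hp' : (p : ℤ) ≠ 0 := by exact_mod_cast hp.ne'
    rw [hq, hq', Int.mul_ediv_cancel_left _ hp', Int.mul_ediv_cancel_left _ hp'] at h3
    obtain ⟨y, hy⟩ := Int.ModEq.dvd (h3.symm : q' ≡ q [ZMOD D])
    refine ⟨y, ?_⟩
    push_cast
    have : i - j = p * (q - q') := by linarith
    rw [this, hy]; ring

end LGraph

/-! ### Pairs of walks with equal labels -/

namespace LGraph

variable {A : Type*} {S S' : LGraph A}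

/-- A set of pairs of edges with equal labels in which every pair begins at a pair of initial
vertices or has a predecessor. -/
structure BackClosed (R : Set (S.E × S'.E)) : Prop where
  matched : ∀ x ∈ R, S.lab x.1 = S'.lab x.2
  back : ∀ x ∈ R, (S.o x.1 ∈ S.Vi ∧ S'.o x.2 ∈ S'.Vi) ∨
    ∃ y ∈ R, S.t y.1 = S.o x.1 ∧ S'.t y.2 = S'.o x.2

/-- `X` contains the pairs of edges on pairs of long periodic walks. -/
def ContainsLong (X : Set (S.E × S'.E)) (θ θ' : ℕ) : Prop :=
  ∀ (q D D' : ℕ) (c : ℤ → S.E) (c' : ℤ → S'.E), 0 < q → 0 < D → 0 < D' → θ ≤ D → θ' ≤ D' →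
    (∀ k, S.t (c k) = S.o (c (k + 1))) → (∀ k, S'.t (c' k) = S'.o (c' (k + 1))) →
    (∀ k, S.lab (c k) = S'.lab (c' k)) → (∀ k, S.lab (c (k + q)) = S.lab (c k)) →
    (∀ k, c (k + (D * q : ℕ)) = c k) → (∀ k, c' (k + (D' * q : ℕ)) = c' k) →
    (∀ r : ℕ, 0 < r → (∀ k, c (k + r) = c k) → D * q ≤ r) →
    (∀ r : ℕ, 0 < r → (∀ k, c' (k + r) = c' k) → D' * q ≤ r) → (c 0, c' 0) ∈ X

/-- Follow the pairs backwards inside `R` while they read `w`, with the phase as a third coordinate.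
One stops at a pair of initial vertices or where a predecessor has the wrong label; its two
components have the same label, so both walks start there at once. If there is no such source,
finiteness makes the pair periodic, and this is carried along the diagonal. -/
theorem exists_pair_walk [Finite S.E] [Finite S'.E] {R : Set (S.E × S'.E)} (hR : BackClosed R)
    {ι ι' : Type*} {C : S.Chains ι} {C' : S'.Chains ι'} {a : ι} {b : ι'} {m n : ℕ} {u : ℤ → S.E}
    {v : ℤ → S'.E} (hu : C.Enum a m u) (hv : C'.Enum b n v) {p : ℕ} [NeZero p] {w : ZMod p → A}
    {d lo hi : ℤ} (h1 : 0 ≤ lo) (h2 : 0 ≤ lo + d) (h3 : lo < hi) (h4 : hi ≤ m) (h5 : hi + d ≤ n)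
    (lu : ∀ i, lo ≤ i → i < hi → S.lab (u i) = w (i : ZMod p))
    (lv : ∀ i, lo ≤ i → i < hi → S'.lab (v (i + d)) = w (i : ZMod p))
    (hs : (u lo, v (lo + d)) ∈ R) :
    (∃ (φ : ZMod p) (c : ℕ → S.E) (c' : ℕ → S'.E) (T : ℕ),
      S.IsWalk w φ c (T + (hi - 1 - lo).toNat) ∧ S'.IsWalk w φ c' (T + (hi - 1 - lo).toNat) ∧
      S.IsStart w φ (c 0) ∧ S'.IsStart w φ (c' 0) ∧ φ + T = lo ∧
      ∀ k : ℕ, lo + k < hi → c (T + k) = u (lo + k) ∧ c' (T + k) = v (lo + d + k)) ∨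
    ∀ i, lo ≤ i → i < hi → (∃ T, IsPeriodic S w (u i) i T) ∧
      ∃ T, IsPeriodic S' w (v (i + d)) i T := by
  let r : S.E × S'.E × ZMod p → S.E × S'.E × ZMod p → Prop := fun x y =>
    S.t x.1 = S.o y.1 ∧ S'.t x.2.1 = S'.o y.2.1 ∧ y.2.2 = x.2.2 + 1 ∧
      S.lab y.1 = w y.2.2 ∧ S'.lab y.2.1 = w y.2.2
  have hr : ∀ x y z, r x y → r x z → y = z := by
    rintro x ⟨y1, y2, y3⟩ ⟨z1, z2, z3⟩ ⟨a1, a2, a3, a4, a5⟩ ⟨b1, b2, b3, b4, b5⟩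
    simp only at a1 a2 a3 a4 a5 b1 b2 b3 b4 b5
    have e3 : y3 = z3 := a3.trans b3.symm
    have e1 : y1 = z1 := S.det _ _ (a1.symm.trans b1) (by rw [a4, b4, e3])
    have e2 : y2 = z2 := S'.det _ _ (a2.symm.trans b2) (by rw [a5, b5, e3])
    rw [e1, e2, e3]
  let R' : Set (S.E × S'.E × ZMod p) := {x | (x.1, x.2.1) ∈ R ∧ S.lab x.1 = w x.2.2}
  -- The possible sources. Outside of `B` every predecessor in `R` continues the reading of `w`
  -- backwards.
  let B : Set (S.E × S'.E × ZMod p) :=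
    {x | (S.o x.1 ∈ S.Vi ∧ S'.o x.2.1 ∈ S'.Vi) ∨ ∃ y ∈ R, S.t y.1 = S.o x.1 ∧
      S'.t y.2 = S'.o x.2.1 ∧ S.lab y.1 ≠ w (x.2.2 - 1)}
  have hback : ∀ x ∈ R', x ∉ B → ∃ y ∈ R', r y x := by
    rintro ⟨x1, x2, x3⟩ ⟨hx, hl⟩ hB
    simp only [B, Set.mem_ofPred_eq, not_or, not_exists, not_and, not_not] at hB
    rcases hR.back _ hx with h | ⟨y, hy, e1, e2⟩
    · exact absurd h.2 (hB.1 h.1)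
    · have e3 := hB.2 y hy e1 e2
      refine ⟨(y.1, y.2, x3 - 1), ⟨hy, e3⟩, e1, e2, by simp, hl, ?_⟩
      rw [← hR.matched _ hx]
      exact hl
  rcases exists_source_or_periodic r hr R' B hback (u lo, v (lo + d), (lo : ZMod p))
    ⟨hs, lu lo le_rfl h3⟩ with ⟨g, T, g1, g2, g3, g4⟩ | ⟨g, T, hT, g0, gper, g1⟩
  · left
    have hph : ∀ k ≤ T, (g k).2.2 = (g 0).2.2 + k := by
      intro k
      induction k with
      | zero => simp
      | succ k ih =>
        intro hk
        rw [(g4 k (by omega)).2.2.1, ih (by omega)]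
        push_cast; ring
    have hl : ∀ k ≤ T, S.lab (g k).1 = w (g k).2.2 ∧ S'.lab (g k).2.1 = w (g k).2.2 := by
      intro k hk
      rcases k with _ | k
      · exact ⟨g1.2, by rw [← g1.2]; exact (hR.matched _ g1.1).symm⟩
      · exact (g4 k (by omega)).2.2.2
    have hφ : (g 0).2.2 + T = lo := by rw [← hph T le_rfl, g3]
    have hph' : ∀ k : ℕ, T ≤ k → (g 0).2.2 + k = ((lo + (k - T : ℕ) : ℤ) : ZMod p) := by
      intro k hk
      push_cast [Nat.cast_sub hk]
      rw [← hφ]; ring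
    set c : ℕ → S.E := fun k => if k < T then (g k).1 else u (lo + (k - T : ℕ)) with hc
    set c' : ℕ → S'.E := fun k => if k < T then (g k).2.1 else v (lo + d + (k - T : ℕ)) with hc'
    have cle : ∀ k ≤ T, c k = (g k).1 ∧ c' k = (g k).2.1 := by
      intro k hk
      rcases hk.eq_or_lt with rfl | hk
      · simp [hc, hc', g3]
      · simp [hc, hc', hk]
    have cge : ∀ k, T ≤ k → c k = u (lo + (k - T : ℕ)) ∧ c' k = v (lo + d + (k - T : ℕ)) := by
      intro k hk
      simp [hc, hc', hk.not_gt]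
    refine ⟨(g 0).2.2, c, c', T, ⟨fun k hk => ?_, fun k hk => ?_⟩, ⟨fun k hk => ?_, fun k hk => ?_⟩,
      ?_, ?_, hφ, fun k hk => ?_⟩
    · rcases lt_or_ge k T with h | h
      · rw [(cle k h.le).1, (cle (k + 1) h).1]
        exact (g4 k h).1
      · rw [(cge k h).1, (cge (k + 1) (by omega)).1, hu.t_eq (by omega) (by omega)]
        congr 2; omega
    · rcases lt_or_ge k T with h | h
      · rw [(cle k h.le).1, (hl k h.le).1, hph k h.le]
      · rw [(cge k h).1, lu _ (by omega) (by omega), hph' k h]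
    · rcases lt_or_ge k T with h | h
      · rw [(cle k h.le).2, (cle (k + 1) h).2]
        exact (g4 k h).2.1
      · rw [(cge k h).2, (cge (k + 1) (by omega)).2, hv.t_eq (by omega) (by omega)]
        congr 2; omega
    · rcases lt_or_ge k T with h | h
      · rw [(cle k h.le).2, (hl k h.le).2, hph k h.le]
      · rw [(cge k h).2, hph' k h, ← lv _ (by omega) (by omega)]
        congr 2; ring
    · rw [(cle 0 (by omega)).1]
      rcases g2 with h | ⟨y, hy, e1, e2, e3⟩
      · exact Or.inl h.1
      · exact Or.inr ⟨y.1, e1, e3⟩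
    · rw [(cle 0 (by omega)).2]
      rcases g2 with h | ⟨y, hy, e1, e2, e3⟩
      · exact Or.inl h.2
      · exact Or.inr ⟨y.2, e2, by rwa [← hR.matched _ hy]⟩
    · have := cge (T + k) (by omega)
      rwa [show T + k - T = k by omega] at this
  · right
    intro i hi1 hi2
    have hph : ∀ k j : ℕ, (g (k + j)).2.2 = (g k).2.2 + j := by
      intro k j
      induction j with
      | zero => simp
      | succ j ih =>
        rw [← add_assoc, (g1 (k + j)).2.2.1, ih]
        push_cast; ring
    have hl : ∀ k, S.lab (g k).1 = w (g k).2.2 ∧ S'.lab (g k).2.1 = w (g k).2.2 := by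
      intro k
      have := (g1 (k + T - 1)).2.2.2
      rwa [show k + T - 1 + 1 = k + T by omega, gper] at this
    obtain ⟨k, rfl⟩ : ∃ k : ℕ, i = lo + k := ⟨(i - lo).toNat, by omega⟩
    have e1 : (g k).1 = u (lo + k) :=
      hu.walk_eq (c := fun k => (g k).1) h1 (by simp [g0]) k (by omega) fun j _ => (g1 j).1
    have e2 : (g k).2.1 = v (lo + d + k) :=
      hv.walk_eq (c := fun k => (g k).2.1) h2 (by simp [g0]) k (by omega) fun j _ => (g1 j).2.1
    have e3 : (g k).2.2 = ((lo + k : ℤ) : ZMod p) := by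
      have := hph 0 k
      rw [Nat.zero_add, g0] at this
      rw [this]; push_cast; ring
    have hT0 : (T : ZMod p) = 0 := by
      have := hph k T
      rw [gper] at this
      simpa using this
    refine ⟨⟨T, hT, hT0, fun j => (g (k + j)).1, ⟨fun j _ => (g1 (k + j)).1, fun j _ => ?_⟩, e1, ?_⟩,
      ⟨T, hT, hT0, fun j => (g (k + j)).2.1, ⟨fun j _ => (g1 (k + j)).2.1, fun j _ => ?_⟩, ?_, ?_⟩⟩
    · rw [(hl _).1, hph, e3]
    · simp only [gper, e1]
    · rw [(hl _).2, hph, e3]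
    · simp only [Nat.add_zero, e2]; congr 1; ring
    · simp only [gper, e2]; congr 1; ring

/-- At most `p - 1` steps lead to the phase `φ₁` and at most `p - 1` more to `φ₂`, so `2 * p - 2`
steps suffice. -/
theorem Entry.exists_of_walk {p : ℕ} [NeZero p] {w : ZMod p → A} (φ₁ φ₂ : ZMod p) {φ : ZMod p}
    {c : ℕ → S.E} {T : ℕ} (hc : S.IsWalk w φ c T) (hs : S.IsStart w φ (c 0)) (hT : 2 * p ≤ T + 2) :
    (φ₁ - φ).val + (φ₂ - φ₁).val ≤ T ∧
      c ((φ₁ - φ).val + (φ₂ - φ₁).val) ∈ gates S w φ₁ φ₂ (c T) (φ + T) := by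
  have h1 := ZMod.val_lt (φ₁ - φ)
  have h2 := ZMod.val_lt (φ₂ - φ₁)
  have key : ∀ x y : ZMod p, ∀ k < (y - x).val, x + k ≠ y := by
    intro x y k hk hE
    rw [← hE, add_sub_cancel_left, ZMod.val_natCast_of_lt (hk.trans (ZMod.val_lt _))] at hk
    omega
  refine ⟨by omega, ⟨c, φ, T, (φ₁ - φ).val, (φ₁ - φ).val + (φ₂ - φ₁).val, hc, hs, rfl, rfl, ?_,
    key φ φ₁, by omega, ?_, ?_, by omega⟩, rfl⟩
  · rw [ZMod.natCast_zmod_val]; ring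
  · rw [Nat.cast_add, ZMod.natCast_zmod_val, ZMod.natCast_zmod_val]; ring
  · intro k hk hk' hE
    refine key φ₁ φ₂ (k - (φ₁ - φ).val) (by omega) ?_
    rw [Nat.cast_sub hk, ZMod.natCast_zmod_val, ← hE]; ring

/-- If the second walk took longer from the common node, it would by determinism visit `ρ` in the
phase `ψ` once before, and the surplus would be a closed walk reading `w`. -/
theorem time_le_of_not_periodic {p : ℕ} {w : ZMod p → A} {φ φ' ψ : ZMod p} {c c' : ℕ → S.E}
    {T T' x x' y y' : ℕ} {ρ : S.E} (hc : S.IsWalk w φ c T) (hc' : S.IsWalk w φ' c' T')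
    (hcx : c x = c' x') (hφ : φ + x = φ' + x') (hy : y ≤ T) (hy' : y' ≤ T') (hxy : x ≤ y)
    (hxy' : x' ≤ y') (h : c y = ρ) (h' : c' y' = ρ) (hψ : φ + y = ψ) (hψ' : φ' + y' = ψ)
    (hper : ¬ ∃ T, IsPeriodic S w ρ ψ T) : y' - x' ≤ y - x := by
  by_contra hlt
  refine hper ⟨(y' - x') - (y - x), by omega, ?_, fun j => c' (x' + (y - x) + j),
    ⟨fun j hj => hc'.1 (x' + (y - x) + j) (by omega), fun j hj => ?_⟩, ?_, ?_⟩
  · have e : φ' + ((x' + (y - x) : ℕ) : ZMod p) = ψ := by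
      rw [← phase_add hφ (y - x), show x + (y - x) = y by omega, hψ]
    have : (((y' - x') - (y - x) : ℕ) : ZMod p) = (y' : ZMod p) - ((x' + (y - x) : ℕ) : ZMod p) := by
      rw [← Nat.cast_sub (by omega)]; congr 1; omega
    rw [this]
    linear_combination hψ' - e
  · rw [hc'.2 _ (by omega)]
    congr 1
    have e : φ' + ((x' + (y - x) : ℕ) : ZMod p) = ψ := by
      rw [← phase_add hφ (y - x), show x + (y - x) = y by omega, hψ]
    rw [Nat.cast_add, ← add_assoc, e]
  · have := hc.agree hc' hcx hφ (y - x) (by omega) (by omega)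
    rw [show x + (y - x) = y by omega, h] at this
    simpa using this.symm
  · simp only
    rw [show x' + (y - x) + (y' - x' - (y - x)) = y' by omega, h']

end LGraph

/-! ### Parallel diagonals that read the same periodic word -/

namespace LGraph

variable {A : Type*} {S S' : LGraph A}

open Classical in
/-- The number of edges on the diagonal `d` that are not in `X`. -/
noncomputable def diagCount (X : Set (S.E × S'.E)) (u : ℤ → S.E) (v : ℤ → S'.E) (lo hi d : ℤ) : ℕ :=
  ((Finset.Ico lo hi).filter fun i => (u i, v (i + d)) ∉ X).card

/-- Many diagonals on which the same periodic word is read: if the walk is not periodic, every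
diagonal is determined by a pair of gates. -/
theorem card_le_of_not_periodic [Finite S.E] [Finite S'.E] {R : Set (S.E × S'.E)}
    (hR : BackClosed R) {ι ι' : Type*} [Finite ι] [Finite ι'] {C : S.Chains ι} {C' : S'.Chains ι'}
    (hVi : S.Vi.Finite) (hVi' : S'.Vi.Finite) {a : ι} {b : ι'} {m n : ℕ} {u : ℤ → S.E}
    {v : ℤ → S'.E} (hu : C.Enum a m u) (hv : C'.Enum b n v) {p : ℕ} [NeZero p] {w : ZMod p → A}
    (prim : ∀ c, (∀ φ, w (φ + c) = w φ) → c = 0) (G : Finset ℤ) (lo hi : ℤ → ℤ) (d₀ iu jv : ℤ)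
    (hlo : ∀ d ∈ G, 0 ≤ lo d ∧ 0 ≤ lo d + d) (hhi : ∀ d ∈ G, hi d ≤ m ∧ hi d + d ≤ n)
    (hd : ∀ d ∈ G, (p : ℤ) ∣ d - d₀)
    (hiu : ∀ d ∈ G, lo d + 2 * p ≤ iu + 2 ∧ lo d ≤ iu ∧ iu < hi d)
    (hjv : ∀ d ∈ G, lo d + d + 2 * p ≤ jv + 2 ∧ lo d + d ≤ jv ∧ jv < hi d + d)
    (lu : ∀ d ∈ G, ∀ i, lo d ≤ i → i < hi d → S.lab (u i) = w (i : ZMod p))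
    (lv : ∀ d ∈ G, ∀ i, lo d ≤ i → i < hi d → S'.lab (v (i + d)) = w (i : ZMod p))
    (hs : ∀ d ∈ G, (u (lo d), v (lo d + d)) ∈ R)
    (hper : ¬ ((∃ T, IsPeriodic S w (u iu) iu T) ∧
      ∃ T, IsPeriodic S' w (v jv) ((jv - d₀ : ℤ) : ZMod p) T)) :
    G.card ≤ (2 * (Nat.card ι + S.Vi.ncard + 1)) * (2 * (Nat.card ι' + S'.Vi.ncard + 1)) := by
  classical
  obtain ⟨_, rank, φ₁, φ₂, inj, mono, bot, top⟩ := exists_rank w prim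
  have hcast : ∀ d ∈ G, ∀ x : ℤ, ((x - d : ℤ) : ZMod p) = ((x - d₀ : ℤ) : ZMod p) := by
    intro d hd' x
    rw [ZMod.intCast_eq_intCast_iff_dvd_sub, show x - d₀ - (x - d) = d - d₀ by ring]
    exact hd d hd'
  have hw : ∀ d ∈ G, ∃ (φ : ZMod p) (c : ℕ → S.E) (c' : ℕ → S'.E) (T : ℕ),
      S.IsWalk w φ c (T + (hi d - 1 - lo d).toNat) ∧
      S'.IsWalk w φ c' (T + (hi d - 1 - lo d).toNat) ∧
      S.IsStart w φ (c 0) ∧ S'.IsStart w φ (c' 0) ∧ φ + T = lo d ∧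
      ∀ k : ℕ, lo d + k < hi d → c (T + k) = u (lo d + k) ∧ c' (T + k) = v (lo d + d + k) := by
    intro d hdG
    obtain ⟨h1, h2⟩ := hlo d hdG
    obtain ⟨h3, h4⟩ := hhi d hdG
    obtain ⟨h5, h6, h7⟩ := hiu d hdG
    obtain ⟨h8, h9, h10⟩ := hjv d hdG
    refine (exists_pair_walk hR hu hv h1 h2 (h6.trans_lt h7) h3 h4 (lu d hdG) (lv d hdG)
      (hs d hdG)).resolve_right fun h => hper ⟨(h iu h6 h7).1, ?_⟩
    have := (h (jv - d) (by omega) (by omega)).2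
    rwa [hcast d hdG, sub_add_cancel] at this
  have : Nonempty S.E := ⟨u 0⟩
  have : Nonempty S'.E := ⟨v 0⟩
  choose! φ c c' T hc hc' st st' hφ hck using hw
  set tm : ℤ → ℕ := fun d => (φ₁ - φ d).val + (φ₂ - φ₁).val with htm
  set X : ℤ → ℕ := fun d => T d + (iu - lo d).toNat with hX
  set Y : ℤ → ℕ := fun d => T d + (jv - d - lo d).toNat with hY
  have gate : ∀ d ∈ G, tm d ≤ X d ∧ c d (tm d) ∈ gates S w φ₁ φ₂ (u iu) (iu : ZMod p) ∧
      c d (X d) = u iu ∧ φ d + X d = iu ∧ X d ≤ T d + (hi d - 1 - lo d).toNat ∧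
      c' d (X d) = v (iu + d) := by
    intro d hdG
    obtain ⟨h5, h6, h7⟩ := hiu d hdG
    obtain ⟨e1, e2⟩ := hck d hdG (iu - lo d).toNat (by omega)
    rw [show lo d + ((iu - lo d).toNat : ℤ) = iu by omega] at e1
    rw [show lo d + d + ((iu - lo d).toNat : ℤ) = iu + d by omega] at e2
    have hle : X d ≤ T d + (hi d - 1 - lo d).toNat := by simp only [hX]; omega
    have eφ : φ d + X d = iu := by
      simp only [hX]
      rw [Nat.cast_add, ← add_assoc, hφ d hdG, ← Int.cast_natCast (R := ZMod p) (iu - lo d).toNat,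
        ← Int.cast_add]
      congr 1; omega
    have := Entry.exists_of_walk φ₁ φ₂ (T := X d)
      ⟨fun k hk => (hc d hdG).1 k (by omega), fun k hk => (hc d hdG).2 k (by omega)⟩ (st d hdG)
      (by simp only [hX]; omega)
    rw [e1, eφ] at this
    exact ⟨this.1, this.2, e1, eφ, hle, e2⟩
  have gate' : ∀ d ∈ G, tm d ≤ Y d ∧
      c' d (tm d) ∈ gates S' w φ₁ φ₂ (v jv) ((jv - d₀ : ℤ) : ZMod p) ∧
      c' d (Y d) = v jv ∧ φ d + Y d = ((jv - d₀ : ℤ) : ZMod p) ∧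
      Y d ≤ T d + (hi d - 1 - lo d).toNat ∧ c d (Y d) = u (jv - d) := by
    intro d hdG
    obtain ⟨h5, h6, h7⟩ := hjv d hdG
    obtain ⟨e1, e2⟩ := hck d hdG (jv - d - lo d).toNat (by omega)
    rw [show lo d + ((jv - d - lo d).toNat : ℤ) = jv - d by omega] at e1
    rw [show lo d + d + ((jv - d - lo d).toNat : ℤ) = jv by omega] at e2
    have hle : Y d ≤ T d + (hi d - 1 - lo d).toNat := by simp only [hY]; omega
    have eφ : φ d + Y d = ((jv - d₀ : ℤ) : ZMod p) := by
      simp only [hY]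
      rw [Nat.cast_add, ← add_assoc, hφ d hdG,
        ← Int.cast_natCast (R := ZMod p) (jv - d - lo d).toNat, ← Int.cast_add, ← hcast d hdG]
      congr 1; omega
    have := Entry.exists_of_walk φ₁ φ₂ (T := Y d)
      ⟨fun k hk => (hc' d hdG).1 k (by omega), fun k hk => (hc' d hdG).2 k (by omega)⟩ (st' d hdG)
      (by simp only [hY]; omega)
    rw [e2, eφ] at this
    exact ⟨this.1, this.2, e2, eφ, hle, e1⟩
  have htmφ : ∀ d, φ d + tm d = φ₂ := by
    intro d
    simp only [htm]
    rw [Nat.cast_add, ZMod.natCast_zmod_val, ZMod.natCast_zmod_val]; ring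
  have hinj : ∀ d ∈ G, ∀ e ∈ G, c d (tm d) = c e (tm e) → c' d (tm d) = c' e (tm e) → d = e := by
    intro d hdG e heG h1 h2
    obtain ⟨a1, -, a3, a4, a5, a6⟩ := gate d hdG
    obtain ⟨b1, -, b3, b4, b5, b6⟩ := gate e heG
    obtain ⟨a1', -, a3', a4', a5', a6'⟩ := gate' d hdG
    obtain ⟨b1', -, b3', b4', b5', b6'⟩ := gate' e heG
    have hφ' : φ d + tm d = φ e + tm e := (htmφ d).trans (htmφ e).symm
    rw [not_and_or] at hper
    -- On the side that is not periodic, the time from the gate to the fixed edge is the same for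
    -- `d` and `e`. Hence the walks on the other side agree when that edge is met, and injectivity
    -- of the enumeration gives `d = e`.
    rcases hper with hper | hper
    · have l1 := time_le_of_not_periodic (hc d hdG) (hc e heG) h1 hφ' a5 b5 a1 b1 a3 b3 a4 b4 hper
      have l2 := time_le_of_not_periodic (hc e heG) (hc d hdG) h1.symm hφ'.symm b5 a5 b1 a1 b3 a3
        b4 a4 hper
      have := (hc' d hdG).agree (hc' e heG) h2 hφ' (X d - tm d) (by omega) (by omega)
      rw [show tm d + (X d - tm d) = X d by omega, show tm e + (X d - tm d) = X e by omega, a6,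
        b6] at this
      have := hv.inj (by have := hlo d hdG; have := hiu d hdG; omega)
        (by have := hhi d hdG; have := hiu d hdG; omega)
        (by have := hlo e heG; have := hiu e heG; omega)
        (by have := hhi e heG; have := hiu e heG; omega) this
      omega
    · have l1 := time_le_of_not_periodic (hc' d hdG) (hc' e heG) h2 hφ' a5' b5' a1' b1' a3' b3'
        a4' b4' hper
      have l2 := time_le_of_not_periodic (hc' e heG) (hc' d hdG) h2.symm hφ'.symm b5' a5' b1' a1'
        b3' a3' b4' a4' hper
      have := (hc d hdG).agree (hc e heG) h1 hφ' (Y d - tm d) (by omega) (by omega)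
      rw [show tm d + (Y d - tm d) = Y d by omega, show tm e + (Y d - tm d) = Y e by omega, a6',
        b6'] at this
      have := hu.inj (by have := hlo d hdG; have := hjv d hdG; omega)
        (by have := hhi d hdG; have := hjv d hdG; omega)
        (by have := hlo e heG; have := hjv e heG; omega)
        (by have := hhi e heG; have := hjv e heG; omega) this
      omega
  rw [← Set.ncard_coe_finset]
  calc (G : Set ℤ).ncard
      ≤ (gates S w φ₁ φ₂ (u iu) (iu : ZMod p) ×ˢ
          gates S' w φ₁ φ₂ (v jv) ((jv - d₀ : ℤ) : ZMod p)).ncard := by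
        refine Set.ncard_le_ncard_of_injOn (fun d => (c d (tm d), c' d (tm d)))
          (fun d hdG => ⟨(gate d hdG).2.1, (gate' d hdG).2.1⟩) ?_
          ((Set.toFinite _).prod (Set.toFinite _))
        intro d hdG e heG h
        exact hinj d hdG e heG (congrArg Prod.fst h) (congrArg Prod.snd h)
    _ = _ * _ := Set.ncard_prod
    _ ≤ _ := Nat.mul_le_mul (ncard_gates_le C hVi inj mono bot top)
        (ncard_gates_le C' hVi' inj mono bot top)

/-- If the walks are periodic, then few edges are outside of `X`. -/
theorem sum_diagCount_le_of_periodic {X : Set (S.E × S'.E)} {θ θ' : ℕ} (hX : ContainsLong X θ θ')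
    {ι ι' : Type*} {C : S.Chains ι} {C' : S'.Chains ι'} {a : ι} {b : ι'} {m n : ℕ} {u : ℤ → S.E}
    {v : ℤ → S'.E} (hu : C.Enum a m u) (hv : C'.Enum b n v) {p : ℕ} [NeZero p] {w : ZMod p → A}
    (prim : ∀ c, (∀ φ, w (φ + c) = w φ) → c = 0) (G : Finset ℤ) (lo hi : ℤ → ℤ) (d₀ iu jv : ℤ)
    (l₁ h₁ l₂ h₂ : ℤ)
    (hlo : ∀ d ∈ G, 0 ≤ lo d ∧ 0 ≤ lo d + d) (hhi : ∀ d ∈ G, hi d ≤ m ∧ hi d + d ≤ n)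
    (hlh : ∀ d ∈ G, l₁ ≤ lo d ∧ hi d ≤ h₁) (hlh' : ∀ d ∈ G, l₂ ≤ lo d + d ∧ hi d + d ≤ h₂)
    (hd : ∀ d ∈ G, (p : ℤ) ∣ d - d₀) (hiu : 0 ≤ iu ∧ iu < m) (hjv : 0 ≤ jv ∧ jv < n)
    (hper : ∃ T, IsPeriodic S w (u iu) iu T)
    (hper' : ∃ T, IsPeriodic S' w (v jv) ((jv - d₀ : ℤ) : ZMod p) T) :
    ∑ d ∈ G, diagCount X u v (lo d) (hi d) d ≤ θ * (h₂ - l₂).toNat + θ' * (h₁ - l₁).toNat := by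
  classical
  have hp : 0 < p := NeZero.pos p
  rw [show (iu : ZMod p) = ((iu - 0 : ℤ) : ZMod p) by simp] at hper
  obtain ⟨D, c, D0, c1, c2, c3, c4, c5⟩ := IsPeriodic.exists_biwalk hper
  obtain ⟨D', c', D0', c1', c2', c3', c4', c5'⟩ := IsPeriodic.exists_biwalk hper'
  have cu : ∀ i : ℤ, 0 ≤ i → i < m → c i = u i := fun i h h' =>
    hu.biwalk_eq c2 hiu.1 hiu.2 c1 h h'
  have cv : ∀ j : ℤ, 0 ≤ j → j < n → c' j = v j := fun j h h' =>
    hv.biwalk_eq c2' hjv.1 hjv.2 c1' h h'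
  -- If both closed walks have enough periods, all pairs are in `X`. If `D < θ`, at most `D`
  -- diagonals of `G` meet a given index of `v`: the possible indices of `u` are congruent modulo
  -- `p`, and `u` is injective while the closed walk repeats after `D * p` steps. The case `D' < θ'`
  -- is symmetric.
  by_cases hθ : θ ≤ D ∧ θ' ≤ D'
  · have : ∀ d ∈ G, diagCount X u v (lo d) (hi d) d = 0 := by
      intro d hdG
      rw [diagCount, Finset.card_eq_zero, Finset.filter_eq_empty_iff]
      intro i hi'
      rw [Finset.mem_Ico] at hi'
      have e1 := hlo d hdG
      have e2 := hhi d hdG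
      rw [not_not, ← cu i (by omega) (by omega), ← cv (i + d) (by omega) (by omega)]
      have hl : ∀ k, w ((i + k : ℤ) : ZMod p) = w ((i + d + k - d₀ : ℤ) : ZMod p) := by
        intro k
        congr 1
        rw [ZMod.intCast_eq_intCast_iff_dvd_sub, show i + d + k - d₀ - (i + k) = d - d₀ by ring]
        exact hd d hdG
      have hmin : ∀ {W : ℤ → A} {s : ℤ}, (∀ k : ℤ, W k = w ((k - s : ℤ) : ZMod p)) → ∀ r : ℕ,
          (∀ k, W (k + r) = W k) → (p : ℤ) ∣ r := by
        intro W s hW r hr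
        have := prim (r : ZMod p) fun φ => by
          have := hr (φ.val + s)
          rw [hW, hW, show (φ.val : ℤ) + s + r - s = φ.val + r by ring,
            show (φ.val : ℤ) + s - s = φ.val by ring] at this
          push_cast at this
          rwa [ZMod.natCast_zmod_val] at this
        exact_mod_cast (ZMod.natCast_eq_zero_iff _ _).1 this
      have key := hX p D D' (fun k => c (i + k)) (fun k => c' (i + d + k)) hp D0 D0' hθ.1 hθ.2
        (fun k => by rw [c2, add_assoc]) (fun k => by rw [c2', add_assoc])
        (fun k => by rw [c3, c3', sub_zero, hl])
        (fun k => by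
          rw [c3, c3]; congr 1
          rw [ZMod.intCast_eq_intCast_iff_dvd_sub]
          exact ⟨-1, by ring⟩)
        (fun k => (congrArg c (by ring)).trans (c4 (i + k)))
        (fun k => (congrArg c' (by ring)).trans (c4' (i + d + k)))
        (fun r hr h => by
          have hr' : ∀ k, c (k + r) = c k := fun k => by
            have := h (k - i)
            rwa [show i + (k - i + r) = k + r by ring, show i + (k - i) = k by ring] at this
          have h1 := hmin (W := fun k => S.lab (c k)) c3 r fun k => by simp only [hr']
          have h2 := c5 (0 + r) 0 (by simpa using h1) (hr' 0)
          have h3 : D * p ∣ r := by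
            rw [← Int.natCast_dvd_natCast]; simpa using h2
          exact Nat.le_of_dvd hr h3)
        (fun r hr h => by
          have hr' : ∀ k, c' (k + r) = c' k := fun k => by
            have := h (k - (i + d))
            rwa [show i + d + (k - (i + d) + r) = k + r by ring,
              show i + d + (k - (i + d)) = k by ring] at this
          have h1 := hmin (W := fun k => S'.lab (c' k)) c3' r fun k => by simp only [hr']
          have h2 := c5' (0 + r) 0 (by simpa using h1) (hr' 0)
          have h3 : D' * p ∣ r := by
            rw [← Int.natCast_dvd_natCast]; simpa using h2
          exact Nat.le_of_dvd hr h3)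
      simpa using key
    rw [Finset.sum_congr rfl this]
    simp
  · set P : Finset (Σ _ : ℤ, ℤ) := G.sigma fun d =>
      (Finset.Ico (lo d) (hi d)).filter fun i => (u i, v (i + d)) ∉ X with hP
    have hPc : ∑ d ∈ G, diagCount X u v (lo d) (hi d) d = P.card := by
      rw [hP, Finset.card_sigma]; rfl
    rw [hPc]
    have memP : ∀ x ∈ P, x.1 ∈ G ∧ lo x.1 ≤ x.2 ∧ x.2 < hi x.1 := by
      intro x hx
      rw [hP, Finset.mem_sigma, Finset.mem_filter, Finset.mem_Ico] at hx
      exact ⟨hx.1, hx.2.1⟩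
    rcases not_and_or.1 hθ with h | h
    · refine le_trans ?_ (Nat.le_add_right _ _)
      refine (Finset.card_le_mul_card_image_of_maps_to (t := Finset.Ico l₂ h₂)
        (f := fun x => x.2 + x.1) (fun x hx => ?_) θ fun j _ => ?_).trans (by rw [Int.card_Ico])
      · obtain ⟨e1, e2, e3⟩ := memP x hx
        have := hlh' x.1 e1
        simp only [Finset.mem_Ico]
        omega
      · refine le_trans ?_ (not_le.1 h).le
        rw [← Finset.card_image_of_injOn (f := fun x : (Σ _ : ℤ, ℤ) => x.2)]
        · refine card_le_of_class _ hp D0 (j - d₀) (fun i hi => ?_) fun i hi i' hi' hdvd => ?_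
          · obtain ⟨x, hx, rfl⟩ := Finset.mem_image.1 hi
            obtain ⟨hx, hxe⟩ := Finset.mem_filter.1 hx
            rw [← hxe, show x.2 - (x.2 + x.1 - d₀) = -(x.1 - d₀) by ring]
            exact dvd_neg.2 (hd _ (memP x hx).1)
          · obtain ⟨x, hx, rfl⟩ := Finset.mem_image.1 hi
            obtain ⟨y, hy, rfl⟩ := Finset.mem_image.1 hi'
            obtain ⟨a1, a2, a3⟩ := memP x (Finset.mem_filter.1 hx).1
            obtain ⟨b1, b2, b3⟩ := memP y (Finset.mem_filter.1 hy).1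
            have := hlo _ a1
            have := hhi _ a1
            have := hlo _ b1
            have := hhi _ b1
            refine hu.inj (by omega) (by omega) (by omega) (by omega) ?_
            rw [← cu _ (by omega) (by omega), ← cu _ (by omega) (by omega)]
            obtain ⟨q, hq⟩ := hdvd
            have hc : Function.Periodic c (D * p : ℕ) := c4
            have := hc.int_mul q y.2
            rw [← this]
            congr 1
            rw [Int.cast_id]
            linarith
        · intro x hx y hy hxy
          have hx := (Finset.mem_filter.1 hx).2
          have hy := (Finset.mem_filter.1 hy).2
          have hxy : x.2 = y.2 := hxy
          have : x.1 = y.1 := by omega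
          exact Sigma.ext this (heq_of_eq hxy)
    · refine le_trans ?_ (Nat.le_add_left _ _)
      refine (Finset.card_le_mul_card_image_of_maps_to (t := Finset.Ico l₁ h₁)
        (f := fun x => x.2) (fun x hx => ?_) θ' fun i _ => ?_).trans (by rw [Int.card_Ico])
      · obtain ⟨e1, e2, e3⟩ := memP x hx
        have := hlh x.1 e1
        simp only [Finset.mem_Ico]
        omega
      · refine le_trans ?_ (not_le.1 h).le
        rw [← Finset.card_image_of_injOn (f := fun x : (Σ _ : ℤ, ℤ) => x.2 + x.1)]
        · refine card_le_of_class _ hp D0' (i + d₀) (fun j hj => ?_) fun j hj j' hj' hdvd => ?_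
          · obtain ⟨x, hx, rfl⟩ := Finset.mem_image.1 hj
            obtain ⟨hx, hxe⟩ := Finset.mem_filter.1 hx
            rw [← hxe, show x.2 + x.1 - (x.2 + d₀) = x.1 - d₀ by ring]
            exact hd _ (memP x hx).1
          · obtain ⟨x, hx, rfl⟩ := Finset.mem_image.1 hj
            obtain ⟨y, hy, rfl⟩ := Finset.mem_image.1 hj'
            obtain ⟨a1, a2, a3⟩ := memP x (Finset.mem_filter.1 hx).1
            obtain ⟨b1, b2, b3⟩ := memP y (Finset.mem_filter.1 hy).1
            have := hlo _ a1
            have := hhi _ a1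
            have := hlo _ b1
            have := hhi _ b1
            refine hv.inj (by omega) (by omega) (by omega) (by omega) ?_
            rw [← cv _ (by omega) (by omega), ← cv _ (by omega) (by omega)]
            obtain ⟨q, hq⟩ := hdvd
            have hc : Function.Periodic c' (D' * p : ℕ) := c4'
            have := hc.int_mul q (y.2 + y.1)
            rw [← this]
            congr 1
            rw [Int.cast_id]
            linarith
        · intro x hx y hy hxy
          have hx := (Finset.mem_filter.1 hx).2
          have hy := (Finset.mem_filter.1 hy).2
          have hxy : x.2 + x.1 = y.2 + y.1 := hxy
          have : x.1 = y.1 := by omega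
          exact Sigma.ext this (heq_of_eq (by omega))

end LGraph

/-! ### Clusters of diagonals on which all labels agree -/

namespace LGraph

/-- The least period of a word divides every other period that is not too long. -/
theorem dvd_of_least_period {A : Type*} (z : ℤ → A) (lo hi : ℤ) {p δ : ℕ} (hp : 0 < p)
    (per : ∀ i, lo ≤ i → i + p < hi → z i = z (i + p))
    (least : ∀ q, 0 < q → q < p → ¬ ∀ i, lo ≤ i → i + q < hi → z i = z (i + q))
    (per' : ∀ i, lo ≤ i → i + δ < hi → z i = z (i + δ)) (hle : (p : ℤ) + δ ≤ hi - lo) : p ∣ δ := by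
  have mult : ∀ k : ℕ, ∀ i, lo ≤ i → i + k * p < hi → z i = z (i + k * p) := by
    intro k
    induction k with
    | zero => intro i _ _; simp
    | succ k ih =>
      intro i hi1 hi2
      push_cast at hi2 ⊢
      have hkp : (0 : ℤ) ≤ k * p := by positivity
      rw [ih i hi1 (by linarith), per (i + k * p) (by linarith) (by linarith)]
      congr 1; ring
  rw [Nat.dvd_iff_mod_eq_zero]
  by_contra hr
  -- The remainder would be a shorter period: modulo `p` every position moves into the first `p`
  -- ones, and there `per'` applies because `p + δ` is at most the length.
  refine least (δ % p) (Nat.pos_of_ne_zero hr) (Nat.mod_lt _ hp) fun i h1 h2 => ?_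
  have hp' : (0 : ℤ) < p := by exact_mod_cast hp
  obtain ⟨k, hk⟩ : ∃ k : ℕ, (i - lo) = (i - lo) % p + k * p := by
    refine ⟨((i - lo) / p).toNat, ?_⟩
    have h3 := Int.emod_add_mul_ediv (i - lo) p
    rw [Int.toNat_of_nonneg (Int.ediv_nonneg (by omega) hp'.le)]
    linarith
  have m1 := Int.emod_nonneg (i - lo) hp'.ne'
  have m2 := Int.emod_lt_of_pos (i - lo) hp'
  set i' := lo + (i - lo) % p with hi'
  have e1 : i = i' + k * p := by omega
  have hδ : (δ : ℤ) = (δ % p : ℕ) + (δ / p : ℕ) * p := by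
    have := Nat.mod_add_div δ p
    rw [mul_comm p] at this
    exact_mod_cast this.symm
  have hkp : (0 : ℤ) ≤ k * p := by positivity
  have hqp : (0 : ℤ) ≤ (δ / p : ℕ) * p := by positivity
  have a1 : z i' = z i := by rw [e1]; exact mult k i' (by omega) (by omega)
  have a2 : z (i' + (δ % p : ℕ)) = z (i + (δ % p : ℕ)) := by
    rw [mult k (i' + (δ % p : ℕ)) (by omega) (by omega)]
    congr 1; omega
  have a3 : z i' = z (i' + δ) := per' i' (by omega) (by omega)
  have a4 : z (i' + (δ % p : ℕ)) = z (i' + δ) := by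
    rw [mult (δ / p) (i' + (δ % p : ℕ)) (by omega) (by omega)]
    congr 1; omega
  rw [← a1, ← a2, a3, a4]

/-- The first position on the diagonal `d` of an `m × n` rectangle. -/
def diagLo (d : ℤ) : ℤ := max 0 (-d)

/-- One more than the last position on the diagonal `d`. -/
def diagHi (m n : ℕ) (d : ℤ) : ℤ := min m (n - d)

/-- The length of the diagonal `d`. -/
def diagLen (m n : ℕ) (d : ℤ) : ℕ := (diagHi m n d - diagLo d).toNat

variable {A : Type*} {S S' : LGraph A}

/-- The labels agree along the diagonal `d`. -/
def IsFull (u : ℤ → S.E) (v : ℤ → S'.E) (m n : ℕ) (d : ℤ) : Prop :=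
  ∀ i, diagLo d ≤ i → i < diagHi m n d → S.lab (u i) = S'.lab (v (i + d))

/-- Comparison with `d₀` gives the labels the period `|d - d₀|` for every `d` in the cluster. As
these are at most `L / 4`, the least period `p` divides them all, and all the diagonals read one
primitive word of period `p`. Depending on periodicity, either few pairs lie outside of `X`, or
there are few diagonals, each of length at most `L`. -/
theorem sum_diagCount_cluster_le [Finite S.E] [Finite S'.E] {R X : Set (S.E × S'.E)} {θ θ' : ℕ}
    (hR : BackClosed R) (hX : ContainsLong X θ θ') {ι ι' : Type*} [Finite ι] [Finite ι']
    {C : S.Chains ι} {C' : S'.Chains ι'} (hVi : S.Vi.Finite) (hVi' : S'.Vi.Finite) {a : ι} {b : ι'}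
    {m n : ℕ} {u : ℤ → S.E} {v : ℤ → S'.E} (hu : C.Enum a m u) (hv : C'.Enum b n v)
    (G : Finset ℤ) (d₀ : ℤ) (hd₀ : d₀ ∈ G) (hlt : ∀ d ∈ G, diagLo d < diagHi m n d)
    (full : ∀ d ∈ G, IsFull u v m n d)
    (hs : ∀ d ∈ G, (u (diagLo d), v (diagLo d + d)) ∈ R)
    (hd : ∀ d ∈ G, 4 * |d - d₀| ≤ diagLen m n d₀)
    (hlen : ∀ d ∈ G, diagLen m n d ≤ diagLen m n d₀) :
    ∑ d ∈ G, diagCount X u v (diagLo d) (diagHi m n d) d ≤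
      ((2 * (Nat.card ι + S.Vi.ncard + 1)) * (2 * (Nat.card ι' + S'.Vi.ncard + 1)) + 2 * (θ + θ')) *
        diagLen m n d₀ := by
  classical
  set L := diagLen m n d₀ with hL
  replace hd : ∀ d ∈ G, -(L : ℤ) ≤ 4 * (d - d₀) ∧ 4 * (d - d₀) ≤ L := fun d hdG => by
    have h := abs_le.1 (show |d - d₀| ≤ L / 4 by have := hd d hdG; omega)
    omega
  have hcount : ∀ d ∈ G, diagCount X u v (diagLo d) (diagHi m n d) d ≤ L := by
    intro d hdG
    refine (Finset.card_filter_le _ _).trans ?_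
    rw [Int.card_Ico]
    exact hlen d hdG
  have hLpos := hlt d₀ hd₀
  have hLe : (L : ℤ) = diagHi m n d₀ - diagLo d₀ := by
    rw [hL, diagLen, Int.toNat_of_nonneg (by omega)]
  by_cases hG : ∀ d ∈ G, d = d₀
  · rw [Finset.eq_singleton_iff_unique_mem.2 ⟨hd₀, hG⟩, Finset.sum_singleton]
    refine (hcount d₀ hd₀).trans (Nat.le_mul_of_pos_left _ ?_)
    positivity
  push Not at hG
  obtain ⟨d₁, hd₁, hne⟩ := hG
  set z : ℤ → A := fun i => S.lab (u i) with hz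
  have hper : ∀ d ∈ G, ∀ i, diagLo d₀ ≤ i → i + (d - d₀).natAbs < diagHi m n d₀ →
      z i = z (i + (d - d₀).natAbs) := by
    intro d hdG i h1 h2
    have h3 := hd d hdG
    rcases le_total d₀ d with hle | hle
    · have e : ((d - d₀).natAbs : ℤ) = d - d₀ := by omega
      rw [e] at h2 ⊢
      have f1 := full d hdG i (by unfold diagLo at *; omega) (by unfold diagHi at *; omega)
      have f2 := full d₀ hd₀ (i + (d - d₀)) (by omega) h2
      rw [show i + (d - d₀) + d₀ = i + d by ring] at f2
      exact f1.trans f2.symm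
    · have e : ((d - d₀).natAbs : ℤ) = d₀ - d := by omega
      rw [e] at h2 ⊢
      have f1 := full d hdG (i + (d₀ - d)) (by unfold diagLo at *; omega)
        (by unfold diagHi at *; omega)
      have f2 := full d₀ hd₀ i h1 (by omega)
      rw [show i + (d₀ - d) + d = i + d₀ by ring] at f1
      exact f2.trans f1.symm
  have hex : ∃ q : ℕ, 0 < q ∧ ∀ i, diagLo d₀ ≤ i → i + q < diagHi m n d₀ → z i = z (i + q) :=
    ⟨(d₁ - d₀).natAbs, by omega, hper d₁ hd₁⟩
  set p := Nat.find hex with hp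
  obtain ⟨hp0, pper⟩ := Nat.find_spec hex
  rw [← hp] at hp0 pper
  have hpd : p ≤ (d₁ - d₀).natAbs := Nat.find_min' hex ⟨by omega, hper d₁ hd₁⟩
  have hd₁' := hd d₁ hd₁
  have least : ∀ q, 0 < q → q < p → ¬ ∀ i, diagLo d₀ ≤ i → i + q < diagHi m n d₀ →
      z i = z (i + q) := fun q hq hqp h => Nat.find_min hex hqp ⟨hq, h⟩
  have hdvd : ∀ d ∈ G, (p : ℤ) ∣ d - d₀ := by
    intro d hdG
    have := hd d hdG
    have := dvd_of_least_period z _ _ hp0 pper least (hper d hdG) (by omega)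
    exact Int.natCast_dvd.2 this
  have : NeZero p := ⟨hp0.ne'⟩
  have hp' : (0 : ℤ) < p := by exact_mod_cast hp0
  -- A phase is evaluated at its representative among the first `p` positions of the diagonal `d₀`.
  set w : ZMod p → A := fun φ => z (diagLo d₀ + (φ - (diagLo d₀ : ZMod p)).val) with hw
  have mult : ∀ k : ℕ, ∀ i, diagLo d₀ ≤ i → i + k * p < diagHi m n d₀ → z i = z (i + k * p) := by
    intro k
    induction k with
    | zero => intro i _ _; simp
    | succ k ih =>
      intro i hi1 hi2
      push_cast at hi2 ⊢
      have hkp : (0 : ℤ) ≤ k * p := by positivity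
      rw [ih i hi1 (by linarith), pper (i + k * p) (by linarith) (by linarith)]
      congr 1; ring
  have zw : ∀ i, diagLo d₀ ≤ i → i < diagHi m n d₀ → z i = w (i : ZMod p) := by
    intro i h1 h2
    simp only [hw]
    rw [← Int.cast_sub, ZMod.val_intCast]
    have h3 := Int.emod_add_mul_ediv (i - diagLo d₀) p
    have h4 : (0 : ℤ) ≤ (i - diagLo d₀) / p := Int.ediv_nonneg (by omega) hp'.le
    have h5 := Int.emod_nonneg (i - diagLo d₀) hp'.ne'
    have h6 : (((i - diagLo d₀) / p).toNat : ℤ) = (i - diagLo d₀) / p := Int.toNat_of_nonneg h4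
    have h7 : diagLo d₀ + (i - diagLo d₀) % p + ((i - diagLo d₀) / p).toNat * p = i := by
      rw [h6]; linarith
    have h8 := mult ((i - diagLo d₀) / p).toNat (diagLo d₀ + (i - diagLo d₀) % p) (by omega)
      (by rw [h7]; exact h2)
    rw [h8, h7]
  have prim : ∀ c, (∀ φ, w (φ + c) = w φ) → c = 0 := by
    intro c hc
    by_contra h0
    refine least c.val (Nat.pos_of_ne_zero fun h => h0 ((ZMod.val_eq_zero c).1 h)) (ZMod.val_lt c)
      fun i h1 h2 => ?_
    rw [zw i h1 (by omega), zw _ (by omega) h2, ← hc]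
    congr 1
    push_cast
    rw [ZMod.natCast_zmod_val]
  have lu : ∀ d ∈ G, ∀ i, diagLo d ≤ i → i < diagHi m n d → S.lab (u i) = w (i : ZMod p) := by
    intro d hdG i h1 h2
    have h3 := hd d hdG
    -- If the index `i` of `u` is off the diagonal `d₀`, the index `i + d` of `v` is still on it, at
    -- the position `i + (d - d₀)`, which has the same phase.
    by_cases hi : diagLo d₀ ≤ i ∧ i < diagHi m n d₀
    · exact zw i hi.1 hi.2
    · have hr : diagLo d₀ ≤ i + (d - d₀) ∧ i + (d - d₀) < diagHi m n d₀ := by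
        unfold diagLo diagHi at *
        omega
      have f2 := full d₀ hd₀ _ hr.1 hr.2
      rw [show i + (d - d₀) + d₀ = i + d by ring] at f2
      rw [full d hdG i h1 h2, ← f2]
      refine (zw _ hr.1 hr.2).trans ?_
      congr 1
      rw [ZMod.intCast_eq_intCast_iff_dvd_sub, show i - (i + (d - d₀)) = -(d - d₀) by ring]
      exact dvd_neg.2 (hdvd d hdG)
  have lv : ∀ d ∈ G, ∀ i, diagLo d ≤ i → i < diagHi m n d →
      S'.lab (v (i + d)) = w (i : ZMod p) := fun d hdG i h1 h2 => by
    rw [← lu d hdG i h1 h2, full d hdG i h1 h2]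
  have near : ∀ d ∈ G, -((L : ℤ) / 4) ≤ d - d₀ ∧ d - d₀ ≤ L / 4 := fun d hdG => by
    have := hd d hdG; omega
  have hlo : ∀ d ∈ G, 0 ≤ diagLo d ∧ 0 ≤ diagLo d + d := fun d _ => by unfold diagLo; omega
  have hhi : ∀ d ∈ G, diagHi m n d ≤ m ∧ diagHi m n d + d ≤ n := fun d _ => by
    unfold diagHi; omega
  have hp4 : (p : ℤ) ≤ L / 4 := by omega
  have sh : ∀ d ∈ G, diagLo d ≤ diagLo d₀ + L / 4 ∧ diagHi m n d₀ - L / 4 ≤ diagHi m n d ∧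
      diagLo d₀ - L / 4 ≤ diagLo d ∧ diagHi m n d ≤ diagHi m n d₀ + L / 4 ∧
      diagLo d + d ≤ diagLo d₀ + d₀ + L / 4 ∧
      diagHi m n d₀ + d₀ - L / 4 ≤ diagHi m n d + d ∧
      diagLo d₀ + d₀ - L / 4 ≤ diagLo d + d ∧
      diagHi m n d + d ≤ diagHi m n d₀ + d₀ + L / 4 := fun d hdG => by
    have := near d hdG
    unfold diagLo diagHi
    omega
  -- Stepping back a quarter from the end of `d₀` gives indices of `u` and `v` that all diagonals of
  -- the cluster meet. At most another quarter is lost at the beginning, and as `p ≤ L / 4`, the `2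
  -- * p - 2` steps up to the gates remain available.
  by_cases hpp : (∃ T, IsPeriodic S w (u (diagHi m n d₀ - L / 4 - 1))
      ((diagHi m n d₀ - L / 4 - 1 : ℤ) : ZMod p) T) ∧
      ∃ T, IsPeriodic S' w (v (diagHi m n d₀ + d₀ - L / 4 - 1))
        ((diagHi m n d₀ + d₀ - L / 4 - 1 - d₀ : ℤ) : ZMod p) T
  · have h1 := hlo d₀ hd₀
    have h2 := hhi d₀ hd₀
    refine (sum_diagCount_le_of_periodic hX hu hv prim G _ _ d₀ (diagHi m n d₀ - L / 4 - 1)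
      (diagHi m n d₀ + d₀ - L / 4 - 1) (diagLo d₀ - L / 4) (diagHi m n d₀ + L / 4)
      (diagLo d₀ + d₀ - L / 4) (diagHi m n d₀ + d₀ + L / 4) hlo hhi
      (fun d hdG => by have := sh d hdG; omega) (fun d hdG => by have := sh d hdG; omega) hdvd
      (by omega) (by omega) hpp.1 hpp.2).trans ?_
    have e1 : (diagHi m n d₀ + d₀ + L / 4 - (diagLo d₀ + d₀ - L / 4)).toNat ≤ 2 * L := by omega
    have e2 : (diagHi m n d₀ + L / 4 - (diagLo d₀ - L / 4)).toNat ≤ 2 * L := by omega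
    calc _ ≤ θ * (2 * L) + θ' * (2 * L) := by gcongr
      _ = 2 * (θ + θ') * L := by ring
      _ ≤ _ := Nat.mul_le_mul_right _ (Nat.le_add_left _ _)
  · have hcard := card_le_of_not_periodic hR hVi hVi' hu hv prim G _ _ d₀
      (diagHi m n d₀ - L / 4 - 1) (diagHi m n d₀ + d₀ - L / 4 - 1) hlo hhi hdvd
      (fun d hdG => by have := sh d hdG; omega) (fun d hdG => by have := sh d hdG; omega)
      lu lv hs hpp
    calc _ ≤ ∑ d ∈ G, L := Finset.sum_le_sum hcount
      _ = G.card * L := by rw [Finset.sum_const, smul_eq_mul]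
      _ ≤ _ := Nat.mul_le_mul_right _ (hcard.trans (Nat.le_add_right _ _))

/-- The full diagonals that start in `R` have few edges outside of `X`. -/
theorem sum_diagCount_le [Finite S.E] [Finite S'.E] {R X : Set (S.E × S'.E)} {θ θ' : ℕ}
    (hR : BackClosed R) (hX : ContainsLong X θ θ') {ι ι' : Type*} [Finite ι] [Finite ι']
    {C : S.Chains ι} {C' : S'.Chains ι'} (hVi : S.Vi.Finite) (hVi' : S'.Vi.Finite) {a : ι} {b : ι'}
    {m n : ℕ} {u : ℤ → S.E} {v : ℤ → S'.E} (hu : C.Enum a m u) (hv : C'.Enum b n v)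
    (D : Finset ℤ) (hlt : ∀ d ∈ D, diagLo d < diagHi m n d) (full : ∀ d ∈ D, IsFull u v m n d)
    (hs : ∀ d ∈ D, (u (diagLo d), v (diagLo d + d)) ∈ R) :
    ∑ d ∈ D, diagCount X u v (diagLo d) (diagHi m n d) d ≤
      ((2 * (Nat.card ι + S.Vi.ncard + 1)) * (2 * (Nat.card ι' + S'.Vi.ncard + 1)) + 2 * (θ + θ')) *
        (4 * (m + n)) := by
  classical
  obtain ⟨D', hD', hcov, hsep⟩ := exists_separated D (diagLen m n)
  have hsum : ∑ d ∈ D', diagLen m n d ≤ 4 * (m + n) := by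
    refine sum_len_le_of_separated D' (diagLen m n) m n hsep (fun d hd => ?_) fun d hd => ?_
    · have := hlt d (hD' hd)
      unfold diagLo diagHi at this
      omega
    · have := hlt d (hD' hd)
      unfold diagLen diagLo diagHi at *
      omega
  choose! f hf1 hf2 using hcov
  rw [← Finset.sum_fiberwise_of_maps_to (g := f) (t := D') hf1]
  calc _ ≤ ∑ d' ∈ D', ((2 * (Nat.card ι + S.Vi.ncard + 1)) *
        (2 * (Nat.card ι' + S'.Vi.ncard + 1)) + 2 * (θ + θ')) * diagLen m n d' := by
        refine Finset.sum_le_sum fun d' hd' => ?_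
        set G := {d ∈ D | 4 * |d - d'| ≤ diagLen m n d' ∧ diagLen m n d ≤ diagLen m n d'} with hG
        have hGD : ∀ d ∈ G, d ∈ D ∧ 4 * |d - d'| ≤ diagLen m n d' ∧
            diagLen m n d ≤ diagLen m n d' := fun d hd => Finset.mem_filter.1 hd
        refine le_trans (Finset.sum_le_sum_of_subset (t := G) fun d hd => ?_)
          (sum_diagCount_cluster_le hR hX hVi hVi' hu hv G d'
            (Finset.mem_filter.2 ⟨hD' hd', by simp, le_rfl⟩) (fun d hd => hlt d (hGD d hd).1)
            (fun d hd => full d (hGD d hd).1) (fun d hd => hs d (hGD d hd).1)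
            (fun d hd => (hGD d hd).2.1) (fun d hd => (hGD d hd).2.2))
        obtain ⟨h1, rfl⟩ := Finset.mem_filter.1 hd
        exact Finset.mem_filter.2 ⟨h1, hf2 d h1⟩
    _ = _ * ∑ d' ∈ D', diagLen m n d' := (Finset.mul_sum _ _ _).symm
    _ ≤ _ := Nat.mul_le_mul_left _ hsum

end LGraph

/-! ### Tracing diagonals back to their sources -/

namespace LGraph

variable {A : Type*} {S S' : LGraph A} {ι ι' : Type*}

/-- Since `prev` lowers the position by one, the positions on a chain have no gaps and are the
numbers below its length. -/
theorem Chains.exists_enum (C : S.Chains ι) [Finite S.E] [Nonempty S.E] (a : ι) :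
    ∃ u : ℤ → S.E, C.Enum a {e | C.idx e = a}.ncard u ∧
      ∀ e, C.idx e = a → C.pos e < {e | C.idx e = a}.ncard ∧ u (C.pos e) = e := by
  classical
  set F := {e | C.idx e = a} with hF
  have hcard : (C.pos '' F).ncard = F.ncard :=
    Set.InjOn.ncard_image fun x hx y hy h => C.ext _ _ (hx.trans hy.symm) h
  have hsub : ∀ e ∈ F, Set.Iic (C.pos e) ⊆ C.pos '' F := fun e he k hk => by
    obtain ⟨h1, h2⟩ := C.idx_pos_prev_iterate e (C.pos e - k) (by omega)
    simp only [Set.mem_Iic] at hk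
    exact ⟨_, h1.trans he, by omega⟩
  have hlt : ∀ e ∈ F, C.pos e < F.ncard := fun e he => by
    have := Set.ncard_le_ncard (hsub e he) (Set.toFinite _)
    rw [hcard, ← Nat.card_coe_set_eq] at this
    simpa using this
  have hEq : C.pos '' F = Set.Iio F.ncard := by
    refine Set.eq_of_subset_of_ncard_le ?_ ?_ (Set.finite_Iio _)
    · rintro _ ⟨e, he, rfl⟩
      exact hlt e he
    · rw [hcard, ← Nat.card_coe_set_eq]
      simp
  have hex : ∀ i : ℤ, ∃ e, 0 ≤ i → i < F.ncard → C.idx e = a ∧ (C.pos e : ℤ) = i := fun i => by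
    by_cases hi : 0 ≤ i ∧ i < F.ncard
    · have : i.toNat ∈ C.pos '' F := by
        rw [hEq]; simp only [Set.mem_Iio]; omega
      obtain ⟨e, he, hp⟩ := this
      exact ⟨e, fun _ _ => ⟨he, by omega⟩⟩
    · exact ⟨Classical.arbitrary _, fun h h' => absurd ⟨h, h'⟩ hi⟩
  choose u hu using hex
  refine ⟨u, hu, fun e he => ⟨hlt e he, ?_⟩⟩
  obtain ⟨h1, h2⟩ := hu (C.pos e) (by omega) (by exact_mod_cast hlt e he)
  exact C.ext _ _ (h1.trans he.symm) (by exact_mod_cast h2)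

/-- Going back along two chains one stays in `R`, unless one meets a pair of initial vertices. -/
theorem BackClosed.trace {R : Set (S.E × S'.E)} (hR : BackClosed R) (C : S.Chains ι)
    (C' : S'.Chains ι') {x : S.E × S'.E} (hx : x ∈ R) (k : ℕ) (hk : k ≤ C.pos x.1)
    (hk' : k ≤ C'.pos x.2) :
    (∃ k' < k, S.o (C.prev^[k'] x.1) ∈ S.Vi ∧ S'.o (C'.prev^[k'] x.2) ∈ S'.Vi) ∨
      (C.prev^[k] x.1, C'.prev^[k] x.2) ∈ R := by
  induction k with
  | zero => exact Or.inr hx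
  | succ k ih =>
    rcases ih (by omega) (by omega) with ⟨k', h1, h2⟩ | h
    · exact Or.inl ⟨k', by omega, h2⟩
    · have p1 := (C.idx_pos_prev_iterate x.1 k (by omega)).2
      have p2 := (C'.idx_pos_prev_iterate x.2 k (by omega)).2
      rcases hR.back _ h with h | ⟨y, hy, e1, e2⟩
      · exact Or.inl ⟨k, by omega, h⟩
      · right
        have q1 := C.eq_prev _ _ (by simp only; omega) e1
        have q2 := C'.eq_prev _ _ (by simp only; omega) e2
        rw [Function.iterate_succ_apply', Function.iterate_succ_apply', ← q1, ← q2]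
        exact hy

section Pair

variable {R X : Set (S.E × S'.E)} {C : S.Chains ι} {C' : S'.Chains ι'} {a : ι} {b : ι'}
    {m n : ℕ} {u : ℤ → S.E} {v : ℤ → S'.E}

/-- Matched walks follow a diagonal. -/
theorem Chains.Enum.pair_walk_eq (hu : C.Enum a m u) (hv : C'.Enum b n v) {c : ℕ → S.E × S'.E}
    {d : ℤ} (h0 : c 0 = (u (diagLo d), v (diagLo d + d))) (k : ℕ)
    (hk : diagLo d + k < diagHi m n d)
    (hc : ∀ j < k, S.t (c j).1 = S.o (c (j + 1)).1 ∧ S'.t (c j).2 = S'.o (c (j + 1)).2) :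
    c k = (u (diagLo d + k), v (diagLo d + d + k)) := by
  unfold diagLo diagHi at *
  refine Prod.ext ?_ ?_
  · exact hu.walk_eq (c := fun j => (c j).1) (by omega) (by simp [h0]) k (by omega)
      fun j hj => (hc j hj).1
  · exact hv.walk_eq (c := fun j => (c j).2) (by omega) (by simp [h0]) k (by omega)
      fun j hj => (hc j hj).2

theorem isFull_of_walk (hu : C.Enum a m u) (hv : C'.Enum b n v) {c : ℕ → S.E × S'.E}
    {d : ℤ} (h0 : c 0 = (u (diagLo d), v (diagLo d + d))) (k : ℕ)
    (hk : diagHi m n d ≤ diagLo d + k + 1)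
    (hc : ∀ j < k, S.t (c j).1 = S.o (c (j + 1)).1 ∧ S'.t (c j).2 = S'.o (c (j + 1)).2)
    (hl : ∀ j ≤ k, S.lab (c j).1 = S'.lab (c j).2) : IsFull u v m n d := by
  intro i hi hi'
  have e := hu.pair_walk_eq hv h0 (i - diagLo d).toNat (by omega) fun j hj => hc j (by omega)
  have := hl (i - diagLo d).toNat (by omega)
  rw [e] at this
  simp only at this
  rwa [show diagLo d + ((i - diagLo d).toNat : ℤ) = i by omega,
    show diagLo d + d + ((i - diagLo d).toNat : ℤ) = i + d by omega] at this

/-- Diagonals that start in `R` and do not match entirely are determined by a source. -/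
theorem card_le_of_not_full [Finite S.E] [Finite S'.E] [Finite ι] [Finite ι'] (hR : BackClosed R)
    (hVi : S.Vi.Finite) (hVi' : S'.Vi.Finite) (hu : C.Enum a m u) (hv : C'.Enum b n v)
    (D : Finset ℤ) (hlt : ∀ d ∈ D, diagLo d < diagHi m n d)
    (hs : ∀ d ∈ D, (u (diagLo d), v (diagLo d + d)) ∈ R) (hD : ∀ d ∈ D, ¬ IsFull u v m n d) :
    D.card ≤ Nat.card ι * Nat.card ι' + S.Vi.ncard * S'.Vi.ncard := by
  classical
  -- A step into a pair with an inner edge is forced: that edge is the only one leaving its origin,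
  -- and its label determines the other edge. So histories are deterministic as long as no pair of
  -- first edges is entered.
  let r : S.E × S'.E → S.E × S'.E → Prop := fun x y =>
    S.t x.1 = S.o y.1 ∧ S'.t x.2 = S'.o y.2 ∧ S.lab y.1 = S'.lab y.2 ∧
      (C.pos y.1 ≠ 0 ∨ C'.pos y.2 ≠ 0)
  have det : ∀ y z : S.E × S'.E, S.o y.1 = S.o z.1 → S'.o y.2 = S'.o z.2 →
      S.lab y.1 = S'.lab y.2 → S.lab z.1 = S'.lab z.2 → (C.pos y.1 ≠ 0 ∨ C'.pos y.2 ≠ 0) →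
      y = z := by
    rintro ⟨y1, y2⟩ ⟨z1, z2⟩ e1 e2 l1 l2 h
    simp only at e1 e2 l1 l2 h
    rcases h with h | h
    · have := C.eq_of_o _ _ h e1.symm
      subst this
      rw [S'.det _ _ e2 (l1.symm.trans l2)]
    · have := C'.eq_of_o _ _ h e2.symm
      subst this
      rw [S.det _ _ e1 (l1.trans l2.symm)]
  have hr : ∀ x y z, r x y → r x z → y = z := fun x y z h h' =>
    det y z (h.1.symm.trans h'.1) (h.2.1.symm.trans h'.2.1) h.2.2.1 h'.2.2.1 h.2.2.2
  let B : Set (S.E × S'.E) :=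
    {x | (C.pos x.1 = 0 ∧ C'.pos x.2 = 0) ∨ (S.o x.1 ∈ S.Vi ∧ S'.o x.2 ∈ S'.Vi)}
  have hback : ∀ x ∈ R, x ∉ B → ∃ y ∈ R, r y x := by
    intro x hx hB
    simp only [B, Set.mem_ofPred_eq, not_or] at hB
    rcases hR.back x hx with h | ⟨y, hy, e1, e2⟩
    · exact absurd h hB.2
    · exact ⟨y, hy, e1, e2, hR.matched x hx, by tauto⟩
  have hsrc : ∀ d ∈ D, ∃ (c : ℕ → S.E × S'.E) (T : ℕ), c 0 ∈ R ∧ c 0 ∈ B ∧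
      c T = (u (diagLo d), v (diagLo d + d)) ∧ ∀ k < T, r (c k) (c (k + 1)) := by
    intro d hd
    rcases exists_source_or_periodic r hr R B hback _ (hs d hd) with h | ⟨c, T, hT, h0, hper, hw⟩
    · exact h
    -- A periodic walk through the beginning of the diagonal would follow and match all of it.
    · refine absurd ?_ (hD d hd)
      refine isFull_of_walk hu hv h0 (diagHi m n d - diagLo d).toNat (by omega)
        (fun j _ => ⟨(hw j).1, (hw j).2.1⟩) fun j _ => ?_
      cases j with
      | zero => rw [h0]; exact hR.matched _ (hs d hd)
      | succ j => exact (hw j).2.2.1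
  have : Nonempty (S.E × S'.E) := ⟨(u 0, v 0)⟩
  choose! c T h1 h2 h3 h4 using hsrc
  -- Of two histories with a common source, the longer one extends the shorter. Beyond the beginning
  -- of `d` it either runs through all of `d`, which would then be full, or meets the beginning of
  -- `d'` while still on `d`.
  have hle : ∀ d ∈ D, ∀ d' ∈ D, c d 0 = c d' 0 → T d ≤ T d' → d = d' := by
    intro d hd d' hd' h0 hT
    have agree : ∀ k ≤ T d, c d k = c d' k := by
      intro k
      induction k with
      | zero => exact fun _ => h0
      | succ k ih =>
        intro hk
        have := h4 d' hd' k (by omega)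
        rw [← ih (by omega)] at this
        exact hr _ _ _ (h4 d hd k (by omega)) this
    have e0 : c d' (T d + 0) = (u (diagLo d), v (diagLo d + d)) := by
      rw [add_zero, ← agree _ le_rfl, h3 d hd]
    have hw : ∀ k < T d' - T d, r (c d' (T d + k)) (c d' (T d + (k + 1))) := fun k hk =>
      h4 d' hd' (T d + k) (by omega)
    have l1 := hlt d hd
    have l2 := hlt d' hd'
    by_cases hlong : diagHi m n d ≤ diagLo d + (T d' - T d : ℕ)
    · refine absurd ?_ (hD d hd)
      refine isFull_of_walk hu hv (c := fun k => c d' (T d + k)) e0 (T d' - T d) (by omega)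
        (fun j hj => ⟨(hw j hj).1, (hw j hj).2.1⟩) fun j hj => ?_
      cases j with
      | zero => simp only [e0]; exact hR.matched _ (hs d hd)
      | succ j => exact (hw j (by omega)).2.2.1
    · have e := hu.pair_walk_eq hv (c := fun k => c d' (T d + k)) e0 (T d' - T d) (by omega)
        fun j hj => ⟨(hw j hj).1, (hw j hj).2.1⟩
      simp only [show T d + (T d' - T d) = T d' by omega, h3 d' hd', Prod.mk.injEq] at e
      obtain ⟨e1, e2⟩ := e
      have e1 := hu.inj (by unfold diagLo; omega) (by unfold diagLo diagHi at *; omega)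
        (by unfold diagLo; omega) (by unfold diagLo diagHi at *; omega) e1
      have e2 := hv.inj (by unfold diagLo; omega) (by unfold diagLo diagHi at *; omega)
        (by unfold diagLo; omega) (by unfold diagLo diagHi at *; omega) e2
      omega
  have hinj : ∀ d ∈ D, ∀ d' ∈ D, c d 0 = c d' 0 → d = d' := fun d hd d' hd' h0 =>
    (le_total (T d) (T d')).elim (hle d hd d' hd' h0) fun hT => (hle d' hd' d hd h0.symm hT).symm
  set D₁ := D.filter fun d => C.pos (c d 0).1 = 0 ∧ C'.pos (c d 0).2 = 0 with hD₁
  set D₂ := D.filter fun d => ¬ (C.pos (c d 0).1 = 0 ∧ C'.pos (c d 0).2 = 0) with hD₂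
  have := Fintype.ofFinite ι
  have := Fintype.ofFinite ι'
  have b₁ : D₁.card ≤ Nat.card ι * Nat.card ι' := by
    rw [Nat.card_eq_fintype_card, Nat.card_eq_fintype_card, ← Fintype.card_prod]
    refine Finset.card_le_card_of_injOn (fun d => (C.idx (c d 0).1, C'.idx (c d 0).2))
      (fun _ _ => Finset.mem_univ _) fun d hd d' hd' h => ?_
    simp only [hD₁, Finset.coe_filter, Set.mem_ofPred_eq, Prod.mk.injEq] at hd hd' h
    exact hinj d hd.1 d' hd'.1 (Prod.ext (C.ext _ _ h.1 (by omega)) (C'.ext _ _ h.2 (by omega)))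
  have b₂ : D₂.card ≤ S.Vi.ncard * S'.Vi.ncard := by
    rw [← Set.ncard_prod, Set.ncard_eq_toFinset_card _ (hVi.prod hVi')]
    refine Finset.card_le_card_of_injOn (fun d => (S.o (c d 0).1, S'.o (c d 0).2))
      (fun d hd => ?_) fun d hd d' hd' h => ?_
    · simp only [hD₂, Finset.coe_filter, Set.mem_ofPred_eq] at hd
      simp only [Set.Finite.coe_toFinset]
      exact (h2 d hd.1).resolve_left hd.2
    · simp only [hD₂, Finset.coe_filter, Set.mem_ofPred_eq, Prod.mk.injEq] at hd hd' h
      refine hinj d hd.1 d' hd'.1 (det _ _ h.1 h.2 (hR.matched _ (h1 d hd.1))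
        (hR.matched _ (h1 d' hd'.1)) ?_)
      have := hd.2
      tauto
  rw [← Finset.card_filter_add_card_filter_not (s := D)
    (fun d => C.pos (c d 0).1 = 0 ∧ C'.pos (c d 0).2 = 0)]
  exact add_le_add b₁ b₂

end Pair

end LGraph

/-! ### Bounds for a pair of chains, and summation over all pairs -/

namespace LGraph

variable {A : Type*} {S S' : LGraph A} {ι ι' : Type*}

/-- The constant in the bound for the number of edges outside of `X`, for `N` and `N'` chains and
`ν` and `ν'` initial vertices. -/
def pairBound (N N' ν ν' θ θ' : ℕ) : ℕ :=
  4 * ((2 * (N + ν + 1)) * (2 * (N' + ν' + 1)) + 2 * (θ + θ')) + N * N' + 2 * (ν * ν')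

section Pair

variable {R X : Set (S.E × S'.E)} {θ θ' : ℕ} {C : S.Chains ι}
  {C' : S'.Chains ι'} {a : ι} {b : ι'} {m n : ℕ} {u : ℤ → S.E} {v : ℤ → S'.E}

/-- The pairs of edges behind a pair of initial vertices. -/
theorem card_le_of_behind (hVi : S.Vi.Finite) (hVi' : S'.Vi.Finite)
    (Z : Finset (S.E × S'.E)) (hZ : ∀ x ∈ Z, C.idx x.1 = a ∧ C'.idx x.2 = b)
    (hm : ∀ x ∈ Z, C.pos x.1 < m)
    (h : ∀ x ∈ Z, ∃ k, k < C.pos x.1 ∧ k < C'.pos x.2 ∧ S.o (C.prev^[k] x.1) ∈ S.Vi ∧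
      S'.o (C'.prev^[k] x.2) ∈ S'.Vi) : Z.card ≤ S.Vi.ncard * S'.Vi.ncard * m := by
  classical
  choose! k h1 h2 h3 h4 using h
  rw [← Set.ncard_prod, Set.ncard_eq_toFinset_card _ (hVi.prod hVi')]
  rw [show m = (Finset.range m).card by simp, ← Finset.card_product]
  -- The initial vertices are inner vertices of the chains, so they determine the two positions
  -- reached by going back, and with them the diagonal. The position on the first chain then
  -- determines the pair.
  refine Finset.card_le_card_of_injOn
    (fun x => ((S.o (C.prev^[k x] x.1), S'.o (C'.prev^[k x] x.2)), C.pos x.1)) (fun x hx => ?_) ?_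
  · simp only [Finset.coe_product, Set.mem_prod, Set.Finite.coe_toFinset, Finset.coe_range,
      Set.mem_Iio]
    exact ⟨⟨h3 x hx, h4 x hx⟩, hm x hx⟩
  · intro x hx y hy hxy
    simp only [Prod.mk.injEq] at hxy
    obtain ⟨⟨e1, e2⟩, e3⟩ := hxy
    have a1 := C.idx_pos_prev_iterate x.1 (k x) (h1 x hx).le
    have a2 := C'.idx_pos_prev_iterate x.2 (k x) (h2 x hx).le
    have b1 := C.idx_pos_prev_iterate y.1 (k y) (h1 y hy).le
    have b2 := C'.idx_pos_prev_iterate y.2 (k y) (h2 y hy).le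
    have := h1 x hx
    have := h2 x hx
    have := h1 y hy
    have := h2 y hy
    have e1 := congrArg C.pos (C.eq_of_o _ _ (by omega) e1)
    have e2 := congrArg C'.pos (C'.eq_of_o _ _ (by omega) e2)
    have hi := (hZ x hx).1.trans (hZ y hy).1.symm
    have hi' := (hZ x hx).2.trans (hZ y hy).2.symm
    exact Prod.ext (C.ext _ _ hi e3) (C'.ext _ _ hi' (by omega))

variable [Finite S.E] [Finite S'.E]

/-- The pairs of edges that are not behind a pair of initial vertices. -/
theorem card_le_of_not_behind [Finite ι] [Finite ι'] (hR : BackClosed R)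
    (hX : ContainsLong X θ θ') (hVi : S.Vi.Finite) (hVi' : S'.Vi.Finite) (hu : C.Enum a m u)
    (hv : C'.Enum b n v)
    (Z : Finset (S.E × S'.E)) (hZ : ∀ x ∈ Z, C.idx x.1 = a ∧ C'.idx x.2 = b)
    (hZR : ∀ x ∈ Z, x ∈ R ∧ x ∉ X)
    (hm : ∀ x ∈ Z, C.pos x.1 < m ∧ u (C.pos x.1) = x.1)
    (hn : ∀ x ∈ Z, C'.pos x.2 < n ∧ v (C'.pos x.2) = x.2)
    (h : ∀ x ∈ Z, ¬ ∃ k, k < C.pos x.1 ∧ k < C'.pos x.2 ∧ S.o (C.prev^[k] x.1) ∈ S.Vi ∧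
      S'.o (C'.prev^[k] x.2) ∈ S'.Vi) :
    Z.card ≤ ((2 * (Nat.card ι + S.Vi.ncard + 1)) * (2 * (Nat.card ι' + S'.Vi.ncard + 1)) +
      2 * (θ + θ')) * (4 * (m + n)) +
      (Nat.card ι * Nat.card ι' + S.Vi.ncard * S'.Vi.ncard) * m := by
  classical
  -- As no pair of `Z` is behind a pair of initial vertices, `BackClosed.trace` leads to the
  -- beginning of its diagonal inside `R`.
  set D : Finset ℤ := (Finset.Ioo (-(m : ℤ)) n).filter fun d =>
    diagLo d < diagHi m n d ∧ (u (diagLo d), v (diagLo d + d)) ∈ R with hD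
  have hDs : ∀ d ∈ D, diagLo d < diagHi m n d ∧ (u (diagLo d), v (diagLo d + d)) ∈ R :=
    fun d hd => (Finset.mem_filter.1 hd).2
  have hmaps : Set.MapsTo (fun x : S.E × S'.E => (C'.pos x.2 : ℤ) - C.pos x.1) Z D := by
    intro x hx
    change (C'.pos x.2 : ℤ) - C.pos x.1 ∈ D
    have l1 := (hm x hx).1
    have l2 := (hn x hx).1
    refine Finset.mem_filter.2 ⟨Finset.mem_Ioo.2 ⟨by omega, by omega⟩, ?_, ?_⟩
    · unfold diagLo diagHi; omega
    · set k := min (C.pos x.1) (C'.pos x.2) with hk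
      rcases hR.trace C C' (hZR x hx).1 k (by omega) (by omega) with ⟨k', h1, h2⟩ | h'
      · exact absurd ⟨k', by omega, by omega, h2⟩ (h x hx)
      · have a1 := C.idx_pos_prev_iterate x.1 k (by omega)
        have a2 := C'.idx_pos_prev_iterate x.2 k (by omega)
        have b1 := hu (diagLo ((C'.pos x.2 : ℤ) - C.pos x.1)) (by unfold diagLo; omega)
          (by unfold diagLo; omega)
        have b2 := hv (diagLo ((C'.pos x.2 : ℤ) - C.pos x.1) + ((C'.pos x.2 : ℤ) - C.pos x.1))
          (by unfold diagLo; omega) (by unfold diagLo; omega)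
        have c1 := C.ext _ _ (b1.1.trans ((hZ x hx).1.symm.trans a1.1.symm))
          (by unfold diagLo at *; omega)
        have c2 := C'.ext _ _ (b2.1.trans ((hZ x hx).2.symm.trans a2.1.symm))
          (by unfold diagLo at *; omega)
        rw [c1, c2]
        exact h'
  have hfib : ∀ d ∈ D, (Z.filter fun x => (C'.pos x.2 : ℤ) - C.pos x.1 = d).card ≤
      diagCount X u v (diagLo d) (diagHi m n d) d := by
    intro d hd
    refine Finset.card_le_card_of_injOn (fun x => (C.pos x.1 : ℤ)) (fun x hx => ?_) ?_
    · obtain ⟨hxZ, rfl⟩ := Finset.mem_filter.1 (Finset.mem_coe.1 hx)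
      have l1 := hm x hxZ
      have l2 := hn x hxZ
      refine Finset.mem_coe.2 (Finset.mem_filter.2 ⟨Finset.mem_Ico.2 ?_, ?_⟩)
      · simp only
        unfold diagLo diagHi
        omega
      · simp only
        rw [l1.2, add_sub_cancel, l2.2]
        exact (hZR x hxZ).2
    · intro x hx y hy hxy
      obtain ⟨hx, hxd⟩ := Finset.mem_filter.1 (Finset.mem_coe.1 hx)
      obtain ⟨hy, hyd⟩ := Finset.mem_filter.1 (Finset.mem_coe.1 hy)
      have hxy : (C.pos x.1 : ℤ) = C.pos y.1 := hxy
      exact Prod.ext (C.ext _ _ ((hZ x hx).1.trans (hZ y hy).1.symm) (by omega))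
        (C'.ext _ _ ((hZ x hx).2.trans (hZ y hy).2.symm) (by omega))
  have hone : ∀ d, diagCount X u v (diagLo d) (diagHi m n d) d ≤ m := by
    intro d
    refine (Finset.card_filter_le _ _).trans ?_
    rw [Int.card_Ico]
    unfold diagLo diagHi
    omega
  rw [Finset.card_eq_sum_card_fiberwise hmaps]
  refine (Finset.sum_le_sum hfib).trans ?_
  rw [← Finset.sum_filter_add_sum_filter_not D fun d => IsFull u v m n d]
  refine add_le_add ?_ ?_
  · refine sum_diagCount_le hR hX hVi hVi' hu hv _ ?_ ?_ ?_
    · exact fun d hd => (hDs d (Finset.mem_filter.1 hd).1).1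
    · exact fun d hd => (Finset.mem_filter.1 hd).2
    · exact fun d hd => (hDs d (Finset.mem_filter.1 hd).1).2
  · refine (Finset.sum_le_sum fun d _ => hone d).trans ?_
    rw [Finset.sum_const, smul_eq_mul]
    refine Nat.mul_le_mul_right _ (card_le_of_not_full hR hVi hVi' hu hv _ ?_ ?_ ?_)
    · exact fun d hd => (hDs d (Finset.mem_filter.1 hd).1).1
    · exact fun d hd => (hDs d (Finset.mem_filter.1 hd).1).2
    · exact fun d hd => (Finset.mem_filter.1 hd).2

/-- The term `ν * ν'` occurs twice in `pairBound`: once for the pairs behind initial vertices and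
once for the diagonals that do not match and whose source is a pair of initial vertices. -/
theorem ncard_pair_le [Finite ι] [Finite ι'] (hR : BackClosed R)
    (hX : ContainsLong X θ θ') (hVi : S.Vi.Finite) (hVi' : S'.Vi.Finite) (C : S.Chains ι)
    (C' : S'.Chains ι') (a : ι) (b : ι') :
    {x | x ∈ R \ X ∧ C.idx x.1 = a ∧ C'.idx x.2 = b}.ncard ≤
      pairBound (Nat.card ι) (Nat.card ι') S.Vi.ncard S'.Vi.ncard θ θ' *
        ({e | C.idx e = a}.ncard + {e | C'.idx e = b}.ncard) := by
  classical
  rcases Set.eq_empty_or_nonempty {x | x ∈ R \ X ∧ C.idx x.1 = a ∧ C'.idx x.2 = b} with h0 | h0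
  · rw [h0]; simp
  obtain ⟨x₀, -⟩ := h0
  have : Nonempty S.E := ⟨x₀.1⟩
  have : Nonempty S'.E := ⟨x₀.2⟩
  obtain ⟨u, hu, hu'⟩ := C.exists_enum a
  obtain ⟨v, hv, hv'⟩ := C'.exists_enum b
  set m := {e | C.idx e = a}.ncard
  set n := {e | C'.idx e = b}.ncard
  rw [Set.ncard_eq_toFinset_card _ (Set.toFinite _)]
  set Z := (Set.toFinite {x | x ∈ R \ X ∧ C.idx x.1 = a ∧ C'.idx x.2 = b}).toFinset with hZ
  have hZm : ∀ x ∈ Z, (x ∈ R ∧ x ∉ X) ∧ C.idx x.1 = a ∧ C'.idx x.2 = b := fun x hx => by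
    simpa [hZ] using hx
  let P : S.E × S'.E → Prop := fun x => ∃ k, k < C.pos x.1 ∧ k < C'.pos x.2 ∧
    S.o (C.prev^[k] x.1) ∈ S.Vi ∧ S'.o (C'.prev^[k] x.2) ∈ S'.Vi
  have h1 := card_le_of_behind (m := m) hVi hVi' (Z.filter P)
    (fun x hx => (hZm x (Finset.mem_filter.1 hx).1).2)
    (fun x hx => (hu' _ (hZm x (Finset.mem_filter.1 hx).1).2.1).1)
    fun x hx => (Finset.mem_filter.1 hx).2
  have h2 := card_le_of_not_behind hR hX hVi hVi' hu hv (Z.filter fun x => ¬ P x)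
    (fun x hx => (hZm x (Finset.mem_filter.1 hx).1).2)
    (fun x hx => (hZm x (Finset.mem_filter.1 hx).1).1)
    (fun x hx => hu' _ (hZm x (Finset.mem_filter.1 hx).1).2.1)
    (fun x hx => hv' _ (hZm x (Finset.mem_filter.1 hx).1).2.2)
    fun x hx => (Finset.mem_filter.1 hx).2
  rw [← Finset.card_filter_add_card_filter_not (s := Z) P]
  refine (add_le_add h1 h2).trans ?_
  unfold pairBound
  set N := Nat.card ι
  set N' := Nat.card ι'
  set ν := S.Vi.ncard
  set ν' := S'.Vi.ncard
  have : (N * N' + 2 * (ν * ν')) * m ≤ (N * N' + 2 * (ν * ν')) * (m + n) :=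
    Nat.mul_le_mul_left _ (Nat.le_add_right _ _)
  nlinarith [this]

theorem Chains.sum_ncard_idx [Fintype ι] (C : S.Chains ι) :
    ∑ a, {e | C.idx e = a}.ncard = Nat.card S.E := by
  classical
  have := Fintype.ofFinite S.E
  rw [Nat.card_eq_fintype_card, ← Finset.card_univ,
    Finset.card_eq_sum_card_fiberwise (f := C.idx) (t := Finset.univ) fun _ _ => Finset.mem_univ _]
  refine Finset.sum_congr rfl fun a _ => ?_
  rw [← Set.ncard_coe_finset]
  simp

/-- The main counting bound. -/
theorem ncard_diff_le [Finite ι] [Finite ι'] (hR : BackClosed R)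
    (hX : ContainsLong X θ θ') (hVi : S.Vi.Finite) (hVi' : S'.Vi.Finite) (C : S.Chains ι)
    (C' : S'.Chains ι') :
    (R \ X).ncard ≤ pairBound (Nat.card ι) (Nat.card ι') S.Vi.ncard S'.Vi.ncard θ θ' *
        (Nat.card ι' * Nat.card S.E + Nat.card ι * Nat.card S'.E) := by
  classical
  have := Fintype.ofFinite ι
  have := Fintype.ofFinite ι'
  rw [Set.ncard_eq_toFinset_card _ (Set.toFinite _), Finset.card_eq_sum_card_fiberwise
    (f := fun x => (C.idx x.1, C'.idx x.2)) (t := Finset.univ) fun _ _ => Finset.mem_univ _]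
  calc _ ≤ ∑ q : ι × ι', pairBound (Nat.card ι) (Nat.card ι') S.Vi.ncard S'.Vi.ncard θ θ' *
        ({e | C.idx e = q.1}.ncard + {e | C'.idx e = q.2}.ncard) := by
        refine Finset.sum_le_sum fun q _ => ?_
        refine le_trans (le_of_eq ?_) (ncard_pair_le hR hX hVi hVi' C C' q.1 q.2)
        rw [← Set.ncard_coe_finset]
        congr 1
        ext x
        simp [Prod.ext_iff]
    _ = _ := by
        rw [← Finset.mul_sum, Finset.sum_add_distrib, Fintype.sum_prod_type, Fintype.sum_prod_type]
        simp only [Finset.sum_const, Finset.card_univ, smul_eq_mul, ← Finset.mul_sum]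
        rw [C.sum_ncard_idx, C'.sum_ncard_idx, Nat.card_eq_fintype_card, Nat.card_eq_fintype_card]

end Pair

end LGraph

/-! ### Periodic walks as cycles, and the image of the long cycles -/

namespace MGraph

variable {Γ : MGraph.{u₁, v₁}} {Λ : MGraph.{u₂, v₂}} {Δ : MGraph.{u₃, v₃}}

theorem apply_cast_intCast {α : Type*} {n : ℕ} {c : ℤ → α} (hc : ∀ k, c (k + n) = c k) (k : ℤ) :
    c (((k : ZMod n).cast : ℤ)) = c k := by
  rw [ZMod.coe_intCast]
  have hp : Function.Periodic c (n : ℤ) := hc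
  conv_rhs => rw [← Int.emod_add_mul_ediv k n, mul_comm]
  exact (hp.int_mul (k / n) _).symm

/-- The cycle given by a periodic bi-infinite walk. -/
def cycOfWalk (c : ℤ → Γ.E) (n : ℕ) (hw : ∀ k, Γ.t (c k) = Γ.o (c (k + 1)))
    (hc : ∀ k, c (k + n) = c k) : Cyc Γ n where
  onV := fun i : ZMod n => Γ.o (c (i.cast : ℤ))
  onE := fun i : ZMod n => c (i.cast : ℤ)
  o_comm _ := rfl
  t_comm := fun (i : ZMod n) => by
    change Γ.o (c ((i + 1).cast : ℤ)) = Γ.t (c (i.cast : ℤ))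
    rw [hw, ← apply_cast_intCast hc (i.cast + 1)]
    push_cast
    rfl
  map_Vi _ h := h.elim
  map_Vf _ h := h.elim

theorem cycOfWalk_onE {c : ℤ → Γ.E} {n : ℕ} (hw : ∀ k, Γ.t (c k) = Γ.o (c (k + 1)))
    (hc : ∀ k, c (k + n) = c k) (k : ℤ) : (cycOfWalk c n hw hc).onE (k : ZMod n) = c k :=
  apply_cast_intCast hc k

theorem cycOfWalk_onV {c : ℤ → Γ.E} {n : ℕ} (hw : ∀ k, Γ.t (c k) = Γ.o (c (k + 1)))
    (hc : ∀ k, c (k + n) = c k) (k : ℤ) : (cycOfWalk c n hw hc).onV (k : ZMod n) = Γ.o (c k) :=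
  congrArg Γ.o (apply_cast_intCast hc k)

/-- A map of circles as a function on `ZMod n`. -/
def Hom.toZMod {n m : ℕ} (π : Hom (circle n) (circle m)) : ZMod n → ZMod m := π.onV

theorem Hom.onE_eq_toZMod {n m : ℕ} (π : Hom (circle n) (circle m)) (i : ZMod n) :
    π.onE i = π.toZMod i := (π.o_comm i).symm

theorem Hom.toZMod_add {n m : ℕ} (π : Hom (circle n) (circle m)) (i : ZMod n) (k : ℕ) :
    π.toZMod (i + k) = π.toZMod i + k := by
  have step : ∀ j : ZMod n, π.toZMod (j + 1) = π.toZMod j + 1 := fun j =>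
    (π.t_comm j).trans (congrArg (· + (1 : ZMod m)) (π.onE_eq_toZMod j))
  induction k with
  | zero => simp
  | succ k ih =>
    push_cast
    rw [← add_assoc, ← add_assoc, step, ih]

theorem Hom.circle_dvd {n m : ℕ} (π : Hom (circle n) (circle m)) : m ∣ n := by
  have h := π.toZMod_add 0 n
  rw [ZMod.natCast_self, add_zero] at h
  exact (ZMod.natCast_eq_zero_iff _ _).1 (left_eq_add.1 h)

/-- A factorisation through a circle of length `m` makes `m` a period of the walk, whose least
period is `n`. -/
theorem cycOfWalk_isPrimitive {c : ℤ → Γ.E} {n : ℕ} (hn : 0 < n)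
    (hw : ∀ k, Γ.t (c k) = Γ.o (c (k + 1))) (hc : ∀ k, c (k + n) = c k)
    (hmin : ∀ r : ℕ, 0 < r → (∀ k, c (k + r) = c k) → n ≤ r) :
    Cyc.IsPrimitive (cycOfWalk c n hw hc) := by
  intro m hm π g h
  refine le_antisymm (Nat.le_of_dvd hn (Hom.circle_dvd π)) (hmin m hm fun k => ?_)
  rw [← cycOfWalk_onE hw hc, ← cycOfWalk_onE hw hc k, h]
  refine congrArg g.onE ?_
  rw [Hom.onE_eq_toZMod, Hom.onE_eq_toZMod]
  push_cast
  rw [Hom.toZMod_add, ZMod.natCast_self, add_zero]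

/-- The standard covering map of circles. -/
def circleCover {n m : ℕ} (h : m ∣ n) : Hom (circle n) (circle m) where
  onV := ZMod.castHom h (ZMod m)
  onE := ZMod.castHom h (ZMod m)
  o_comm _ := rfl
  t_comm := fun (i : ZMod n) => by
    change ZMod.castHom h (ZMod m) (i + 1) = ZMod.castHom h (ZMod m) i + 1
    rw [map_add, map_one]
  map_Vi _ h := h.elim
  map_Vf _ h := h.elim

/-- The image in `Δ` already closes up after `q` steps, so it factors through the covering of degree
`D`. -/
theorem le_deg_cycOfWalk (γ : Hom Γ Δ) {c : ℤ → Γ.E} {D q : ℕ} (hq : 0 < q)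
    (hw : ∀ k, Γ.t (c k) = Γ.o (c (k + 1))) (hc : ∀ k, c (k + (D * q : ℕ)) = c k)
    (hq' : ∀ k, γ.onE (c (k + q)) = γ.onE (c k)) :
    D ≤ Cyc.deg (γ.comp (cycOfWalk c (D * q) hw hc)) := by
  have hw' : ∀ k, Δ.t (γ.onE (c k)) = Δ.o (γ.onE (c (k + 1))) := fun k => by
    rw [← γ.t_comm, ← γ.o_comm, hw]
  refine le_csSup ⟨D * q, ?_⟩ ⟨q, hq, circleCover (Dvd.intro_left D rfl),
    cycOfWalk (fun k => γ.onE (c k)) q hw' hq', ?_, rfl⟩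
  · rintro d ⟨m, hm, -, -, -, hd⟩
    rw [hd]
    exact Nat.le_mul_of_pos_right d hm
  · ext i
    · obtain ⟨k, rfl⟩ := ZMod.intCast_surjective (n := D * q) i
      refine (congrArg γ.onV (cycOfWalk_onV hw hc k)).trans ?_
      rw [γ.o_comm, ← cycOfWalk_onV hw' hq']
      exact congrArg _ (map_intCast (ZMod.castHom _ (ZMod q)) k).symm
    · obtain ⟨k, rfl⟩ := ZMod.intCast_surjective (n := D * q) i
      refine (congrArg γ.onE (cycOfWalk_onE hw hc k)).trans ?_
      rw [← cycOfWalk_onE hw' hq']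
      exact congrArg _ (map_intCast (ZMod.castHom _ (ZMod q)) k).symm

namespace LongCycle

variable {γ : Hom Γ Δ}

/-- The long cycle with its base point moved. -/
def rotate (L : LongCycle γ) (x : ZMod L.len) : LongCycle γ where
  len := L.len
  len_pos := L.len_pos
  cyc := Hom.comp L.cyc (rot L.len x)
  primitive := L.primitive.rot x
  long := (Cyc.deg_rot (γ.comp L.cyc) x).symm ▸ L.long

theorem next_rotate (L : LongCycle γ) (x : ZMod L.len) : (L.rotate x).next = L.rotate (x + 1) := by
  unfold next rotate
  congr 1
  have key : ∀ i : ZMod L.len, i + 1 + x = i + (x + 1) := fun i => by ring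
  ext i
  · exact congrArg L.cyc.onV (key i)
  · exact congrArg L.cyc.onE (key i)

theorem onE_rotate (L : LongCycle γ) (x : ZMod L.len) :
    (longCyclesMap γ).onE (L.rotate x) = L.cyc.onE x :=
  congrArg L.cyc.onE (zero_add (M := ZMod L.len) x)

end LongCycle

/-- Running along both long cycles at once closes up after `L.len * L'.len` steps and is a cycle in
`𝕊_Γ ×_Δ 𝕊_Λ`. -/
theorem mem_longImageEdges {γ : Hom Γ Δ} {lam : Hom Λ Δ} (L : LongCycle γ) (L' : LongCycle lam)
    (h : ∀ k : ℤ, γ.onE (L.cyc.onE (k : ZMod L.len)) = lam.onE (L'.cyc.onE (k : ZMod L'.len)))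
    (e : (fibreProd γ lam).E) (he : e.1.1 = L.cyc.onE (0 : ZMod L.len))
    (he' : e.1.2 = L'.cyc.onE (0 : ZMod L'.len)) : e ∈ longImageEdges γ lam := by
  set N := L.len * L'.len with hN
  have d : L.len ∣ N := Dvd.intro _ rfl
  have d' : L'.len ∣ N := Dvd.intro_left _ rfl
  let ρ : ZMod N → ZMod L.len := ZMod.castHom d (ZMod L.len)
  let ρ' : ZMod N → ZMod L'.len := ZMod.castHom d' (ZMod L'.len)
  have hE : ∀ i : ZMod N, γ.onE ((longCyclesMap γ).onE (L.rotate (ρ i))) =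
      lam.onE ((longCyclesMap lam).onE (L'.rotate (ρ' i))) := fun i => by
    obtain ⟨k, rfl⟩ := ZMod.intCast_surjective (n := N) i
    rw [LongCycle.onE_rotate, LongCycle.onE_rotate]
    simp only [ρ, ρ', map_intCast]
    exact h k
  have hV : ∀ i : ZMod N, γ.onV ((longCyclesMap γ).onV (L.rotate (ρ i))) =
      lam.onV ((longCyclesMap lam).onV (L'.rotate (ρ' i))) := fun i => by
    have := congrArg Δ.o (hE i)
    rw [← γ.o_comm, ← lam.o_comm] at this
    exact (congrArg γ.onV ((longCyclesMap γ).o_comm _)).trans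
      (this.trans (congrArg lam.onV ((longCyclesMap lam).o_comm _)).symm)
  let f : Cyc (longProd γ lam) N :=
    { onV := fun i : ZMod N => ⟨(L.rotate (ρ i), L'.rotate (ρ' i)), hV i⟩
      onE := fun i : ZMod N => ⟨(L.rotate (ρ i), L'.rotate (ρ' i)), hE i⟩
      o_comm := fun _ => rfl
      t_comm := fun i => by
        refine Subtype.ext (Prod.ext ?_ ?_)
        · refine (congrArg L.rotate ?_).trans (L.next_rotate (ρ i)).symm
          exact (map_add (ZMod.castHom d (ZMod L.len)) _ _).trans
            (congrArg (ρ i + ·) (map_one (ZMod.castHom d (ZMod L.len))))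
        · refine (congrArg L'.rotate ?_).trans (L'.next_rotate (ρ' i)).symm
          exact (map_add (ZMod.castHom d' (ZMod L'.len)) _ _).trans
            (congrArg (ρ' i + ·) (map_one (ZMod.castHom d' (ZMod L'.len))))
      map_Vi := fun _ h => h.elim
      map_Vf := fun _ h => h.elim }
  refine ⟨_, ⟨N, Nat.mul_pos L.len_pos L'.len_pos, f, (0 : ZMod N), rfl⟩, ?_⟩
  refine Subtype.ext (Prod.ext ?_ ?_)
  · refine (L.onE_rotate (ρ 0)).trans ?_
    rw [he]
    exact congrArg _ (map_zero (ZMod.castHom d (ZMod L.len)))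
  · refine (L'.onE_rotate (ρ' 0)).trans ?_
    rw [he']
    exact congrArg _ (map_zero (ZMod.castHom d' (ZMod L'.len)))

/-- Two long periodic walks with the same labels run through `s(𝕊)`. -/
theorem mem_longImageEdges_of_walk (γ : Hom Γ Δ) (lam : Hom Λ Δ) {q D D' : ℕ} {c : ℤ → Γ.E}
    {c' : ℤ → Λ.E} (hq : 0 < q) (hD : 0 < D) (hD' : 0 < D') (hl : 12 * Γ.betti₁ ≤ D)
    (hl' : 12 * Λ.betti₁ ≤ D') (hw : ∀ k, Γ.t (c k) = Γ.o (c (k + 1)))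
    (hw' : ∀ k, Λ.t (c' k) = Λ.o (c' (k + 1))) (hlab : ∀ k, γ.onE (c k) = lam.onE (c' k))
    (hper : ∀ k, γ.onE (c (k + q)) = γ.onE (c k)) (hc : ∀ k, c (k + (D * q : ℕ)) = c k)
    (hc' : ∀ k, c' (k + (D' * q : ℕ)) = c' k)
    (hmin : ∀ r : ℕ, 0 < r → (∀ k, c (k + r) = c k) → D * q ≤ r)
    (hmin' : ∀ r : ℕ, 0 < r → (∀ k, c' (k + r) = c' k) → D' * q ≤ r) :
    ∃ h, (⟨(c 0, c' 0), h⟩ : (fibreProd γ lam).E) ∈ longImageEdges γ lam := by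
  have p := Nat.mul_pos hD hq
  have p' := Nat.mul_pos hD' hq
  let L : LongCycle γ := ⟨D * q, p, cycOfWalk c (D * q) hw hc,
    cycOfWalk_isPrimitive p hw hc hmin, hl.trans (le_deg_cycOfWalk γ hq hw hc hper)⟩
  let L' : LongCycle lam := ⟨D' * q, p', cycOfWalk c' (D' * q) hw' hc',
    cycOfWalk_isPrimitive p' hw' hc' hmin', hl'.trans (le_deg_cycOfWalk lam hq hw' hc'
      fun k => by rw [← hlab, ← hlab, hper])⟩
  refine ⟨hlab 0, mem_longImageEdges L L' (fun k => ?_) _ ?_ ?_⟩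
  · exact (congrArg γ.onE (cycOfWalk_onE hw hc k)).trans
      ((hlab k).trans (congrArg lam.onE (cycOfWalk_onE hw' hc' k)).symm)
  · have := cycOfWalk_onE hw hc 0
    rw [Int.cast_zero] at this
    exact this.symm
  · have := cycOfWalk_onE hw' hc' 0
    rw [Int.cast_zero] at this
    exact this.symm

end MGraph

/-! ### From labelled graphs to the fibre product -/

namespace MGraph

variable {Γ : MGraph.{u₁, v₁}} {Λ : MGraph.{u₂, v₂}} {Δ : MGraph.{u₃, v₃}}

/-- The edges in `F`, labelled by their images under a forwards immersion, with the initial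
vertices `W`. -/
def Hom.labelled (γ : Hom Γ Δ) (hγ : γ.IsForwardsImmersion) (F : Set Γ.E) (W : Set Γ.V) :
    LGraph Δ.E where
  V := Γ.V
  E := F
  o e := Γ.o e
  t e := Γ.t e
  lab e := γ.onE e
  Vi := W
  det x _ h hl := Subtype.ext (hγ (Γ.o x) rfl h.symm hl)

/-- The pairs of edges in `F` and `F'` that are edges in `T`. -/
def edgePairs {γ : Hom Γ Δ} {lam : Hom Λ Δ} (T : Set (fibreProd γ lam).E) (F : Set Γ.E)
    (F' : Set Λ.E) : Set (F × F') :=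
  {x | ∃ h, (⟨(x.1, x.2), h⟩ : (fibreProd γ lam).E) ∈ T}

variable {γ : Hom Γ Δ} {lam : Hom Λ Δ} (hγ : γ.IsForwardsImmersion)
  (hlam : lam.IsForwardsImmersion)

theorem containsLong_edgePairs (F : Set Γ.E) (F' : Set Λ.E) (W : Set Γ.V) (W' : Set Λ.V) :
    LGraph.ContainsLong (S := γ.labelled hγ F W) (S' := lam.labelled hlam F' W')
      (edgePairs (longImageEdges γ lam) F F') (12 * Γ.betti₁) (12 * Λ.betti₁) := by
  intro q D D' c c' hq hD hD' hl hl' hw hw' hlab hper hc hc' hmin hmin'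
  refine mem_longImageEdges_of_walk γ lam (c := fun k => Subtype.val (p := (· ∈ F)) (c k))
    (c' := fun k => Subtype.val (p := (· ∈ F')) (c' k))
    hq hD hD' hl hl' hw hw' hlab hper (fun k => congrArg _ (hc k)) (fun k => congrArg _ (hc' k))
    (fun r hr h => hmin r hr fun k => Subtype.ext (h k))
    fun r hr h => hmin' r hr fun k => Subtype.ext (h k)

theorem backClosed_edgePairs {F : Set Γ.E} {F' : Set Λ.E} {W : Set Γ.V} {W' : Set Λ.V}
    {T : Set (fibreProd γ lam).E} (hT : ∀ e ∈ T, e.1.1 ∈ F ∧ e.1.2 ∈ F')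
    (hback : ∀ e ∈ T, (Γ.o e.1.1 ∈ W ∧ Λ.o e.1.2 ∈ W') ∨
      ∃ y ∈ T, (fibreProd γ lam).t y = (fibreProd γ lam).o e) :
    LGraph.BackClosed (S := γ.labelled hγ F W) (S' := lam.labelled hlam F' W')
      (edgePairs T F F') where
  matched := fun _ ⟨h, _⟩ => h
  back := by
    rintro x ⟨h, hx⟩
    refine (hback _ hx).imp id ?_
    rintro ⟨y, hy, hxy⟩
    refine ⟨(⟨y.1.1, (hT y hy).1⟩, ⟨y.1.2, (hT y hy).2⟩), ⟨y.2, hy⟩, ?_, ?_⟩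
    · exact congrArg (fun z => z.1.1) hxy
    · exact congrArg (fun z => z.1.2) hxy

/-- The edge sets `F` and `F'` are left free so that the same bound serves the whole graphs, for
relative cores, and the cores alone, where the number of chains is controlled by `β₁`. -/
theorem ncard_diff_longImageEdges_le [Finite Γ.E] [Finite Λ.E] {F : Set Γ.E} {F' : Set Λ.E}
    {W : Set Γ.V} {W' : Set Λ.V} {T : Set (fibreProd γ lam).E}
    (hT : ∀ e ∈ T, e.1.1 ∈ F ∧ e.1.2 ∈ F')
    (hback : ∀ e ∈ T, (Γ.o e.1.1 ∈ W ∧ Λ.o e.1.2 ∈ W') ∨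
      ∃ y ∈ T, (fibreProd γ lam).t y = (fibreProd γ lam).o e)
    {ι ι' : Type*} [Finite ι] [Finite ι'] (C : (γ.labelled hγ F W).Chains ι)
    (C' : (lam.labelled hlam F' W').Chains ι') (hW : W.Finite) (hW' : W'.Finite) :
    (T \ longImageEdges γ lam).ncard ≤
      LGraph.pairBound (Nat.card ι) (Nat.card ι') W.ncard W'.ncard (12 * Γ.betti₁)
        (12 * Λ.betti₁) * (Nat.card ι' * Nat.card Γ.E + Nat.card ι * Nat.card Λ.E) := by
  have : Finite (γ.labelled hγ F W).E := inferInstanceAs (Finite F)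
  have : Finite (lam.labelled hlam F' W').E := inferInstanceAs (Finite F')
  have key := LGraph.ncard_diff_le (backClosed_edgePairs hγ hlam hT hback)
    (containsLong_edgePairs hγ hlam F F' W W') hW hW' C C'
  have h1 : Nat.card (γ.labelled hγ F W).E ≤ Nat.card Γ.E :=
    Nat.card_le_card_of_injective (fun e : F => (e : Γ.E)) Subtype.val_injective
  have h2 : Nat.card (lam.labelled hlam F' W').E ≤ Nat.card Λ.E :=
    Nat.card_le_card_of_injective (fun e : F' => (e : Λ.E)) Subtype.val_injective
  refine le_trans ?_ (key.trans (Nat.mul_le_mul_left _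
    (add_le_add (Nat.mul_le_mul_left _ h1) (Nat.mul_le_mul_left _ h2))))
  rw [← Nat.card_coe_set_eq, ← Nat.card_coe_set_eq]
  have : Finite (F × F') := inferInstance
  refine Nat.card_le_card_of_injective (β := ↥(edgePairs T F F' \
    edgePairs (longImageEdges γ lam) F F')) (fun e => ⟨(⟨e.1.1.1, (hT e.1 e.2.1).1⟩,
      ⟨e.1.1.2, (hT e.1 e.2.1).2⟩), ⟨e.1.2, e.2.1⟩, fun h => e.2.2 h.2⟩) ?_
  intro e e' h
  exact Subtype.ext (Subtype.ext (Prod.ext (congrArg (fun z => (z.1.1 : Γ.E)) h)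
    (congrArg (fun z => (z.1.2 : Λ.E)) h)))

/-- Only the first edge of an admissible path has no predecessor on it; then the path begins at an
initial vertex, or it is a loop and its last edge is a predecessor. -/
theorem rcore_edges_back (Γ : MGraph.{u₁, v₁}) (e : Γ.E) (he : e ∈ Γ.rcore.edges) :
    Γ.o e ∈ Γ.Vi ∨ ∃ y ∈ Γ.rcore.edges, Γ.t y = Γ.o e := by
  obtain ⟨k, p, hp, (i : Fin k), rfl⟩ := he
  obtain ⟨k, rfl⟩ : ∃ k', k = k' + 1 := ⟨k - 1, by have := i.2; omega⟩
  refine i.cases ?_ fun j => ?_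
  · rcases hp with h | h
    · left
      exact p.o_comm (0 : Fin (k + 1)) ▸ h.1
    · right
      refine ⟨p.onE (Fin.last k : Fin (k + 1)), ⟨k + 1, p, Or.inr h, _, rfl⟩, ?_⟩
      exact (p.t_comm (Fin.last k : Fin (k + 1))).symm.trans
        (h.symm.trans (p.o_comm (0 : Fin (k + 1))))
  · right
    refine ⟨p.onE (j.castSucc : Fin (k + 1)), ⟨k + 1, p, hp, _, rfl⟩, ?_⟩
    exact (p.t_comm (j.castSucc : Fin (k + 1))).symm.trans
      ((congrArg p.onV (Fin.succ_castSucc j)).trans (p.o_comm (j.succ : Fin (k + 1))))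

theorem core_edges_back (Γ : MGraph.{u₁, v₁}) (e : Γ.E) (he : e ∈ Γ.core.edges) :
    ∃ y ∈ Γ.core.edges, Γ.t y = Γ.o e := by
  obtain ⟨n, hn, f, i, rfl⟩ := he
  obtain ⟨j, rfl⟩ : ∃ j : ZMod n, j + 1 = i := ⟨_, sub_add_cancel (G := ZMod n) i 1⟩
  exact ⟨f.onE j, ⟨n, hn, f, j, rfl⟩, (f.t_comm j).symm.trans (f.o_comm _)⟩

theorem core_edges_fwd (Γ : MGraph.{u₁, v₁}) (e : Γ.E) (he : e ∈ Γ.core.edges) :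
    ∃ y ∈ Γ.core.edges, Γ.o y = Γ.t e := by
  obtain ⟨n, hn, f, i, rfl⟩ := he
  let j : ZMod n := i
  exact ⟨f.onE (j + 1), ⟨n, hn, f, _, rfl⟩, (f.o_comm _).symm.trans (f.t_comm j)⟩

/-- The first projection of the fibre product. -/
def fibreFst (γ : Hom Γ Δ) (lam : Hom Λ Δ) : Hom (fibreProd γ lam) Γ where
  onV x := x.1.1
  onE e := e.1.1
  o_comm _ := rfl
  t_comm _ := rfl
  map_Vi _ h := h.1
  map_Vf _ h := h.1

/-- The second projection of the fibre product. -/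
def fibreSnd (γ : Hom Γ Δ) (lam : Hom Λ Δ) : Hom (fibreProd γ lam) Λ where
  onV x := x.1.2
  onE e := e.1.2
  o_comm _ := rfl
  t_comm _ := rfl
  map_Vi _ h := h.2
  map_Vf _ h := h.2

theorem core_edges_fibreProd {e : (fibreProd γ lam).E} (he : e ∈ (fibreProd γ lam).core.edges) :
    e.1.1 ∈ Γ.core.edges ∧ e.1.2 ∈ Λ.core.edges := by
  obtain ⟨n, hn, f, i, rfl⟩ := he
  exact ⟨⟨n, hn, (fibreFst γ lam).comp f, i, rfl⟩, ⟨n, hn, (fibreSnd γ lam).comp f, i, rfl⟩⟩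

end MGraph

/-! ### The decomposition into maximal chains -/

namespace LGraph

variable {A : Type*} (S : LGraph A)

/-- Exactly one edge ends and exactly one edge begins at `v`. -/
def IsGood (v : S.V) : Prop := (∃! e, S.t e = v) ∧ ∃! e, S.o e = v

open Classical in
/-- The only edge that ends at a good origin of `e`; otherwise `e`. -/
noncomputable def pred (e : S.E) : S.E := if h : S.IsGood (S.o e) then h.1.choose else e

variable {S}

theorem t_pred {e : S.E} (h : S.IsGood (S.o e)) : S.t (S.pred e) = S.o e := by
  rw [pred, dif_pos h]
  exact h.1.choose_spec.1

theorem eq_pred {e y : S.E} (h : S.IsGood (S.o e)) (hy : S.t y = S.o e) : y = S.pred e :=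
  h.1.unique hy (t_pred h)

theorem pred_inj {x y : S.E} (hx : S.IsGood (S.o x)) (hy : S.IsGood (S.o y))
    (h : S.pred x = S.pred y) : x = y :=
  hy.2.unique (by rw [← t_pred hx, h, t_pred hy]) rfl

variable (S) in
/-- The edges on circles all of whose vertices are good. -/
def circleEdges : Set S.E := {e | ∀ k, S.IsGood (S.o (S.pred^[k] e))}

theorem pred_mem_circleEdges {e : S.E} (he : e ∈ S.circleEdges) : S.pred e ∈ S.circleEdges :=
  fun k => he (k + 1)

theorem pred_iterate_mem_circleEdges {e : S.E} (he : e ∈ S.circleEdges) (k : ℕ) :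
    S.pred^[k] e ∈ S.circleEdges := by
  induction k with
  | zero => exact he
  | succ k ih => rw [Function.iterate_succ_apply']; exact pred_mem_circleEdges ih

/-- On the circles `pred` is a permutation. -/
theorem bijOn_pred [Finite S.E] : Set.BijOn S.pred S.circleEdges S.circleEdges := by
  have h : Set.MapsTo S.pred S.circleEdges S.circleEdges := fun e he => pred_mem_circleEdges he
  have hi : Set.InjOn S.pred S.circleEdges := fun x hx y hy hxy => pred_inj (hx 0) (hy 0) hxy
  refine ⟨h, hi, fun y hy => ?_⟩
  have hsurj := Finite.injective_iff_surjective.1 ((Set.MapsTo.restrict_inj h).2 hi)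
  obtain ⟨x, hx⟩ := hsurj ⟨y, hy⟩
  exact ⟨x.1, x.2, congrArg Subtype.val hx⟩

theorem exists_pred_iterate_eq [Finite S.E] {e : S.E} (he : e ∈ S.circleEdges) (k : ℕ) :
    ∃ n, S.pred^[n] (S.pred^[k] e) = e := by
  have hinj : ∀ (j : ℕ) (x y : S.E), x ∈ S.circleEdges → y ∈ S.circleEdges →
      S.pred^[j] x = S.pred^[j] y → x = y := by
    intro j
    induction j with
    | zero => exact fun _ _ _ _ h => h
    | succ j ih =>
      intro x y hx hy h
      rw [Function.iterate_succ_apply, Function.iterate_succ_apply] at h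
      exact pred_inj (hx 0) (hy 0) (ih _ _ (pred_mem_circleEdges hx) (pred_mem_circleEdges hy) h)
  obtain ⟨i, j, hij, h⟩ := Finite.exists_ne_map_eq_of_infinite fun j : ℕ => S.pred^[j] e
  have hper : ∃ n, 0 < n ∧ S.pred^[n] e = e := by
    rcases lt_or_gt_of_ne hij with hlt | hlt
    · refine ⟨j - i, by omega, (hinj i _ _ he (pred_iterate_mem_circleEdges he _) ?_).symm⟩
      rw [← Function.iterate_add_apply, show i + (j - i) = j by omega]
      exact h
    · refine ⟨i - j, by omega, (hinj j _ _ he (pred_iterate_mem_circleEdges he _) ?_).symm⟩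
      rw [← Function.iterate_add_apply, show j + (i - j) = i by omega]
      exact h.symm
  obtain ⟨n, hn, hne⟩ := hper
  refine ⟨n * (k + 1) - k, ?_⟩
  have : k ≤ n * (k + 1) := by nlinarith
  rw [← Function.iterate_add_apply, Nat.sub_add_cancel this, Function.iterate_mul,
    Function.iterate_fixed hne]

variable (S) in
/-- One edge on every circle: the least one in some enumeration. -/
def circleReps (ν : S.E → ℕ) : Set S.E := {e | e ∈ S.circleEdges ∧ ∀ k, ν e ≤ ν (S.pred^[k] e)}

variable (S) in
/-- The first edges of the chains. -/
def heads (ν : S.E → ℕ) : Set S.E := {e | ¬ S.IsGood (S.o e)} ∪ S.circleReps ν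

section Heads

variable {ν : S.E → ℕ}

theorem isGood_of_notMem_heads {e : S.E} (h : e ∉ S.heads ν) : S.IsGood (S.o e) := by
  by_contra hn
  exact h (Or.inl hn)

theorem exists_pred_iterate_mem_heads (ν : S.E → ℕ) (e : S.E) :
    ∃ k, S.pred^[k] e ∈ S.heads ν := by
  classical
  by_cases he : e ∈ S.circleEdges
  · have hex : ∃ x, ∃ k, ν (S.pred^[k] e) = x := ⟨_, 0, rfl⟩
    obtain ⟨k, hk⟩ := Nat.find_spec hex
    refine ⟨k, Or.inr ⟨pred_iterate_mem_circleEdges he k, fun j => ?_⟩⟩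
    rw [hk, ← Function.iterate_add_apply]
    exact Nat.find_min' hex ⟨_, rfl⟩
  · simp only [circleEdges, Set.mem_ofPred_eq, not_forall] at he
    obtain ⟨k, hk⟩ := he
    exact ⟨k, Or.inl hk⟩

open Classical in
/-- The decomposition of the edges into maximal chains. -/
noncomputable def headChains (S : LGraph A) (ν : S.E → ℕ) : S.Chains (S.heads ν) where
  pos e := Nat.find (exists_pred_iterate_mem_heads ν e)
  idx e := ⟨_, Nat.find_spec (exists_pred_iterate_mem_heads ν e)⟩
  prev := S.pred
  ext x y h h' := by
    have h := congrArg Subtype.val h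
    simp only at h
    set n := Nat.find (exists_pred_iterate_mem_heads ν x) with hn
    have key : ∀ j ≤ n, S.pred^[n - j] x = S.pred^[n - j] y := by
      intro j
      induction j with
      | zero => intro _; rw [Nat.sub_zero, h, ← h']
      | succ j ih =>
        intro hj
        have e := ih (by omega)
        rw [show n - j = n - (j + 1) + 1 by omega, Function.iterate_succ_apply',
          Function.iterate_succ_apply'] at e
        exact pred_inj
          (isGood_of_notMem_heads (Nat.find_min (exists_pred_iterate_mem_heads ν x) (by omega)))
          (isGood_of_notMem_heads (Nat.find_min (exists_pred_iterate_mem_heads ν y) (by omega))) e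
    have := key n le_rfl
    rwa [Nat.sub_self] at this
  idx_prev x h := by
    refine Subtype.ext ?_
    simp only
    have := Nat.find_comp_succ (exists_pred_iterate_mem_heads ν x)
      (exists_pred_iterate_mem_heads ν (S.pred x)) ((Nat.find_eq_zero _).not.1 h)
    rw [this]
    rfl
  pos_prev x h := by
    exact (Nat.find_comp_succ (exists_pred_iterate_mem_heads ν x)
      (exists_pred_iterate_mem_heads ν (S.pred x)) ((Nat.find_eq_zero _).not.1 h)).symm
  t_prev x h := t_pred (isGood_of_notMem_heads ((Nat.find_eq_zero _).not.1 h))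
  eq_prev x y h hy := eq_pred (isGood_of_notMem_heads ((Nat.find_eq_zero _).not.1 h)) hy
  eq_of_o x y h hy := (isGood_of_notMem_heads ((Nat.find_eq_zero _).not.1 h)).2.unique hy rfl

open Classical in
theorem headChains_pos_eq_zero {e : S.E} : (S.headChains ν).pos e = 0 ↔ e ∈ S.heads ν :=
  Nat.find_eq_zero _

theorem headChains_isGood {e : S.E} (h : (S.headChains ν).pos e ≠ 0) : S.IsGood (S.o e) :=
  isGood_of_notMem_heads (headChains_pos_eq_zero.not.1 h)

theorem headChains_pos_head {e : S.E} (he : e ∈ S.heads ν) : (S.headChains ν).pos e = 0 :=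
  headChains_pos_eq_zero.2 he

theorem headChains_idx_eq (e : S.E) :
    ((S.headChains ν).idx e : S.E) = S.pred^[(S.headChains ν).pos e] e := rfl

theorem headChains_idx_head (h : S.heads ν) : (S.headChains ν).idx h = h := by
  refine Subtype.ext ?_
  rw [headChains_idx_eq, headChains_pos_head h.2]
  rfl

theorem headChains_idx_mem_circleReps {e : S.E} (he : e ∈ S.circleEdges) :
    ((S.headChains ν).idx e : S.E) ∈ S.circleReps ν := by
  refine ((S.headChains ν).idx e).2.resolve_left fun h => h ?_
  rw [headChains_idx_eq]
  exact pred_iterate_mem_circleEdges he _ 0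

/-- All edges of a circle belong to the same chain. -/
theorem headChains_idx_pred [Finite S.E] (hν : Function.Injective ν) {e : S.E}
    (he : e ∈ S.circleEdges) : (S.headChains ν).idx (S.pred e) = (S.headChains ν).idx e := by
  set C := S.headChains ν with hC
  -- Position `0` on a circle means that `e` is a representative and `pred` jumps over the cut. Both
  -- heads minimise `ν` on the same circle, so they agree by injectivity.
  by_cases h0 : C.pos e = 0
  · have hr : e ∈ S.circleReps ν :=
      (headChains_pos_eq_zero.1 h0).resolve_left fun h => h (he 0)
    refine (Subtype.ext (hν (le_antisymm ?_ ?_))).trans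
      (headChains_idx_head (⟨e, Or.inr hr⟩ : S.heads ν)).symm
    · obtain ⟨n, hn⟩ := exists_pred_iterate_eq he (C.pos (S.pred e) + 1)
      have := (headChains_idx_mem_circleReps (ν := ν) (pred_mem_circleEdges he)).2 n
      rw [headChains_idx_eq, ← hC, ← Function.iterate_succ_apply, hn] at this
      rwa [headChains_idx_eq, ← hC, ← Function.iterate_succ_apply]
    · rw [headChains_idx_eq, ← hC, ← Function.iterate_succ_apply]
      exact hr.2 _
  · exact C.idx_prev e h0

/-- A chain is either closed or begins and ends at vertices that are not good. -/
theorem headChains_end [Finite S.E] (hν : Function.Injective ν) (h : S.heads ν) {m : ℕ}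
    {u : ℤ → S.E} (hm : 0 < m) (hu : (S.headChains ν).Enum h m u)
    (hu' : ∀ e, (S.headChains ν).idx e = h →
      (S.headChains ν).pos e < m ∧ u ((S.headChains ν).pos e) = e) :
    u 0 = h ∧ ((¬ S.IsGood (S.o (u 0)) ∧ ¬ S.IsGood (S.t (u (m - 1)))) ∨
      (S.IsGood (S.o (u 0)) ∧ S.t (u (m - 1)) = S.o (u 0))) := by
  set C := S.headChains ν with hC
  have h0 : u 0 = h := by
    have := (hu' h (headChains_idx_head h)).2
    rw [headChains_pos_head h.2] at this
    exact this
  refine ⟨h0, ?_⟩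
  obtain ⟨l1, l2⟩ := hu (m - 1) (by omega) (by omega)
  rw [h0]
  rcases h.2 with hb | hr
  · refine Or.inl ⟨hb, fun hg => ?_⟩
    obtain ⟨e, he, -⟩ := hg.2
    rw [← he] at hg
    have hp : u (m - 1) = S.pred e := eq_pred hg he.symm
    have hcirc : e ∉ S.circleEdges := fun hc => by
      refine hb ?_
      have := pred_iterate_mem_circleEdges (pred_mem_circleEdges hc) (C.pos (u (m - 1)))
      rw [← hp, ← headChains_idx_eq, ← hC, l1] at this
      exact this 0
    have hne : C.pos e ≠ 0 := fun hz => by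
      have := headChains_pos_eq_zero.1 hz
      rcases this with h | h
      · exact h hg
      · exact hcirc h.1
    have i1 := C.idx_prev e hne
    have i2 := C.pos_prev e hne
    change C.idx (S.pred e) = _ at i1
    change C.pos (S.pred e) + 1 = _ at i2
    rw [← hp] at i1 i2
    have := (hu' e (i1.symm.trans l1)).1
    omega
  · right
    have hg : S.IsGood (S.o (h : S.E)) := hr.1 0
    refine ⟨hg, ?_⟩
    have hidx : C.idx (S.pred h) = h :=
      (headChains_idx_pred hν hr.1).trans (headChains_idx_head h)
    obtain ⟨p1, p2⟩ := hu' _ hidx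
    by_cases hlast : C.pos (S.pred h) + 1 = m
    · rw [show (m : ℤ) - 1 = C.pos (S.pred h) by omega, p2, t_pred hg]
    · exfalso
      have e1 := hu.eq_of_o (i := C.pos (S.pred h)) (e := h) (by omega) (by omega)
        (by rw [p2, t_pred hg])
      have e2 := hu.pos_succ (i := C.pos (S.pred h)) (by omega) (by omega)
      rw [← e1, hC, headChains_pos_head h.2] at e2
      exact e2 rfl

end Heads

end LGraph

/-! ### Cycle rank and the number of chains -/

namespace LGraph

variable {A : Type*} (S : LGraph A) [Fintype S.E]

/-- The boundary map on rational chains. -/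
noncomputable def boundary : (S.E → ℚ) →ₗ[ℚ] (S.V →₀ ℚ) :=
  Fintype.linearCombination ℚ fun e => Finsupp.single (S.t e) 1 - Finsupp.single (S.o e) 1

/-- The dimension of the space of cycles. -/
noncomputable def cycleRank : ℕ := Module.finrank ℚ (LinearMap.ker S.boundary)

variable {S}

theorem boundary_apply (x : S.E → ℚ) : S.boundary x =
    ∑ e, Finsupp.single (S.t e) (x e) - ∑ e, Finsupp.single (S.o e) (x e) := by
  simp [boundary, Fintype.linearCombination_apply, smul_sub]

/-- A cycle has constant coefficients along a chain. -/
theorem Chains.eq_of_mem_ker {ι : Type*} (C : S.Chains ι) {x : S.E → ℚ}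
    (hx : x ∈ LinearMap.ker S.boundary) {e : S.E} (he : C.pos e ≠ 0) : x (C.prev e) = x e := by
  classical
  rw [LinearMap.mem_ker, boundary_apply] at hx
  have h := DFunLike.congr_fun hx (S.o e)
  simp only [Finsupp.coe_sub, Pi.sub_apply, Finsupp.coe_finsetSum, Finset.sum_apply,
    Finsupp.coe_zero, Pi.zero_apply, Finsupp.single_apply] at h
  rw [Finset.sum_eq_single (C.prev e), Finset.sum_eq_single e] at h
  · rw [if_pos (C.t_prev e he), if_pos rfl] at h
    exact sub_eq_zero.1 h
  · exact fun y _ hy => if_neg fun h => hy (C.eq_of_o e y he h)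
  · simp
  · exact fun y _ hy => if_neg fun h => hy (C.eq_prev e y he h)
  · simp

/-- Cycles are constant along chains, hence determined by their values on the first edges. -/
theorem cycleRank_le_card {ι : Type*} [Finite ι] (C : S.Chains ι) : S.cycleRank ≤ Nat.card ι := by
  classical
  have := Fintype.ofFinite ι
  rw [Nat.card_eq_fintype_card, ← Module.finrank_fintype_fun_eq_card ℚ (η := ι)]
  have hrep : ∀ x ∈ LinearMap.ker S.boundary, ∀ (n : ℕ) (e : S.E), C.pos e = n →
      ∃ h, C.pos h = 0 ∧ C.idx h = C.idx e ∧ x h = x e := by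
    intro x hx n
    induction n with
    | zero => exact fun e he => ⟨e, he, rfl, rfl⟩
    | succ n ih =>
      intro e he
      have h0 : C.pos e ≠ 0 := by omega
      obtain ⟨h, h1, h2, h3⟩ := ih (C.prev e) (by have := C.pos_prev e h0; omega)
      exact ⟨h, h1, h2.trans (C.idx_prev e h0), h3.trans (C.eq_of_mem_ker hx h0)⟩
  let f : (S.E → ℚ) →ₗ[ℚ] (ι → ℚ) :=
    { toFun := fun x a => if h : ∃ e, C.pos e = 0 ∧ C.idx e = a then x h.choose else 0
      map_add' := fun x y => by
        ext a
        by_cases h : ∃ e, C.pos e = 0 ∧ C.idx e = a <;> simp [h]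
      map_smul' := fun r x => by
        ext a
        by_cases h : ∃ e, C.pos e = 0 ∧ C.idx e = a <;> simp [h] }
  refine LinearMap.finrank_le_finrank_of_injective (f := f.domRestrict (LinearMap.ker S.boundary))
    ((injective_iff_map_eq_zero _).2 ?_)
  rintro ⟨x, hx⟩ h0
  refine Subtype.ext (funext fun e => ?_)
  obtain ⟨h, h1, h2, h3⟩ := hrep x hx _ e rfl
  have hex : ∃ e', C.pos e' = 0 ∧ C.idx e' = C.idx e := ⟨h, h1, h2⟩
  have := congrFun h0 (C.idx e)
  simp only [LinearMap.domRestrict_apply, f, LinearMap.coe_mk, AddHom.coe_mk, dif_pos hex] at this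
  refine h3.symm.trans (Eq.trans ?_ this)
  congr 1
  exact C.ext _ _ (h2.trans hex.choose_spec.2.symm) (h1.trans hex.choose_spec.1.symm)

/-- The circles are linearly independent cycles. -/
theorem card_circleReps_le {ν : S.E → ℕ} (hν : Function.Injective ν) :
    Nat.card (S.circleReps ν) ≤ S.cycleRank := by
  classical
  have := Fintype.ofFinite (S.circleReps ν)
  rw [Nat.card_eq_fintype_card, ← Module.finrank_fintype_fun_eq_card ℚ (η := S.circleReps ν)]
  let f : (S.circleReps ν → ℚ) →ₗ[ℚ] (S.E → ℚ) :=
    { toFun := fun y e =>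
        if h : e ∈ S.circleEdges then y ⟨_, headChains_idx_mem_circleReps (ν := ν) h⟩ else 0
      map_add' := fun x y => by
        ext e
        by_cases h : e ∈ S.circleEdges <;> simp [h]
      map_smul' := fun c x => by
        ext e
        by_cases h : e ∈ S.circleEdges <;> simp [h] }
  have hf : ∀ y e, (h : e ∈ S.circleEdges) →
      f y e = y ⟨_, headChains_idx_mem_circleReps (ν := ν) h⟩ := fun y e h => dif_pos h
  have hf0 : ∀ y e, e ∉ S.circleEdges → f y e = 0 := fun y e h => dif_neg h
  -- `pred` permutes the edges on circles, preserves the coefficients and satisfies `t (pred e) = o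
  -- e`, so the sums over targets and over origins agree.
  have hker : ∀ y, f y ∈ LinearMap.ker S.boundary := fun y => by
    rw [LinearMap.mem_ker, boundary_apply, sub_eq_zero]
    rw [← Finset.sum_filter_of_ne (p := (· ∈ S.circleEdges)),
      ← Finset.sum_filter_of_ne (s := Finset.univ) (p := (· ∈ S.circleEdges))
        (f := fun e => Finsupp.single (S.o e) (f y e))]
    · symm
      refine Finset.sum_nbij S.pred ?_ ?_ ?_ ?_
      · intro e he
        simpa using pred_mem_circleEdges (by simpa using he)
      · simpa using bijOn_pred.injOn
      · simpa using bijOn_pred.surjOn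
      · intro e he
        have he : e ∈ S.circleEdges := by simpa using he
        rw [t_pred (e := e) (he 0), hf y e he, hf y _ (pred_mem_circleEdges he)]
        congr 3
        exact congrArg Subtype.val (headChains_idx_pred hν he).symm
    · intro e _ h
      by_contra hn
      exact h (by rw [hf0 y e hn, Finsupp.single_zero])
    · intro e _ h
      by_contra hn
      exact h (by rw [hf0 y e hn, Finsupp.single_zero])
  refine LinearMap.finrank_le_finrank_of_injective (f := f.codRestrict _ hker)
    ((injective_iff_map_eq_zero _).2 fun y h0 => funext fun r => ?_)
  have h1 := congrFun (congrArg Subtype.val h0) r.1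
  have h1 : f y r.1 = 0 := h1
  rw [hf y r.1 r.2.1] at h1
  refine Eq.trans (congrArg y (Subtype.ext ?_)) h1
  exact (congrArg Subtype.val (headChains_idx_head (⟨r.1, Or.inr r.2⟩ : S.heads ν))).symm

/-- If every vertex that is met has incoming and outgoing edges, then most vertices are good. -/
theorem card_not_good_le (hin : ∀ e, ∃ y, S.t y = S.o e) (hout : ∀ e, ∃ y, S.o y = S.t e) :
    {e | ¬ S.IsGood (S.o e)}.ncard ≤ 3 * S.cycleRank := by
  classical
  set W : Finset S.V := Finset.univ.image S.o with hW
  have hWt : ∀ e, S.t e ∈ W := fun e => by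
    obtain ⟨y, hy⟩ := hout e
    exact Finset.mem_image.2 ⟨y, Finset.mem_univ _, hy⟩
  have hWo : ∀ e, S.o e ∈ W := fun e => Finset.mem_image_of_mem _ (Finset.mem_univ _)
  have hrank : Fintype.card S.E ≤ W.card + S.cycleRank := by
    have h1 := LinearMap.finrank_range_add_finrank_ker S.boundary
    rw [Module.finrank_fintype_fun_eq_card] at h1
    have h2 : LinearMap.range S.boundary ≤
        Submodule.span ℚ ((W.image fun v => (Finsupp.single v 1 : S.V →₀ ℚ) : Finset _) : Set _) := by
      rintro _ ⟨x, rfl⟩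
      have hs : ∀ v ∈ W, (Finsupp.single v 1 : S.V →₀ ℚ) ∈ Submodule.span ℚ
          ((W.image fun v => (Finsupp.single v 1 : S.V →₀ ℚ) : Finset _) : Set (S.V →₀ ℚ)) :=
        fun v hv => Submodule.subset_span (Finset.mem_coe.2 (Finset.mem_image_of_mem _ hv))
      rw [boundary, Fintype.linearCombination_apply]
      exact Submodule.sum_mem _ fun e _ => Submodule.smul_mem _ _
        (Submodule.sub_mem _ (hs _ (hWt e)) (hs _ (hWo e)))
    have h3 := (Submodule.finrank_mono h2).trans
      ((finrank_span_finset_le_card _).trans Finset.card_image_le)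
    unfold cycleRank
    omega
  have h1 : Fintype.card S.E = ∑ v ∈ W, (Finset.univ.filter fun e => S.o e = v).card := by
    rw [← Finset.card_univ]
    exact Finset.card_eq_sum_card_fiberwise fun e _ => hWo e
  have h2 : Fintype.card S.E = ∑ v ∈ W, (Finset.univ.filter fun e => S.t e = v).card := by
    rw [← Finset.card_univ]
    exact Finset.card_eq_sum_card_fiberwise fun e _ => hWt e
  set B : Finset S.E := Finset.univ.filter fun e => ¬ S.IsGood (S.o e) with hB
  have h3 : B.card = ∑ v ∈ W, (B.filter fun e => S.o e = v).card :=
    Finset.card_eq_sum_card_fiberwise fun e _ => hWo e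
  have h4 : B.card + 3 * W.card ≤ 3 * Fintype.card S.E := by
    -- At a good vertex this reads `0 + 3 ≤ 2 + 1`. At any other vertex of `W` both degrees are
    -- positive and not both `1`, so their sum is at least `3`. Summing gives `|B| ≤ 3 * (|E| -
    -- |W|)`, and `hrank` concludes.
    have : ∑ v ∈ W, ((B.filter fun e => S.o e = v).card + 3) ≤
        ∑ v ∈ W, (2 * (Finset.univ.filter fun e => S.o e = v).card +
          (Finset.univ.filter fun e => S.t e = v).card) := by
      refine Finset.sum_le_sum fun v hv => ?_
      obtain ⟨e, -, rfl⟩ := Finset.mem_image.1 hv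
      obtain ⟨y, hy⟩ := hin e
      have p1 : 0 < (Finset.univ.filter fun e' => S.o e' = S.o e).card :=
        Finset.card_pos.2 ⟨e, by simp⟩
      have p2 : 0 < (Finset.univ.filter fun e' => S.t e' = S.o e).card :=
        Finset.card_pos.2 ⟨y, by simp [hy]⟩
      by_cases hg : S.IsGood (S.o e)
      · have : (B.filter fun e' => S.o e' = S.o e) = ∅ := by
          refine Finset.filter_eq_empty_iff.2 fun e' he' h => ?_
          exact (Finset.mem_filter.1 he').2 (h ▸ hg)
        rw [this, Finset.card_empty]
        omega
      · have hle : (B.filter fun e' => S.o e' = S.o e).card ≤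
            (Finset.univ.filter fun e' => S.o e' = S.o e).card :=
          Finset.card_le_card (Finset.filter_subset_filter _ (Finset.subset_univ _))
        have : ¬ ((Finset.univ.filter fun e' => S.t e' = S.o e).card = 1 ∧
            (Finset.univ.filter fun e' => S.o e' = S.o e).card = 1) := by
          rintro ⟨c1, c2⟩
          obtain ⟨a, ha⟩ := Finset.card_eq_one.1 c1
          obtain ⟨b, hb⟩ := Finset.card_eq_one.1 c2
          refine hg ⟨⟨a, ?_, fun z hz => ?_⟩, ⟨b, ?_, fun z hz => ?_⟩⟩
          · have := Finset.mem_singleton_self a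
            rw [← ha] at this
            exact (Finset.mem_filter.1 this).2
          · rw [← Finset.mem_singleton, ← ha]
            exact Finset.mem_filter.2 ⟨Finset.mem_univ _, hz⟩
          · have := Finset.mem_singleton_self b
            rw [← hb] at this
            exact (Finset.mem_filter.1 this).2
          · rw [← Finset.mem_singleton, ← hb]
            exact Finset.mem_filter.2 ⟨Finset.mem_univ _, hz⟩
        omega
    rw [Finset.sum_add_distrib, Finset.sum_add_distrib, ← h3, ← Finset.mul_sum, ← h1, ← h2,
      Finset.sum_const, smul_eq_mul] at this
    omega
  have h5 : {e | ¬ S.IsGood (S.o e)}.ncard = B.card := by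
    rw [← Set.ncard_coe_finset, hB]
    simp
  omega

/-- Three times the rank for the edges with bad origin, once for the circles. -/
theorem card_heads_le {ν : S.E → ℕ} (hν : Function.Injective ν)
    (hin : ∀ e, ∃ y, S.t y = S.o e) (hout : ∀ e, ∃ y, S.o y = S.t e) :
    Nat.card (S.heads ν) ≤ 4 * S.cycleRank := by
  have h1 := card_not_good_le hin hout
  have h2 := card_circleReps_le hν
  have h3 := Set.ncard_union_le {e | ¬ S.IsGood (S.o e)} (S.circleReps ν)
  rw [Nat.card_coe_set_eq] at h2 ⊢
  unfold heads
  omega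

end LGraph

/-! ### Comparison with the Betti number and with the long edges -/

namespace MGraph

variable {Γ : MGraph.{u₁, v₁}} {Δ : MGraph.{u₂, v₂}} {γ : Hom Γ Δ} (hγ : γ.IsForwardsImmersion)

/-- Extension of chains by zero is injective and commutes with the boundary maps. -/
theorem cycleRank_labelled_le [Finite Γ.E] (F : Set Γ.E) (W : Set Γ.V)
    [Fintype (γ.labelled hγ F W).E] : (γ.labelled hγ F W).cycleRank ≤ Γ.betti₁ := by
  classical
  let S := γ.labelled hγ F W
  let φ : (S.E → ℚ) →ₗ[ℚ] (Γ.E →₀ ℚ) :=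
    Fintype.linearCombination ℚ fun e : S.E => Finsupp.single (Subtype.val (p := (· ∈ F)) e) 1
  have hφ : ∀ y, Γ.boundary (φ y) = S.boundary y := fun y => by
    simp only [φ, LGraph.boundary, boundary, Fintype.linearCombination_apply, map_sum, map_smul,
      Finsupp.lift_apply]
    refine Finset.sum_congr rfl fun e _ => ?_
    rw [Finsupp.sum_single_index (by simp), one_smul]
    rfl
  have hval : ∀ y (e : S.E), φ y (Subtype.val (p := (· ∈ F)) e) = y e := fun y e => by
    simp only [φ, Fintype.linearCombination_apply, Finsupp.coe_finsetSum, Finset.sum_apply,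
      Finsupp.coe_smul, Pi.smul_apply, Finsupp.single_apply]
    rw [Finset.sum_eq_single e]
    · simp
    · intro e' _ hne
      rw [if_neg fun h => hne (Subtype.ext h), smul_zero]
    · simp
  refine LinearMap.finrank_le_finrank_of_injective
    (f := (φ.domRestrict (LinearMap.ker S.boundary)).codRestrict (LinearMap.ker Γ.boundary)
      fun y => ?_) ((injective_iff_map_eq_zero _).2 fun y h0 => Subtype.ext (funext fun e => ?_))
  · rw [LinearMap.mem_ker, LinearMap.domRestrict_apply, hφ]
    exact y.2
  · have h1 : φ y.1 = 0 := congrArg Subtype.val h0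
    refine (hval y.1 e).symm.trans ?_
    rw [h1]
    rfl

theorem betti₁_le_cycleRank [Finite Γ.E] (W : Set Γ.V)
    [Fintype (γ.labelled hγ Set.univ W).E] :
    Γ.betti₁ ≤ (γ.labelled hγ Set.univ W).cycleRank := by
  classical
  have := Fintype.ofFinite Γ.E
  let S := γ.labelled hγ Set.univ W
  let φ : (Γ.E →₀ ℚ) →ₗ[ℚ] (S.E → ℚ) :=
    { toFun := fun x e => x (Subtype.val (p := (· ∈ Set.univ)) e)
      map_add' := fun _ _ => rfl
      map_smul' := fun _ _ => rfl }
  have hφ : ∀ x, S.boundary (φ x) = Γ.boundary x := fun x => by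
    have e : Γ.boundary x =
        ∑ e, x e • ((Finsupp.single (Γ.t e) 1 : Γ.V →₀ ℚ) - Finsupp.single (Γ.o e) 1) := by
      rw [boundary, Finsupp.lift_apply]
      exact Finsupp.sum_fintype x _ fun _ => zero_smul _ _
    rw [LGraph.boundary, Fintype.linearCombination_apply]
    refine Eq.trans ?_ e.symm
    let ε : S.E ≃ Γ.E := Equiv.Set.univ Γ.E
    exact Fintype.sum_equiv ε _ _ fun e => rfl
  refine LinearMap.finrank_le_finrank_of_injective
    (f := (φ.domRestrict (LinearMap.ker Γ.boundary)).codRestrict (LinearMap.ker S.boundary)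
      fun y => ?_) ((injective_iff_map_eq_zero _).2 fun y h0 => Subtype.ext (Finsupp.ext fun e => ?_))
  · rw [LinearMap.mem_ker, LinearMap.domRestrict_apply, hφ]
    exact y.2
  · have h1 : φ y.1 = 0 := congrArg Subtype.val h0
    exact congrFun h1 ⟨e, trivial⟩

theorem ncard_eq_one_iff_existsUnique {α : Type*} (s : Set α) :
    s.ncard = 1 ↔ ∃! x, x ∈ s := by
  rw [Set.ncard_eq_one]
  constructor
  · rintro ⟨a, rfl⟩
    exact ⟨a, rfl, fun _ h => h⟩
  · rintro ⟨a, ha, h⟩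
    exact ⟨a, Set.eq_singleton_iff_unique_mem.2 ⟨ha, h⟩⟩

theorem isGood_labelled_univ (W : Set Γ.V) (v : Γ.V) :
    (γ.labelled hγ Set.univ W).IsGood v ↔ v ∉ Γ.Vbar := by
  have key : ∀ p : Γ.E → Prop, (∃! e : (Set.univ : Set Γ.E), p e) ↔ {e | p e}.ncard = 1 := by
    intro p
    rw [ncard_eq_one_iff_existsUnique]
    exact (Equiv.Set.univ Γ.E).existsUnique_congr fun {_} => Iff.rfl
  have h1 := key fun e => Γ.t e = v
  have h2 := key fun e => Γ.o e = v
  simp only [Vbar, Set.mem_ofPred_eq, not_or, not_not]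
  exact and_congr h1 h2

/-- The chain that begins at a head is a long edge. -/
theorem fibre_mem_Ebar [Finite Γ.E] (W : Set Γ.V) {ν : (γ.labelled hγ Set.univ W).E → ℕ}
    (hν : Function.Injective ν) (h : (γ.labelled hγ Set.univ W).heads ν) :
    {e : Γ.E | ((γ.labelled hγ Set.univ W).headChains ν).idx
      (⟨e, trivial⟩ : (Set.univ : Set Γ.E)) = h} ∈ Γ.Ebar := by
  let S := γ.labelled hγ Set.univ W
  have : Finite S.E := inferInstanceAs (Finite (Set.univ : Set Γ.E))
  have : Nonempty S.E := ⟨h.1⟩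
  let C : S.Chains (S.heads ν) := S.headChains ν
  obtain ⟨u, hu, hu'⟩ := C.exists_enum h
  set m := {e | C.idx e = h}.ncard
  have hm : 0 < m := lt_of_le_of_lt (Nat.zero_le _) (hu' h.1 (LGraph.headChains_idx_head h)).1
  obtain ⟨h0, hend⟩ := LGraph.headChains_end hν h hm hu hu'
  let w : ℤ → Γ.E := fun i => Subtype.val (p := (· ∈ Set.univ)) (u i)
  have winj : ∀ i j : ℤ, 0 ≤ i → i < m → 0 ≤ j → j < m → w i = w j → i = j :=
    fun i j hi hi' hj hj' hw => hu.inj hi hi' hj hj' (Subtype.ext hw)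
  have wt : ∀ i : ℤ, 0 ≤ i → i + 1 < m → Γ.t (w i) = Γ.o (w (i + 1)) :=
    fun i hi hi' => hu.t_eq hi hi'
  have wgood : ∀ i : ℤ, 0 ≤ i → i + 1 < m → Γ.o (w (i + 1)) ∉ Γ.Vbar := fun i hi hi' =>
    (isGood_labelled_univ hγ W _).1 (LGraph.headChains_isGood (hu.pos_succ hi hi'))
  have wmem : ∀ e : Γ.E, C.idx (⟨e, trivial⟩ : (Set.univ : Set Γ.E)) = h ↔
      ∃ i : ℕ, i < m ∧ w i = e := by
    intro e
    constructor
    · intro he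
      obtain ⟨l1, l2⟩ := hu' _ he
      exact ⟨_, l1, congrArg (Subtype.val (p := (· ∈ Set.univ))) l2⟩
    · rintro ⟨i, hi, rfl⟩
      exact (hu i (by omega) (by omega)).1
  rcases hend with ⟨b1, b2⟩ | ⟨g1, g2⟩
  · left
    have b1 : Γ.o (w 0) ∈ Γ.Vbar := by
      by_contra hn
      exact b1 ((isGood_labelled_univ hγ W _).2 hn)
    have b2 : Γ.t (w (m - 1)) ∈ Γ.Vbar := by
      by_contra hn
      exact b2 ((isGood_labelled_univ hγ W _).2 hn)
    let p : Path Γ m :=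
      -- The last vertex is not the origin of an edge at an index below `m`, so all vertices but the
      -- first are read as targets.
      { onV := fun i : Fin (m + 1) =>
          if (i : ℕ) = 0 then Γ.o (w 0) else Γ.t (w ((i : ℕ) - 1 : ℤ))
        onE := fun i : Fin m => w (i : ℕ)
        o_comm := fun i : Fin m => by
          change (if ((i.castSucc : Fin (m + 1)) : ℕ) = 0 then Γ.o (w 0) else
            Γ.t (w (((i.castSucc : Fin (m + 1)) : ℕ) - 1 : ℤ))) = Γ.o (w (i : ℕ))
          rw [Fin.val_castSucc]
          split_ifs with hi
          · rw [hi]; rfl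
          · rw [wt _ (by omega) (by omega)]
            congr 2
            ring
        t_comm := fun i : Fin m => by
          change (if ((i.succ : Fin (m + 1)) : ℕ) = 0 then Γ.o (w 0) else
            Γ.t (w (((i.succ : Fin (m + 1)) : ℕ) - 1 : ℤ))) = Γ.t (w (i : ℕ))
          rw [Fin.val_succ, if_neg (by omega)]
          congr 2
          push_cast
          ring
        map_Vi := fun _ h => h.elim
        map_Vf := fun _ h => h.elim }
    refine ⟨m, hm, p, fun (i j : Fin m) hij => ?_, fun i => ?_, ?_⟩
    · have := winj (i : ℕ) (j : ℕ) (by omega) (by omega) (by omega) (by omega) hij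
      exact Fin.ext (by omega)
    · change (if (i : ℕ) = 0 then Γ.o (w 0) else Γ.t (w ((i : ℕ) - 1 : ℤ))) ∈ Γ.Vbar ↔ _
      rw [Fin.ext_iff, Fin.ext_iff, Fin.val_last, Fin.val_zero]
      split_ifs with hi
      · exact ⟨fun _ => Or.inl hi, fun _ => b1⟩
      · by_cases hl : (i : ℕ) = m
        · rw [hl]
          exact ⟨fun _ => Or.inr rfl, fun _ => b2⟩
        · rw [wt _ (by omega) (by omega)]
          refine ⟨fun hb => absurd hb (wgood _ (by omega) (by omega)), fun hb => ?_⟩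
          omega
    · ext e
      rw [Set.mem_ofPred_eq, wmem]
      exact ⟨fun ⟨i, hi, hw⟩ => ⟨(⟨i, hi⟩ : Fin m), hw⟩, fun ⟨(i : Fin m), hw⟩ => ⟨i, i.2, hw⟩⟩
  · right
    have g1 : Γ.o (w 0) ∉ Γ.Vbar := (isGood_labelled_univ hγ W _).1 g1
    have g2 : Γ.t (w (m - 1)) = Γ.o (w 0) := g2
    have : NeZero m := ⟨hm.ne'⟩
    have hm' : (0 : ℤ) < m := by exact_mod_cast hm
    have cw : ∀ k : ℤ, Γ.t (w (k % m)) = Γ.o (w ((k + 1) % m)) := fun k => by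
      have l1 := Int.emod_nonneg k hm'.ne'
      have l2 := Int.emod_lt_of_pos k hm'
      rcases (show k % m + 1 ≤ m by omega).eq_or_lt with hE | hlt
      · have e1 : k % m = m - 1 := by omega
        have e2 : (k + 1) % m = 0 := by
          rw [← Int.emod_add_emod, hE, Int.emod_self]
        rw [e1, e2, g2]
      · have e2 : (k + 1) % m = k % m + 1 := by
          rw [← Int.emod_add_emod, Int.emod_eq_of_lt (by omega) hlt]
        rw [e2]
        exact wt _ l1 hlt
    have cp : ∀ k : ℤ, w ((k + m) % m) = w (k % m) := fun k => by rw [Int.add_emod_right]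
    let f : Cyc Γ m := cycOfWalk (fun k => w (k % m)) m cw cp
    have hfE : ∀ i : ZMod m, f.onE i = w (i.val : ℕ) := fun i => by
      have := cycOfWalk_onE (Γ := Γ) (c := fun k => w (k % m)) (n := m) cw cp (i.val : ℤ)
      rw [Int.cast_natCast, ZMod.natCast_zmod_val] at this
      refine this.trans (congrArg w (Int.emod_eq_of_lt (by omega) ?_))
      exact_mod_cast ZMod.val_lt i
    refine ⟨m, hm, f, fun (i j : ZMod m) hij => ?_, fun (i : ZMod m) => ?_, ?_⟩
    · rw [hfE, hfE] at hij
      have l1 := ZMod.val_lt i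
      have l2 := ZMod.val_lt j
      have := winj _ _ (by omega) (by omega) (by omega) (by omega) hij
      exact ZMod.val_injective m (by omega)
    · have e : f.onV i = Γ.o (w (i.val : ℕ)) := (f.o_comm i).trans (congrArg Γ.o (hfE i))
      have l1 := ZMod.val_lt i
      rw [e]
      rcases Nat.eq_zero_or_pos i.val with hi | hi
      · rw [hi]; exact g1
      · have := wgood (i.val - 1) (by omega) (by omega)
        rwa [sub_add_cancel] at this
    · ext e
      rw [Set.mem_ofPred_eq, wmem]
      constructor
      · rintro ⟨i, hi, rfl⟩
        refine ⟨((i : ZMod m)), ?_⟩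
        rw [hfE, ZMod.val_cast_of_lt hi]
      · rintro ⟨(i : ZMod m), rfl⟩
        exact ⟨i.val, ZMod.val_lt i, (hfE i).symm⟩

/-- Each head lies in its own chain, so different heads give different long edges. -/
theorem card_heads_le_ncard_Ebar [Finite Γ.E] (W : Set Γ.V)
    {ν : (γ.labelled hγ Set.univ W).E → ℕ} (hν : Function.Injective ν) :
    Nat.card ((γ.labelled hγ Set.univ W).heads ν) ≤ Γ.Ebar.ncard := by
  rw [← Nat.card_coe_set_eq Γ.Ebar]
  refine Nat.card_le_card_of_injective
    (fun h => (⟨_, fibre_mem_Ebar hγ W hν h⟩ : Γ.Ebar)) fun h h' hh => ?_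
  have h1 := congrArg Subtype.val hh
  simp only at h1
  have h2 : Subtype.val (p := (· ∈ Set.univ)) h.1 ∈ {e : Γ.E |
      ((γ.labelled hγ Set.univ W).headChains ν).idx
        (⟨e, trivial⟩ : (Set.univ : Set Γ.E)) = h} := LGraph.headChains_idx_head h
  rw [h1] at h2
  exact (LGraph.headChains_idx_head h).symm.trans h2

end MGraph

/-! ### The constants and the theorem -/

namespace LGraph

/-- The gates contribute `4 * 16`, the thresholds `8 * 12 * 2` and the remaining terms `2`; the
linear terms are absorbed because `c` and `c'` are at least `1`. -/
theorem pairBound_le {N N' ν ν' b b' c c' : ℕ} (h : N + ν ≤ c) (h' : N' + ν' ≤ c') (hb : b ≤ c)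
    (hb' : b' ≤ c') (hc : 1 ≤ c) (hc' : 1 ≤ c') :
    pairBound N N' ν ν' (12 * b) (12 * b') ≤ 258 * c * c' := by
  unfold pairBound
  have h1 : 2 * (N + ν + 1) * (2 * (N' + ν' + 1)) ≤ (4 * c) * (4 * c') :=
    Nat.mul_le_mul (by omega) (by omega)
  have h2 : (N + ν) * (N' + ν') ≤ c * c' := Nat.mul_le_mul h h'
  have h3 : c ≤ c * c' := Nat.le_mul_of_pos_right c hc'
  have h4 : c' ≤ c * c' := Nat.le_mul_of_pos_left c' hc
  nlinarith [Nat.zero_le (N * ν'), Nat.zero_le (ν * N'), Nat.zero_le (N * N')]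

end LGraph

namespace MGraph

variable {Γ : MGraph.{u₁, v₁}} {Λ : MGraph.{u₂, v₂}} {Δ : MGraph.{u₃, v₃}} {γ : Hom Γ Δ}
  {lam : Hom Λ Δ}

/-- All edges are kept. The chains number at most `|Ē|` and at least `β₁`, so `graphConst` may serve
as `c` and `c'`, and `258 ≤ 508`. -/
theorem ncard_rcore_diff_le [Finite Γ.V] [Finite Γ.E] [Finite Λ.V] [Finite Λ.E]
    (hγ : γ.IsForwardsImmersion) (hlam : lam.IsForwardsImmersion) :
    ((rcore (fibreProd γ lam)).edges \ longImageEdges γ lam).ncard ≤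
      508 * Γ.graphConst * Λ.graphConst *
        (Λ.Ebar.ncard * Nat.card Γ.E + Γ.Ebar.ncard * Nat.card Λ.E) := by
  let S := γ.labelled hγ Set.univ Γ.Vi
  let S' := lam.labelled hlam Set.univ Λ.Vi
  have : Finite S.E := inferInstanceAs (Finite (Set.univ : Set Γ.E))
  have : Finite S'.E := inferInstanceAs (Finite (Set.univ : Set Λ.E))
  have := Fintype.ofFinite S.E
  have := Fintype.ofFinite S'.E
  obtain ⟨ν, hν⟩ := exists_injective_nat S.E
  obtain ⟨ν', hν'⟩ := exists_injective_nat S'.E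
  have key := ncard_diff_longImageEdges_le (F := Set.univ) (F' := Set.univ)
    (T := (rcore (fibreProd γ lam)).edges) hγ hlam
    (fun _ _ => ⟨trivial, trivial⟩) (rcore_edges_back _) (S.headChains ν) (S'.headChains ν')
    (Set.toFinite _) (Set.toFinite _)
  rcases Set.eq_empty_or_nonempty ((rcore (fibreProd γ lam)).edges \ longImageEdges γ lam)
    with h0 | ⟨e, -⟩
  · rw [h0, Set.ncard_empty]
    exact Nat.zero_le _
  have p : 0 < Nat.card (S.heads ν) :=
    have : Nonempty (S.heads ν) := ⟨(S.headChains ν).idx (⟨e.1.1, trivial⟩ : (Set.univ : Set Γ.E))⟩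
    Nat.card_pos
  have p' : 0 < Nat.card (S'.heads ν') :=
    have : Nonempty (S'.heads ν') :=
      ⟨(S'.headChains ν').idx (⟨e.1.2, trivial⟩ : (Set.univ : Set Λ.E))⟩
    Nat.card_pos
  have l : Nat.card (S.heads ν) ≤ Γ.Ebar.ncard := card_heads_le_ncard_Ebar hγ Γ.Vi hν
  have l' : Nat.card (S'.heads ν') ≤ Λ.Ebar.ncard := card_heads_le_ncard_Ebar hlam Λ.Vi hν'
  have b : Γ.betti₁ ≤ Nat.card (S.heads ν) :=
    (betti₁_le_cycleRank hγ Γ.Vi).trans (LGraph.cycleRank_le_card (S.headChains ν))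
  have b' : Λ.betti₁ ≤ Nat.card (S'.heads ν') :=
    (betti₁_le_cycleRank hlam Λ.Vi).trans (LGraph.cycleRank_le_card (S'.headChains ν'))
  refine key.trans (Nat.mul_le_mul ?_ (add_le_add (Nat.mul_le_mul_right _ l')
    (Nat.mul_le_mul_right _ l)))
  refine (LGraph.pairBound_le (c := Γ.graphConst) (c' := Λ.graphConst) ?_ ?_ ?_ ?_ ?_ ?_).trans ?_
  all_goals unfold graphConst
  · exact Nat.add_le_add_right l _
  · exact Nat.add_le_add_right l' _
  · omega
  · omega
  · omega
  · omega
  · gcongr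
    norm_num

/-- Only the edges of the cores are kept and no initial vertices are needed. There are at most `4 *
β₁` chains, so `c = 4 * Γ.betti₁` and `c' = 4 * Λ.betti₁`, and the constant is `258 * 16 * 4`. -/
theorem ncard_core_diff_le [Finite Γ.E] [Finite Λ.E]
    (hγ : γ.IsForwardsImmersion) (hlam : lam.IsForwardsImmersion) :
    ((core (fibreProd γ lam)).edges \ longImageEdges γ lam).ncard ≤
      16512 * (Γ.betti₁ * Λ.betti₁) ^ 2 * (Nat.card Γ.E + Nat.card Λ.E) := by
  let S := γ.labelled hγ Γ.core.edges ∅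
  let S' := lam.labelled hlam Λ.core.edges ∅
  have : Finite S.E := inferInstanceAs (Finite Γ.core.edges)
  have : Finite S'.E := inferInstanceAs (Finite Λ.core.edges)
  have := Fintype.ofFinite S.E
  have := Fintype.ofFinite S'.E
  obtain ⟨ν, hν⟩ := exists_injective_nat S.E
  obtain ⟨ν', hν'⟩ := exists_injective_nat S'.E
  have key := ncard_diff_longImageEdges_le (T := (core (fibreProd γ lam)).edges) hγ hlam
    (fun _ he => core_edges_fibreProd he) (fun e he => Or.inr (core_edges_back _ e he))
    (S.headChains ν) (S'.headChains ν') Set.finite_empty Set.finite_empty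
  rcases Set.eq_empty_or_nonempty ((core (fibreProd γ lam)).edges \ longImageEdges γ lam)
    with h0 | ⟨e, he, -⟩
  · rw [h0, Set.ncard_empty]
    exact Nat.zero_le _
  obtain ⟨he, he'⟩ := core_edges_fibreProd he
  have p : 0 < Nat.card (S.heads ν) :=
    have : Nonempty (S.heads ν) := ⟨(S.headChains ν).idx (⟨e.1.1, he⟩ : Γ.core.edges)⟩
    Nat.card_pos
  have p' : 0 < Nat.card (S'.heads ν') :=
    have : Nonempty (S'.heads ν') := ⟨(S'.headChains ν').idx (⟨e.1.2, he'⟩ : Λ.core.edges)⟩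
    Nat.card_pos
  have l : Nat.card (S.heads ν) ≤ 4 * Γ.betti₁ := by
    refine (LGraph.card_heads_le hν (fun (x : Γ.core.edges) => ?_)
      fun (x : Γ.core.edges) => ?_).trans (Nat.mul_le_mul_left _ (cycleRank_labelled_le hγ _ _))
    · obtain ⟨y, hy, h⟩ := core_edges_back Γ x x.2
      exact ⟨(⟨y, hy⟩ : Γ.core.edges), h⟩
    · obtain ⟨y, hy, h⟩ := core_edges_fwd Γ x x.2
      exact ⟨(⟨y, hy⟩ : Γ.core.edges), h⟩
  have l' : Nat.card (S'.heads ν') ≤ 4 * Λ.betti₁ := by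
    refine (LGraph.card_heads_le hν' (fun (x : Λ.core.edges) => ?_)
      fun (x : Λ.core.edges) => ?_).trans (Nat.mul_le_mul_left _ (cycleRank_labelled_le hlam _ _))
    · obtain ⟨y, hy, h⟩ := core_edges_back Λ x x.2
      exact ⟨(⟨y, hy⟩ : Λ.core.edges), h⟩
    · obtain ⟨y, hy, h⟩ := core_edges_fwd Λ x x.2
      exact ⟨(⟨y, hy⟩ : Λ.core.edges), h⟩
  rw [Set.ncard_empty, Set.ncard_empty] at key
  have hK := LGraph.pairBound_le (N := Nat.card (S.heads ν)) (N' := Nat.card (S'.heads ν')) (ν := 0)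
    (ν' := 0) (b := Γ.betti₁) (b' := Λ.betti₁) (c := 4 * Γ.betti₁) (c' := 4 * Λ.betti₁)
    l l' (by omega) (by omega) (by omega) (by omega)
  have q : 1 ≤ Γ.betti₁ := by omega
  have q' : 1 ≤ Λ.betti₁ := by omega
  have m : Nat.card (S.heads ν) ≤ 4 * (Γ.betti₁ * Λ.betti₁) :=
    l.trans (Nat.mul_le_mul_left _ (Nat.le_mul_of_pos_right _ q'))
  have m' : Nat.card (S'.heads ν') ≤ 4 * (Γ.betti₁ * Λ.betti₁) :=
    l'.trans (Nat.mul_le_mul_left _ (Nat.le_mul_of_pos_left _ q))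
  refine key.trans ((Nat.mul_le_mul hK (add_le_add (Nat.mul_le_mul_right _ m')
    (Nat.mul_le_mul_right _ m))).trans (le_of_eq ?_))
  ring

end MGraph

theorem mainTheorem3 :
    (∀ (Γ : MGraph.{u₁, v₁}) (Λ : MGraph.{u₂, v₂}) (Δ : MGraph.{u₃, v₃})
        [Finite Γ.V] [Finite Γ.E] [Finite Λ.V] [Finite Λ.E]
        (γ : MGraph.Hom Γ Δ) (lam : MGraph.Hom Λ Δ),
        γ.IsForwardsImmersion → lam.IsForwardsImmersion →
        Γ.Connected → Λ.Connected → Γ.IsRelCore → Λ.IsRelCore →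
        ((MGraph.rcore (MGraph.fibreProd γ lam)).edges \ MGraph.longImageEdges γ lam).ncard ≤
          508 * Γ.graphConst * Λ.graphConst *
            (Λ.Ebar.ncard * Nat.card Γ.E + Γ.Ebar.ncard * Nat.card Λ.E)) ∧
    (∃ C : ℕ, 0 < C ∧
      ∀ (Γ : MGraph.{u₁, v₁}) (Λ : MGraph.{u₂, v₂}) (Δ : MGraph.{u₃, v₃})
        [Finite Γ.V] [Finite Γ.E] [Finite Λ.V] [Finite Λ.E]
        (γ : MGraph.Hom Γ Δ) (lam : MGraph.Hom Λ Δ),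
        γ.IsForwardsImmersion → lam.IsForwardsImmersion →
        ((MGraph.core (MGraph.fibreProd γ lam)).edges \ MGraph.longImageEdges γ lam).ncard ≤
          C * (Γ.betti₁ * Λ.betti₁) ^ 2 * (Nat.card Γ.E + Nat.card Λ.E)) :=
  ⟨fun _ _ _ _ _ _ _ _ _ hγ hlam _ _ _ _ => MGraph.ncard_rcore_diff_le hγ hlam,
    16512, by norm_num, fun _ _ _ _ _ _ _ _ _ hγ hlam => MGraph.ncard_core_diff_le hγ hlam⟩
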